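/- An instance of the popular matching problem consists of a bipartite graph $G=(A\cup B,E)$ with a set $A$ of agents and a set $B$ of objects, together with, for every agent $a\in A$, a strict partial order $\succ_a$ (an irreflexive and transitive relation) on the neighbours of $a$; $a$ prefers $b$ to $b'$ if $b\succ_a b'$. For a matching $M$ write $M(a)$ for the object matched with an agent $a$ that is matched in $M$. For a positive integer $\kappa$, matchings $N,M$ in $G$ and an agent $a$ let $$\mathsf{vote}^\kappa_a(N,M)=\begin{cases}1&\text{if } a \text{ is matched in } N \text{ and } M \text{ and } N(a)\succ_a M(a),\\-1&\text{if } a \text{ is matched in } N \text{ and } M \text{ and } M(a)\succ_a N(a),\\ \kappa&\text{if } a \text{ is matched in } N \text{ but not in } M,\\-\kappa&\text{if } a \text{ is matched in } M \text{ but not in } N,\\0&\text{otherwise.}\end{cases}$$ A matching $M$ in $G$ is popular with penalty $\kappa$ if $\sum_{a\in A}\mathsf{vote}^\kappa_a(N,M)\le 0$ for every matching $N$ in $G$. Theorem. There is an algorithm that, given an instance $G=(A\cup B,E)$ of the popular matching problem with $|A\cup B|=n$ and an integer $\kappa\in\{1,\dots,n-1\}$, computes in $O(n^{7/2}\cdot\kappa^{5/2})$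 time a matching of $G$ that is popular with penalty $\kappa$ if $G$ admits such a matching, and reports that there is none otherwise. Here time is the number of steps on a word RAM with words of $O(\log n)$ bits (constant-time assignment, addition, truncated subtraction, multiplication, comparison and indirect memory access), and the input is given by $|A|$, $|B|$, $\kappa$, the adjacency table of $G$ and the table of the preference relations. -/

import Mathlib

/-- An instance with `p` agents and `q` objects: a bipartite graph given by its adjacency relation
`adj`, together with, for each agent `a`, a strict partial order `pref a` on the neighbours of `a`;
`pref a b b'` means that `a` prefers `b` to `b'`. -/
structure PopInstance (p q : ℕ) where
  adj : Fin p → Fin q → Prop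
  pref : Fin p → Fin q → Fin q → Prop
  pref_adj : ∀ a b b', pref a b b' → adj a b ∧ adj a b'
  pref_irrefl : ∀ a b, ¬ pref a b b
  pref_trans : ∀ a b b' b'', pref a b b' → pref a b' b'' → pref a b b''

namespace PopInstance

variable {p q : ℕ}

/-- A matching of the graph: `partner a` is the object that is matched with the agent `a`, or
`none` if `a` is unmatched. -/
structure Matching (G : PopInstance p q) where
  partner : Fin p → Option (Fin q)
  adj_of_partner : ∀ a b, partner a = some b → G.adj a b
  partner_inj : ∀ a a' b, partner a = some b → partner a' = some b → a = a'

open Classical in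
/-- The vote of agent `a` between the matchings `N` and `M` with penalty `κ`. -/
noncomputable def vote (G : PopInstance p q) (κ : ℕ) (N M : G.Matching) (a : Fin p) : ℤ :=
  match N.partner a, M.partner a with
  | some b, some b' => if G.pref a b b' then 1 else if G.pref a b' b then -1 else 0
  | some _, none => (κ : ℤ)
  | none, some _ => -(κ : ℤ)
  | none, none => 0

/-- `M` is popular with penalty `κ`: no matching `N` beats it. -/
def PopularWithPenalty (G : PopInstance p q) (κ : ℕ) (M : G.Matching) : Prop :=
  ∀ N : G.Matching, ∑ a : Fin p, G.vote κ N M a ≤ 0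

end PopInstance

/-! ### Machine model

Word RAM: finitely many registers (a program mentions only finitely many of them) and a random
access memory, all holding natural numbers below a word bound `W`. Programs are built
from primitive register and memory instructions by sequencing, branching and looping. -/

namespace WordRAM

/-- Registers and memory. -/
structure State where
  reg : ℕ → ℕ
  mem : ℕ → ℕ

/-- Write a register. -/
def State.setReg (s : State) (x v : ℕ) : State := ⟨Function.update s.reg x v, s.mem⟩

/-- Write a memory cell. -/
def State.setMem (s : State) (i v : ℕ) : State := ⟨s.reg, Function.update s.mem i v⟩

/-- Programs; the arguments `x`, `y`, `z` name registers. -/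
inductive Prog where
  /-- no operation -/
  | skip : Prog
  /-- `x := k` -/
  | const (x k : ℕ) : Prog
  /-- `x := y` -/
  | copy (x y : ℕ) : Prog
  /-- `x := y + z` -/
  | add (x y z : ℕ) : Prog
  /-- `x := max (y - z) 0` -/
  | sub (x y z : ℕ) : Prog
  /-- `x := y * z` -/
  | mul (x y z : ℕ) : Prog
  /-- `x := mem[y]` -/
  | load (x y : ℕ) : Prog
  /-- `mem[x] := y` -/
  | store (x y : ℕ) : Prog
  /-- first `P`, then `Q` -/
  | seq (P Q : Prog) : Prog
  /-- if `x < y` then `P` else `Q` -/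
  | cond (x y : ℕ) (P Q : Prog) : Prog
  /-- while `x < y` do `P` -/
  | loop (x y : ℕ) (P : Prog) : Prog

/-- `Exec W P s t s'`: on a machine whose words hold the numbers below `W`, the program `P` started
in state `s` halts in state `s'` after exactly `t` steps. Every primitive instruction and every
evaluation of a test counts as one step. An instruction whose result does not fit into a word has
no successor state, so that such a run does not count as halting. -/
inductive Exec (W : ℕ) : Prog → State → ℕ → State → Prop where
  | skip (s : State) : Exec W .skip s 1 s
  | const (s : State) (x k : ℕ) (h : k < W) : Exec W (.const x k) s 1 (s.setReg x k)
  | copy (s : State) (x y : ℕ) (h : s.reg y < W) : Exec W (.copy x y) s 1 (s.setReg x (s.reg y))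
  | add (s : State) (x y z : ℕ) (h : s.reg y + s.reg z < W) :
      Exec W (.add x y z) s 1 (s.setReg x (s.reg y + s.reg z))
  | sub (s : State) (x y z : ℕ) (h : s.reg y - s.reg z < W) :
      Exec W (.sub x y z) s 1 (s.setReg x (s.reg y - s.reg z))
  | mul (s : State) (x y z : ℕ) (h : s.reg y * s.reg z < W) :
      Exec W (.mul x y z) s 1 (s.setReg x (s.reg y * s.reg z))
  | load (s : State) (x y : ℕ) (ha : s.reg y < W) (h : s.mem (s.reg y) < W) :
      Exec W (.load x y) s 1 (s.setReg x (s.mem (s.reg y)))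
  | store (s : State) (x y : ℕ) (ha : s.reg x < W) (h : s.reg y < W) :
      Exec W (.store x y) s 1 (s.setMem (s.reg x) (s.reg y))
  | seq {P Q : Prog} {s s' s'' : State} {t t' : ℕ} (h : Exec W P s t s') (h' : Exec W Q s' t' s'') :
      Exec W (.seq P Q) s (t + t') s''
  | condTrue {x y : ℕ} {P Q : Prog} {s s' : State} {t : ℕ} (hxy : s.reg x < s.reg y)
      (h : Exec W P s t s') : Exec W (.cond x y P Q) s (t + 1) s'
  | condFalse {x y : ℕ} {P Q : Prog} {s s' : State} {t : ℕ} (hxy : ¬ s.reg x < s.reg y)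
      (h : Exec W Q s t s') : Exec W (.cond x y P Q) s (t + 1) s'
  | loopTrue {x y : ℕ} {P : Prog} {s s' s'' : State} {t t' : ℕ} (hxy : s.reg x < s.reg y)
      (h : Exec W P s t s') (h' : Exec W (.loop x y P) s' t' s'') :
      Exec W (.loop x y P) s (t + t' + 1) s''
  | loopFalse {x y : ℕ} {P : Prog} {s : State} (hxy : ¬ s.reg x < s.reg y) :
      Exec W (.loop x y P) s 1 s

/-- Runs are deterministic: the step count and the final state are determined by the program and
the initial state. -/
theorem Exec.unique {W : ℕ} {P : Prog} {s s₁ s₂ : State} {t₁ t₂ : ℕ} (h₁ : Exec W P s t₁ s₁)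
    (h₂ : Exec W P s t₂ s₂) : t₁ = t₂ ∧ s₁ = s₂ := by
  induction h₁ generalizing t₂ s₂ with
  | seq _ _ ih ih' =>
    cases h₂ with
    | seq h h' =>
      obtain ⟨rfl, rfl⟩ := ih h
      obtain ⟨rfl, rfl⟩ := ih' h'
      exact ⟨rfl, rfl⟩
  | condTrue hxy _ ih =>
    cases h₂ with
    | condTrue _ h => obtain ⟨rfl, rfl⟩ := ih h; exact ⟨rfl, rfl⟩
    | condFalse hn _ => exact absurd hxy hn
  | condFalse hxy _ ih =>
    cases h₂ with
    | condTrue hn _ => exact absurd hn hxy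
    | condFalse _ h => obtain ⟨rfl, rfl⟩ := ih h; exact ⟨rfl, rfl⟩
  | loopTrue hxy _ _ ih ih' =>
    cases h₂ with
    | loopTrue _ h h' =>
      obtain ⟨rfl, rfl⟩ := ih h
      obtain ⟨rfl, rfl⟩ := ih' h'
      exact ⟨rfl, rfl⟩
    | loopFalse hn => exact absurd hxy hn
  | loopFalse hxy =>
    cases h₂ with
    | loopTrue hn _ _ => exact absurd hn hxy
    | loopFalse _ => exact ⟨rfl, rfl⟩
  | _ => cases h₂; exact ⟨rfl, rfl⟩

end WordRAM

namespace PopInstance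

variable {p q : ℕ}

open Classical in
/-- Initial memory: the `p × q` adjacency table of `G` in the cells `a * q + b`, followed by the
`p × q × q` preference table in the cells `p * q + ((a * q + b) * q + b')`; table entries are `0`
or `1`, and all further cells hold `0`. -/
noncomputable def inputMem (G : PopInstance p q) (i : ℕ) : ℕ :=
  if (∃ (a : Fin p) (b : Fin q), i = a * q + b ∧ G.adj a b) ∨
    (∃ (a : Fin p) (b b' : Fin q), i = p * q + ((a * q + b) * q + b') ∧ G.pref a b b')
  then 1 else 0

/-- Initial registers: the registers `0`, `1`, `2` hold `p`, `q`, `κ`, all others hold `0`. -/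
def inputReg (p q κ : ℕ) : ℕ → ℕ
  | 0 => p
  | 1 => q
  | 2 => κ
  | _ => 0

/-- The machine state that presents the instance `G` and the penalty `κ`. -/
noncomputable def inputState (G : PopInstance p q) (κ : ℕ) : WordRAM.State :=
  ⟨inputReg p q κ, G.inputMem⟩

/-- The memory cells `0, …, p - 1` of the state `s` hold the matching `M`: cell `a` holds `0` if
agent `a` is unmatched, and `b + 1` if `a` is matched with object `b`. -/
def Outputs {G : PopInstance p q} (s : WordRAM.State) (M : G.Matching) : Prop :=
  ∀ a : Fin p, s.mem a = match M.partner a with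
    | none => 0
    | some b => (b : ℕ) + 1

end PopInstance

/-! Duality turns popularity into prices. Complete a matching of `G` to a perfect matching between
objects and private dummies on the left and agents and absorbing nodes on the right: an agent that
takes its dummy is unmatched, and an unused object or dummy goes to an absorbing node. Weight each
edge at an agent by the vote of that agent against `M`, and every other edge by zero. If `M` is
popular, its completion has maximum weight, and integral dual potentials
(`exists_assignment_potentials`) collapse to object prices in `{0, …, κ}` (`exists_prices`). At
these prices the vote of a matched agent for switching to a neighbour never exceeds the increase in
price, an agent stays unmatched only if all its neighbours cost `κ`, and every object of positive
price is matched. Conversely, summing these conditions over the agents shows that such prices force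
popularity (`popular_of_prices`). Thus a popular matching exists exactly if, for some prices `y`,
the graph of edges `Allowed` at `y` has a perfect matching.

Such prices are sought from above. All prices start at `κ`, and the current `y` always dominates
every `z` that admits a perfect matching. Take a maximum matching of the graph at `y`. If it is
perfect, it yields the answer. Otherwise let `x₀` be a free left node, and let `U` be the set of
left nodes from which no alternating path leads to a free right node; it contains `x₀`. Suppose that
`z ≤ y` admits a perfect matching `f`. Following `f` at `z` and then going back along the current
matching permutes the nodes of `U` with `z x = y x`; since `x₀` is nobody's mate, `z x₀ < y x₀`
(`not_tight_of_closed`). So the price of `x₀` may be lowered by one, and if it is already zero there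
is no popular matching. Each failure lowers one price, hence there are at most `q * κ + 1` rounds.

With `N = p + q` and `L` about `√N`, a round takes `O(N² L)` steps. An auction with labels up to `L`
finds a matching that lacks at most `L` edges (`matchSize_le_of_labels`), at most `L + 1` searches
of `O(N²)` steps complete it, and the table of allowed edges is updated, not recomputed, after a
price change. The total is `O(N ^ (7/2) * κ)`, which is within the claimed bound because `1 ≤ κ`.

The algorithm is written in a small structured language. Its weakest preconditions treat the elapsed
time as part of the state, and `Cmd.wp_sound` transfers them to the compiled machine code. -/

namespace WordRAM

/-! ### A structured language, its compiler, and a calculus of total correctness with time. -/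

/-- Arithmetic expressions over variables and arrays. -/
inductive Ex where
  | lit (k : ℕ) : Ex
  | var (x : ℕ) : Ex
  | add (e f : Ex) : Ex
  | sub (e f : Ex) : Ex
  | mul (e f : Ex) : Ex
  | get (j : ℕ) (e : Ex) : Ex

instance : Add Ex := ⟨Ex.add⟩
instance : Sub Ex := ⟨Ex.sub⟩
instance : Mul Ex := ⟨Ex.mul⟩
instance (n : ℕ) : OfNat Ex n := ⟨Ex.lit n⟩

/-- Structured commands over variables and arrays. -/
inductive Cmd where
  | skip : Cmd
  | asg (x : ℕ) (e : Ex) : Cmd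
  | put (j : ℕ) (e f : Ex) : Cmd
  | seq (c d : Cmd) : Cmd
  | ite (e f : Ex) (c d : Cmd) : Cmd
  | loop (e f : Ex) (c : Cmd) : Cmd

infixr:60 " ;; " => Cmd.seq

/-- Abstract states: variables, arrays and elapsed time. -/
structure St where
  v : ℕ → ℕ
  a : ℕ → ℕ → ℕ
  time : ℕ

/-- Assign a variable, spending `t` steps. -/
def St.asg (σ : St) (x n t : ℕ) : St := ⟨Function.update σ.v x n, σ.a, σ.time + t⟩

/-- Assign an array cell, spending `t` steps. -/
def St.put (σ : St) (j i n t : ℕ) : St :=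
  ⟨σ.v, Function.update σ.a j (Function.update (σ.a j) i n), σ.time + t⟩

/-- Spend `t` steps. -/
def St.tick (σ : St) (t : ℕ) : St := ⟨σ.v, σ.a, σ.time + t⟩

section StLemmas

variable (σ : St) (x n t j i : ℕ)

@[simp] theorem St.asg_v : (σ.asg x n t).v = Function.update σ.v x n := rfl
@[simp] theorem St.asg_a : (σ.asg x n t).a = σ.a := rfl
@[simp] theorem St.asg_time : (σ.asg x n t).time = σ.time + t := rfl
@[simp] theorem St.put_v : (σ.put j i n t).v = σ.v := rfl
@[simp] theorem St.put_a :
    (σ.put j i n t).a = Function.update σ.a j (Function.update (σ.a j) i n) := rfl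
@[simp] theorem St.put_time : (σ.put j i n t).time = σ.time + t := rfl
@[simp] theorem St.tick_v : (σ.tick t).v = σ.v := rfl
@[simp] theorem St.tick_a : (σ.tick t).a = σ.a := rfl
@[simp] theorem St.tick_time : (σ.tick t).time = σ.time + t := rfl

end StLemmas

namespace Ex

/-- The value of an expression. -/
def eval (σ : St) : Ex → ℕ
  | lit k => k
  | var x => σ.v x
  | add e f => e.eval σ + f.eval σ
  | sub e f => e.eval σ - f.eval σ
  | mul e f => e.eval σ * f.eval σ
  | get j e => σ.a j (e.eval σ)

/-- The number of steps that the evaluation takes. -/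
def cost : Ex → ℕ
  | lit _ => 1
  | var _ => 1
  | add e f => e.cost + f.cost + 1
  | sub e f => e.cost + f.cost + 1
  | mul e f => e.cost + f.cost + 1
  | get _ e => e.cost + 4

/-- No intermediate value overflows, and all array indices are in range. -/
def ok (W K : ℕ) (σ : St) : Ex → Prop
  | lit _ => True
  | var _ => True
  | add e f => e.ok W K σ ∧ f.ok W K σ ∧ e.eval σ + f.eval σ < W
  | sub e f => e.ok W K σ ∧ f.ok W K σ
  | mul e f => e.ok W K σ ∧ f.ok W K σ ∧ e.eval σ * f.eval σ < W
  | get _ e => e.ok W K σ ∧ e.eval σ < K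

/-- Literals, variables and arrays are within the fixed static bounds. -/
def wf : Ex → Bool
  | lit k => k < 256
  | var x => x < 40
  | add e f => e.wf && f.wf
  | sub e f => e.wf && f.wf
  | mul e f => e.wf && f.wf
  | get j e => j < 16 && e.wf

/-- Code that leaves the value of the expression in register `d`; it uses registers from `d` on. -/
def code : Ex → ℕ → Prog
  | lit k, d => .const d k
  | var x, d => .copy d x
  | add e f, d => .seq (e.code d) (.seq (f.code (d + 1)) (.add d d (d + 1)))
  | sub e f, d => .seq (e.code d) (.seq (f.code (d + 1)) (.sub d d (d + 1)))
  | mul e f, d => .seq (e.code d) (.seq (f.code (d + 1)) (.mul d d (d + 1)))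
  | get j e, d => .seq (e.code d) (.seq (.const (d + 1) j) (.seq (.mul (d + 1) (d + 1) 40)
      (.seq (.add d d (d + 1)) (.load d d))))

section

variable (W K : ℕ) (σ : St) (e f : Ex) (n j : ℕ)

@[simp] theorem eval_ofNat : (no_index (OfNat.ofNat n) : Ex).eval σ = OfNat.ofNat n := rfl
@[simp] theorem eval_var : (var n).eval σ = σ.v n := rfl
@[simp] theorem eval_add : (e + f).eval σ = e.eval σ + f.eval σ := rfl
@[simp] theorem eval_sub : (e - f).eval σ = e.eval σ - f.eval σ := rfl
@[simp] theorem eval_mul : (e * f).eval σ = e.eval σ * f.eval σ := rfl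
@[simp] theorem eval_get : (get j e).eval σ = σ.a j (e.eval σ) := rfl
@[simp] theorem cost_ofNat : (no_index (OfNat.ofNat n) : Ex).cost = 1 := rfl
@[simp] theorem cost_var : (var n).cost = 1 := rfl
@[simp] theorem cost_add : (e + f).cost = e.cost + f.cost + 1 := rfl
@[simp] theorem cost_sub : (e - f).cost = e.cost + f.cost + 1 := rfl
@[simp] theorem cost_mul : (e * f).cost = e.cost + f.cost + 1 := rfl
@[simp] theorem cost_get : (get j e).cost = e.cost + 4 := rfl
@[simp] theorem ok_ofNat : (no_index (OfNat.ofNat n) : Ex).ok W K σ ↔ True := Iff.rfl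
@[simp] theorem ok_var : (var n).ok W K σ ↔ True := Iff.rfl
@[simp] theorem ok_add :
    (e + f).ok W K σ ↔ e.ok W K σ ∧ f.ok W K σ ∧ e.eval σ + f.eval σ < W := Iff.rfl
@[simp] theorem ok_sub : (e - f).ok W K σ ↔ e.ok W K σ ∧ f.ok W K σ := Iff.rfl
@[simp] theorem ok_mul :
    (e * f).ok W K σ ↔ e.ok W K σ ∧ f.ok W K σ ∧ e.eval σ * f.eval σ < W := Iff.rfl
@[simp] theorem ok_get : (get j e).ok W K σ ↔ e.ok W K σ ∧ e.eval σ < K := Iff.rfl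

end

end Ex

/-- The machine state `s` represents the abstract state `σ`: the variables are the registers below
`40`, register `40` holds `K`, and array `j` occupies the `K` cells from `j * K` on. -/
structure Rel (W K : ℕ) (s : State) (σ : St) : Prop where
  reg : ∀ x < 40, s.reg x = σ.v x
  size : s.reg 40 = K
  mem : ∀ j < 16, ∀ i < K, s.mem (j * K + i) = σ.a j i
  reg_lt : ∀ x < 40, σ.v x < W
  mem_lt : ∀ j < 16, ∀ i < K, σ.a j i < W

theorem Rel.of_agree {W K : ℕ} {s s' : State} {σ : St} (h : Rel W K s σ)
    (hr : ∀ y < 41, s'.reg y = s.reg y) (hm : s'.mem = s.mem) : Rel W K s' σ :=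
  ⟨fun x hx => (hr x (by omega)).trans (h.reg x hx), (hr 40 (by omega)).trans h.size,
    fun j hj i hi => by rw [hm]; exact h.mem j hj i hi, h.reg_lt, h.mem_lt⟩

theorem Rel.tick {W K : ℕ} {s : State} {σ : St} (h : Rel W K s σ) (t : ℕ) : Rel W K s (σ.tick t) :=
  ⟨h.reg, h.size, h.mem, h.reg_lt, h.mem_lt⟩

theorem cell_lt {K j i : ℕ} (hj : j < 16) (hi : i < K) : j * K + i < 16 * K := by
  have : (j + 1) * K ≤ 16 * K := Nat.mul_le_mul_right K hj
  rw [Nat.add_mul] at this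
  omega

/-- Uniqueness of quotient and remainder: blocks of length `K` are disjoint. This separates the
arrays in memory, the rows of the edge table and the cells of the input tables. -/
theorem cell_inj {K j i j' i' : ℕ} (hi : i < K) (hi' : i' < K) (h : j * K + i = j' * K + i') :
    j = j' ∧ i = i' := by
  have hj : j = j' := by
    rcases lt_trichotomy j j' with hlt | heq | hlt
    · have := Nat.mul_le_mul_right K (Nat.succ_le_of_lt hlt)
      rw [Nat.succ_mul] at this
      omega
    · exact heq
    · have := Nat.mul_le_mul_right K (Nat.succ_le_of_lt hlt)
      rw [Nat.succ_mul] at this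
      omega
  subst hj
  exact ⟨rfl, by omega⟩

/-- Code with target `d` changes no register below `d`. Hence the first operand in register `d`
survives the evaluation of the second one in `d + 1`, and starting from `41` leaves the variables
and the array size alone. -/
theorem Ex.code_spec {W K : ℕ} (hK : 16 * K ≤ W) (hW : 256 ≤ W) {σ : St} (e : Ex) :
    ∀ (s : State) (d : ℕ), 41 ≤ d → e.wf = true → e.ok W K σ → Rel W K s σ →
    e.eval σ < W ∧ ∃ s', Exec W (e.code d) s e.cost s' ∧ s'.reg d = e.eval σ ∧
      (∀ y < d, s'.reg y = s.reg y) ∧ s'.mem = s.mem := by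
  have two : ∀ (e f : Ex) (s : State) (d : ℕ), 41 ≤ d → Rel W K s σ →
      (∀ (s : State) (d : ℕ), 41 ≤ d → Rel W K s σ →
        e.eval σ < W ∧ ∃ s', Exec W (e.code d) s e.cost s' ∧ s'.reg d = e.eval σ ∧
          (∀ y < d, s'.reg y = s.reg y) ∧ s'.mem = s.mem) →
      (∀ (s : State) (d : ℕ), 41 ≤ d → Rel W K s σ →
        f.eval σ < W ∧ ∃ s', Exec W (f.code d) s f.cost s' ∧ s'.reg d = f.eval σ ∧
          (∀ y < d, s'.reg y = s.reg y) ∧ s'.mem = s.mem) →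
      e.eval σ < W ∧ f.eval σ < W ∧ ∃ s₁ s₂, Exec W (e.code d) s e.cost s₁ ∧
        Exec W (f.code (d + 1)) s₁ f.cost s₂ ∧ s₂.reg d = e.eval σ ∧ s₂.reg (d + 1) = f.eval σ ∧
        (∀ y < d, s₂.reg y = s.reg y) ∧ s₂.mem = s.mem := by
    intro e f s d hd hs he hf
    obtain ⟨h1, s₁, x1, r1, f1, m1⟩ := he s d hd hs
    have hs1 : Rel W K s₁ σ := hs.of_agree (fun y hy => f1 y (by omega)) m1
    obtain ⟨h2, s₂, x2, r2, f2, m2⟩ := hf s₁ (d + 1) (by omega) hs1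
    exact ⟨h1, h2, s₁, s₂, x1, x2, by rw [f2 d (by omega), r1], r2,
      fun y hy => by rw [f2 y (by omega), f1 y hy], by rw [m2, m1]⟩
  induction e with
  | lit k =>
    intro s d hd hwf _ hs
    simp only [wf, decide_eq_true_eq] at hwf
    refine ⟨by simp only [eval]; omega, _, Exec.const s d k (by omega), ?_, ?_, rfl⟩
    · simp [State.setReg, eval]
    · intro y hy; simp [State.setReg, Function.update_of_ne hy.ne]
  | var x =>
    intro s d hd hwf _ hs
    simp only [wf, decide_eq_true_eq] at hwf
    have h1 := hs.reg x hwf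
    have h2 := hs.reg_lt x hwf
    refine ⟨h2, _, Exec.copy s d x (by omega), ?_, ?_, rfl⟩
    · simp [State.setReg, eval, h1]
    · intro y hy; simp [State.setReg, Function.update_of_ne hy.ne]
  | add e f ihe ihf =>
    intro s d hd hwf hok hs
    simp only [wf, Bool.and_eq_true] at hwf
    obtain ⟨o1, o2, o3⟩ := hok
    obtain ⟨h1, h2, s₁, s₂, x1, x2, r1, r2, fr, m⟩ := two e f s d hd hs
      (fun s d hd hs => ihe s d hd hwf.1 o1 hs) (fun s d hd hs => ihf s d hd hwf.2 o2 hs)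
    have hx := Exec.seq x1 (.seq x2 (.add s₂ d d (d + 1) (by rw [r1, r2]; exact o3)))
    rw [← add_assoc] at hx
    refine ⟨o3, _, hx, ?_, ?_, ?_⟩
    · simp [State.setReg, eval, r1, r2]
    · intro y hy; simp [State.setReg, Function.update_of_ne hy.ne, fr y hy]
    · simp [State.setReg, m]
  | sub e f ihe ihf =>
    intro s d hd hwf hok hs
    simp only [wf, Bool.and_eq_true] at hwf
    obtain ⟨o1, o2⟩ := hok
    obtain ⟨h1, h2, s₁, s₂, x1, x2, r1, r2, fr, m⟩ := two e f s d hd hs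
      (fun s d hd hs => ihe s d hd hwf.1 o1 hs) (fun s d hd hs => ihf s d hd hwf.2 o2 hs)
    have hx := Exec.seq x1 (.seq x2 (.sub s₂ d d (d + 1) (by rw [r1, r2]; omega)))
    rw [← add_assoc] at hx
    refine ⟨by simp only [eval]; omega, _, hx, ?_, ?_, ?_⟩
    · simp [State.setReg, eval, r1, r2]
    · intro y hy; simp [State.setReg, Function.update_of_ne hy.ne, fr y hy]
    · simp [State.setReg, m]
  | mul e f ihe ihf =>
    intro s d hd hwf hok hs
    simp only [wf, Bool.and_eq_true] at hwf
    obtain ⟨o1, o2, o3⟩ := hok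
    obtain ⟨h1, h2, s₁, s₂, x1, x2, r1, r2, fr, m⟩ := two e f s d hd hs
      (fun s d hd hs => ihe s d hd hwf.1 o1 hs) (fun s d hd hs => ihf s d hd hwf.2 o2 hs)
    have hx := Exec.seq x1 (.seq x2 (.mul s₂ d d (d + 1) (by rw [r1, r2]; exact o3)))
    rw [← add_assoc] at hx
    refine ⟨o3, _, hx, ?_, ?_, ?_⟩
    · simp [State.setReg, eval, r1, r2]
    · intro y hy; simp [State.setReg, Function.update_of_ne hy.ne, fr y hy]
    · simp [State.setReg, m]
  | get j e ihe =>
    intro s d hd hwf hok hs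
    simp only [wf, Bool.and_eq_true, decide_eq_true_eq] at hwf
    obtain ⟨o1, o2⟩ := hok
    obtain ⟨h1, s₁, x1, r1, f1, m1⟩ := ihe s d hd hwf.2 o1 hs
    have hcell := cell_lt hwf.1 o2
    have hsz : s₁.reg 40 = K := (f1 40 (by omega)).trans hs.size
    have hmem := hs.mem j hwf.1 _ o2
    have hlt := hs.mem_lt j hwf.1 _ o2
    have hd40 : (40 : ℕ) ≠ d + 1 := by omega
    have hd1 : d ≠ d + 1 := by omega
    have e1 := Exec.const (W := W) s₁ (d + 1) j (by omega)
    have e2 := Exec.mul (W := W) (s₁.setReg (d + 1) j) (d + 1) (d + 1) 40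
      (by simp [State.setReg, hsz, Function.update_of_ne hd40]; omega)
    have e3 := Exec.add (W := W) ((s₁.setReg (d + 1) j).setReg (d + 1) (j * K)) d d (d + 1)
      (by simp [State.setReg, r1]; omega)
    have e4 := Exec.load (W := W)
      (((s₁.setReg (d + 1) j).setReg (d + 1) (j * K)).setReg d (e.eval σ + j * K)) d d
      (by simp [State.setReg]; omega)
      (by simp [State.setReg, m1]; rw [Nat.add_comm, hmem]; exact hlt)
    simp only [State.setReg, hsz, Function.update_self, r1, ne_eq, hd40, hd1,
      not_false_eq_true, Function.update_of_ne, m1, Nat.add_comm (e.eval σ), hmem] at e2 e3 e4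
    simp only [State.setReg, m1] at e1
    refine ⟨hlt, _, Exec.seq x1 (.seq e1 (.seq e2 (.seq e3 e4))), ?_, ?_, ?_⟩
    · simp [eval]
    · intro y hy
      have hy1 : y ≠ d + 1 := by omega
      simp [Function.update_of_ne hy.ne, Function.update_of_ne hy1, f1 y hy]
    · simp

namespace Cmd

/-- Static well-formedness. -/
def wf : Cmd → Bool
  | skip => true
  | asg x e => x < 40 && e.wf
  | put j e f => j < 16 && e.wf && f.wf
  | seq c d => c.wf && d.wf
  | ite e f c d => e.wf && f.wf && c.wf && d.wf
  | loop e f c => e.wf && f.wf && c.wf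

/-- Compilation to machine code. -/
def code : Cmd → Prog
  | skip => .skip
  | asg x e => .seq (e.code 41) (.copy x 41)
  | put j e f => .seq (e.code 41) (.seq (f.code 42) (.seq (.const 43 j) (.seq (.mul 43 43 40)
      (.seq (.add 41 41 43) (.store 41 42)))))
  | seq c d => .seq c.code d.code
  | ite e f c d => .seq (e.code 41) (.seq (f.code 42) (.cond 41 42 c.code d.code))
  -- The loop of the machine compares registers only, so both sides of the guard are evaluated
  -- before the loop and again at the end of each pass.
  | loop e f c => .seq (e.code 41) (.seq (f.code 42)
      (.loop 41 42 (.seq c.code (.seq (e.code 41) (f.code 42)))))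

/-- Weakest preconditions for total correctness; the elapsed time is part of the state. -/
def wp (W K : ℕ) : Cmd → (St → Prop) → St → Prop
  | skip, Q, σ => Q (σ.tick 1)
  | asg x e, Q, σ => e.ok W K σ ∧ Q (σ.asg x (e.eval σ) (e.cost + 1))
  | put j e f, Q, σ => e.ok W K σ ∧ f.ok W K σ ∧ e.eval σ < K ∧
      Q (σ.put j (e.eval σ) (f.eval σ) (e.cost + f.cost + 4))
  | seq c d, Q, σ => c.wp W K (d.wp W K Q) σ
  | ite e f c d, Q, σ => e.ok W K σ ∧ f.ok W K σ ∧
      (e.eval σ < f.eval σ → c.wp W K Q (σ.tick (e.cost + f.cost + 1))) ∧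
      (¬ e.eval σ < f.eval σ → d.wp W K Q (σ.tick (e.cost + f.cost + 1)))
  | loop e f c, Q, σ => ∃ (I : St → Prop) (m : St → ℕ), I σ ∧ ∀ τ, I τ →
      e.ok W K τ ∧ f.ok W K τ ∧
      (e.eval τ < f.eval τ →
        c.wp W K (fun τ' => I τ' ∧ m τ' < m τ) (τ.tick (e.cost + f.cost + 1))) ∧
      (¬ e.eval τ < f.eval τ → Q (τ.tick (e.cost + f.cost + 1)))

theorem wp_mono {W K : ℕ} {c : Cmd} {Q R : St → Prop} {σ : St} (h : c.wp W K Q σ)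
    (hQR : ∀ τ, Q τ → R τ) : c.wp W K R σ := by
  induction c generalizing Q R σ with
  | skip => exact hQR _ h
  | asg x e => exact ⟨h.1, hQR _ h.2⟩
  | put j e f => exact ⟨h.1, h.2.1, h.2.2.1, hQR _ h.2.2.2⟩
  | seq c d ihc ihd => exact ihc h fun τ hτ => ihd hτ hQR
  | ite e f c d ihc ihd =>
    exact ⟨h.1, h.2.1, fun hl => ihc (h.2.2.1 hl) hQR, fun hl => ihd (h.2.2.2 hl) hQR⟩
  | loop e f c ih =>
    obtain ⟨I, m, hI, hstep⟩ := h
    refine ⟨I, m, hI, fun τ hτ => ?_⟩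
    obtain ⟨h1, h2, h3, h4⟩ := hstep τ hτ
    exact ⟨h1, h2, h3, fun hl => hQR _ (h4 hl)⟩

theorem guard_spec {W K : ℕ} (hK : 16 * K ≤ W) (hW : 256 ≤ W) {σ : St} {e f : Ex}
    (we : e.wf = true) (wf : f.wf = true) (oe : e.ok W K σ) (of : f.ok W K σ) {s : State}
    (hs : Rel W K s σ) : ∃ s₁ s₂, Exec W (e.code 41) s e.cost s₁ ∧ Exec W (f.code 42) s₁ f.cost s₂ ∧
      s₂.reg 41 = e.eval σ ∧ s₂.reg 42 = f.eval σ ∧ (∀ y < 41, s₂.reg y = s.reg y) ∧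
      s₂.mem = s.mem ∧ e.eval σ < W ∧ f.eval σ < W := by
  obtain ⟨h1, s₁, x1, r1, f1, m1⟩ := e.code_spec hK hW s 41 le_rfl we oe hs
  obtain ⟨h2, s₂, x2, r2, f2, m2⟩ := f.code_spec hK hW s₁ 42 (by omega) wf of (hs.of_agree f1 m1)
  exact ⟨s₁, s₂, x1, x2, (f2 41 (by omega)).trans r1, r2,
    fun y hy => (f2 y (by omega)).trans (f1 y hy), m2.trans m1, h1, h2⟩

/-- Soundness of the weakest preconditions with respect to the machine. -/
theorem wp_sound {W K : ℕ} (hK : 16 * K ≤ W) (hW : 256 ≤ W) (c : Cmd) (hwf : c.wf = true) :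
    ∀ (Q : St → Prop) (σ : St) (s : State), c.wp W K Q σ → Rel W K s σ →
      ∃ t s' σ', Exec W c.code s t s' ∧ Rel W K s' σ' ∧ Q σ' ∧ σ'.time = σ.time + t := by
  induction c with
  | skip =>
    intro Q σ s h hs
    exact ⟨1, s, _, .skip s, hs.tick 1, h, rfl⟩
  | asg x e =>
    intro Q σ s h hs
    simp only [wf, Bool.and_eq_true, decide_eq_true_eq] at hwf
    obtain ⟨hv, s₁, x1, r1, f1, m1⟩ := e.code_spec hK hW s 41 le_rfl hwf.2 h.1 hs
    refine ⟨_, _, _, .seq x1 (.copy s₁ x 41 (by rw [r1]; exact hv)), ⟨?_, ?_, ?_, ?_, ?_⟩, h.2, rfl⟩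
    · intro y hy
      simp only [State.setReg, St.asg_v, r1, Function.update_apply]
      split
      · rfl
      · rw [f1 y (by omega), hs.reg y hy]
    · simp only [State.setReg]
      rw [Function.update_of_ne (by omega), f1 40 (by omega), hs.size]
    · intro j hj i hi
      simp only [State.setReg, m1]
      exact hs.mem j hj i hi
    · intro y hy
      simp only [St.asg_v, Function.update_apply]
      split
      · exact hv
      · exact hs.reg_lt y hy
    · exact hs.mem_lt
  | put j e f =>
    intro Q σ s h hs
    simp only [wf, Bool.and_eq_true, decide_eq_true_eq] at hwf
    obtain ⟨oe, of, hi, hQ⟩ := h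
    obtain ⟨s₁, s₂, x1, x2, r1, r2, fr, hm, v1, v2⟩ := guard_spec hK hW hwf.1.2 hwf.2 oe of hs
    have hcell := cell_lt hwf.1.1 hi
    have hsz : s₂.reg 40 = K := (fr 40 (by omega)).trans hs.size
    have hst : Exec W (put j e f).code s (e.cost + f.cost + 4)
        ((((s₂.setReg 43 j).setReg 43 (j * K)).setReg 41 (e.eval σ + j * K)).setMem
          (e.eval σ + j * K) (f.eval σ)) := by
      have e1 := Exec.const (W := W) s₂ 43 j (by omega)
      have e2 := Exec.mul (W := W) (s₂.setReg 43 j) 43 43 40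
        (by simp [State.setReg, hsz]; omega)
      have e3 := Exec.add (W := W) ((s₂.setReg 43 j).setReg 43 (j * K)) 41 41 43
        (by simp [State.setReg, r1]; omega)
      have e4 := Exec.store (W := W)
        (((s₂.setReg 43 j).setReg 43 (j * K)).setReg 41 (e.eval σ + j * K)) 41 42
        (by simp [State.setReg]; omega) (by simp [State.setReg, r2]; omega)
      simp only [State.setReg, hsz, Function.update_self, r1, r2, ne_eq, Nat.reduceEqDiff,
        not_false_eq_true, Function.update_of_ne] at e2 e3 e4
      have := Exec.seq x1 (.seq x2 (.seq e1 (.seq e2 (.seq e3 e4))))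
      have ht : e.cost + (f.cost + (1 + (1 + (1 + 1)))) = e.cost + f.cost + 4 := by omega
      rw [ht] at this
      exact this
    refine ⟨_, _, _, hst, (⟨?_, ?_, ?_, hs.reg_lt, ?_⟩ :
      Rel W K _ (σ.put j (e.eval σ) (f.eval σ) (e.cost + f.cost + 4))), hQ, by
        simp only [St.put_time]⟩
    · intro y hy
      simp only [State.setReg, State.setMem]
      rw [Function.update_of_ne (by omega), Function.update_of_ne (by omega),
        Function.update_of_ne (by omega), fr y (by omega)]
      exact hs.reg y hy
    · simp only [State.setReg, State.setMem]
      rw [Function.update_of_ne (by omega), Function.update_of_ne (by omega),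
        Function.update_of_ne (by omega), hsz]
    · intro j' hj' i' hi'
      simp only [State.setReg, State.setMem, St.put_a, hm]
      by_cases hc : j' * K + i' = e.eval σ + j * K
      · obtain ⟨rfl, rfl⟩ := cell_inj hi' hi (hc.trans (Nat.add_comm _ _))
        rw [hc]; simp
      · rw [Function.update_of_ne hc, hs.mem j' hj' i' hi']
        by_cases hj : j' = j
        · subst hj
          have : i' ≠ e.eval σ := by rintro rfl; exact hc (Nat.add_comm _ _)
          simp [this]
        · simp [hj]
    · intro j' hj' i' hi'
      simp only [St.put_a, Function.update_apply]
      split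
      · rename_i hj
        simp only [Function.update_apply]
        split
        · exact v2
        · exact hs.mem_lt _ hwf.1.1 i' hi'
      · exact hs.mem_lt j' hj' i' hi'
  | seq c d ihc ihd =>
    intro Q σ s h hs
    simp only [wf, Bool.and_eq_true] at hwf
    obtain ⟨t₁, s₁, σ₁, x1, hs1, h1, ht1⟩ := ihc hwf.1 _ σ s h hs
    obtain ⟨t₂, s₂, σ₂, x2, hs2, h2, ht2⟩ := ihd hwf.2 _ σ₁ s₁ h1 hs1
    exact ⟨_, s₂, σ₂, .seq x1 x2, hs2, h2, by omega⟩
  | ite e f c d ihc ihd =>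
    intro Q σ s h hs
    simp only [wf, Bool.and_eq_true] at hwf
    obtain ⟨oe, of, hc, hd⟩ := h
    obtain ⟨s₁, s₂, x1, x2, r1, r2, fr, hm, -, -⟩ := guard_spec hK hW hwf.1.1.1 hwf.1.1.2 oe of hs
    have hs2 := (hs.of_agree fr hm).tick (e.cost + f.cost + 1)
    by_cases hlt : e.eval σ < f.eval σ
    · obtain ⟨t, s', σ', x3, hs', hQ, ht⟩ := ihc hwf.1.2 Q _ s₂ (hc hlt) hs2
      refine ⟨_, s', σ', .seq x1 (.seq x2 (.condTrue (by rw [r1, r2]; exact hlt) x3)), hs', hQ, ?_⟩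
      simp only [St.tick_time] at ht
      omega
    · obtain ⟨t, s', σ', x3, hs', hQ, ht⟩ := ihd hwf.2 Q _ s₂ (hd hlt) hs2
      refine ⟨_, s', σ', .seq x1 (.seq x2 (.condFalse (by rw [r1, r2]; exact hlt) x3)), hs', hQ, ?_⟩
      simp only [St.tick_time] at ht
      omega
  | loop e f c ih =>
    intro Q σ s h hs
    simp only [wf, Bool.and_eq_true] at hwf
    obtain ⟨I, m, hI, hstep⟩ := h
    -- Strong induction on the measure. The registers `41` and `42` already hold the two sides of
    -- the guard, so the time for evaluating them is listed separately from `t`.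
    have key : ∀ (n : ℕ) (τ : St) (u : State), m τ = n → I τ → Rel W K u τ →
        u.reg 41 = e.eval τ → u.reg 42 = f.eval τ → ∃ t u' τ',
        Exec W (.loop 41 42 (.seq c.code (.seq (e.code 41) (f.code 42)))) u t u' ∧ Rel W K u' τ' ∧
        Q τ' ∧ τ'.time = τ.time + (e.cost + f.cost) + t := by
      intro n
      induction n using Nat.strong_induction_on with
      | _ n ihn =>
        intro τ u hm hIτ hu r1 r2
        obtain ⟨-, -, hbody, hdone⟩ := hstep τ hIτ
        by_cases hlt : e.eval τ < f.eval τ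
        · obtain ⟨t₁, u₁, τ₁, x1, hu1, ⟨hI1, hm1⟩, ht1⟩ :=
            ih hwf.2 _ _ u (hbody hlt) (hu.tick (e.cost + f.cost + 1))
          obtain ⟨oe, of, -, -⟩ := hstep τ₁ hI1
          obtain ⟨v₁, v₂, y1, y2, q1, q2, fr, hmm, -, -⟩ :=
            guard_spec hK hW hwf.1.1 hwf.1.2 oe of hu1
          obtain ⟨t₂, u₂, τ₂, x2, hu2, hQ, ht2⟩ :=
            ihn (m τ₁) (by omega) τ₁ v₂ rfl hI1 (hu1.of_agree fr hmm) q1 q2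
          refine ⟨_, u₂, τ₂, .loopTrue (by rw [r1, r2]; exact hlt) (.seq x1 (.seq y1 y2)) x2,
            hu2, hQ, ?_⟩
          simp only [St.tick_time] at ht1
          omega
        · exact ⟨1, u, _, .loopFalse (by rw [r1, r2]; exact hlt), hu.tick _, hdone hlt, by
            simp only [St.tick_time]; omega⟩
    obtain ⟨oe, of, -, -⟩ := hstep σ hI
    obtain ⟨s₁, s₂, x1, x2, r1, r2, fr, hm, -, -⟩ := guard_spec hK hW hwf.1.1 hwf.1.2 oe of hs
    obtain ⟨t, s', σ', x3, hs', hQ, ht⟩ := key _ σ s₂ rfl hI (hs.of_agree fr hm) r1 r2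
    exact ⟨_, s', σ', .seq x1 (.seq x2 x3), hs', hQ, by omega⟩

/-- `for x := 0, …, n - 1` where `n` is the value of the variable `y`. -/
def forLoop (x y : ℕ) (c : Cmd) : Cmd :=
  asg x 0 ;; loop (.var x) (.var y) (c ;; asg x (.var x + 1))

/-- The invariant `I k` refers to the state just after the counter has become `k`. The constants are
the costs of the control: `2` for the initialization, `3` for a test and `4` for an increment. The
body has to preserve the counter and the bound. -/
theorem wp_forLoop {W K x y n : ℕ} {c : Cmd} {Q : St → Prop} {σ : St} (I : ℕ → St → Prop)
    (hxy : x ≠ y) (hn : σ.v y = n) (hnW : n < W) (h0 : I 0 (σ.asg x 0 2))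
    (hstep : ∀ k τ, k < n → I k τ → τ.v x = k → τ.v y = n → c.wp W K
      (fun τ' => τ'.v x = k ∧ τ'.v y = n ∧ I (k + 1) (τ'.asg x (k + 1) 4)) (τ.tick 3))
    (hQ : ∀ τ, I n τ → Q (τ.tick 3)) : (forLoop x y c).wp W K Q σ := by
  refine ⟨trivial, fun τ => τ.v y = n ∧ τ.v x ≤ n ∧ I (τ.v x) τ, fun τ => n - τ.v x, ?_, ?_⟩
  · refine ⟨?_, ?_, ?_⟩
    · simp [Function.update_of_ne hxy.symm, hn]
    · simp
    · have h : (σ.asg x (Ex.eval σ 0) (Ex.cost 0 + 1)).v x = 0 := by simp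
      rw [h]
      exact h0
  · rintro τ ⟨h1, h2, h3⟩
    refine ⟨trivial, trivial, fun hlt => ?_, fun hlt => ?_⟩
    · simp only [Ex.eval_var, h1] at hlt
      refine wp_mono (c := c) (hstep _ τ hlt h3 rfl h1) ?_
      rintro τ' ⟨h4, h5, h6⟩
      refine ⟨?_, ⟨?_, ?_, ?_⟩, ?_⟩
      · simp [h4]; omega
      · simp [Function.update_of_ne hxy.symm, h5]
      · simp [h4]; omega
      · simpa [h4] using h6
      · simp [h4]; omega
    · simp only [Ex.eval_var, h1] at hlt
      have : τ.v x = n := by omega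
      rw [this] at h3
      exact hQ τ h3

end Cmd

end WordRAM

/-! ### Integral duality for the assignment problem. -/

open Finset in
/-- Integral duality for the assignment problem: an optimal perfect matching `μ` has tight
potentials. -/
theorem exists_assignment_potentials {X R : Type*} [Fintype X] [Fintype R] (Edge : X → R → Prop)
    (w : X → R → ℤ) (μ : X ≃ R) (hμ : ∀ x, Edge x (μ x))
    (hopt : ∀ σ : X ≃ R, (∀ x, Edge x (σ x)) → ∑ x, w x (σ x) ≤ ∑ x, w x (μ x)) :
    ∃ (u : X → ℤ) (v : R → ℤ), (∀ x r, Edge x r → w x r ≤ u x + v r) ∧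
      ∀ x, w x (μ x) = u x + v (μ x) := by
  classical
  have hμsum : ∀ (u : X → ℤ) (v : R → ℤ) (σ : X ≃ R),
      ∑ x, u x + ∑ r, v r = ∑ x, (u x + v (σ x)) := fun u v σ => by
    rw [sum_add_distrib, Equiv.sum_comp σ v]
  -- For feasible integral potentials the gap between the dual value and the weight of `μ` is a
  -- natural number, so some feasible pair minimizes it. Row sums of absolute values together with
  -- `v = 0` show that feasible potentials exist.
  have hex : ∃ n : ℕ, ∃ (u : X → ℤ) (v : R → ℤ), (∀ x r, Edge x r → w x r ≤ u x + v r) ∧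
      ∑ x, u x + ∑ r, v r - ∑ x, w x (μ x) = n := by
    refine ⟨(∑ x, (∑ r, |w x r|) + ∑ _r : R, (0 : ℤ) - ∑ x, w x (μ x)).toNat,
      fun x => ∑ r, |w x r|, fun _ => 0, ?_, ?_⟩
    · intro x r _
      have := single_le_sum (f := fun r => |w x r|) (fun r _ => abs_nonneg _) (mem_univ r)
      have h2 := le_abs_self (w x r)
      simp only [add_zero]
      exact h2.trans this
    · refine (Int.toNat_of_nonneg ?_).symm
      simp only [sum_const_zero, add_zero, sub_nonneg]
      refine sum_le_sum fun x _ => ?_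
      exact (le_abs_self _).trans
        (single_le_sum (f := fun r => |w x r|) (fun r _ => abs_nonneg _) (mem_univ (μ x)))
  obtain ⟨u, v, hf, hn⟩ := Nat.find_spec hex
  refine ⟨u, v, hf, ?_⟩
  let t : X → Finset R := fun x => univ.filter fun r => Edge x r ∧ w x r = u x + v r
  -- Hall's condition in the graph of tight edges. If it holds, a tight perfect matching attains the
  -- dual value; by optimality so does `μ`, and then every edge of `μ` is tight.
  by_cases hall : ∀ s : Finset X, s.card ≤ (s.biUnion t).card
  · obtain ⟨f, hinj, hft⟩ := (all_card_le_biUnion_card_iff_exists_injective t).1 hall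
    have hbij : Function.Bijective f :=
      (Fintype.bijective_iff_injective_and_card f).2 ⟨hinj, Fintype.card_congr μ⟩
    let σ := Equiv.ofBijective f hbij
    have hσ : ∀ x, Edge x (σ x) ∧ w x (σ x) = u x + v (σ x) := fun x =>
      (mem_filter.1 (hft x)).2
    have h1 := hopt σ fun x => (hσ x).1
    rw [sum_congr rfl fun x _ => (hσ x).2, ← hμsum u v σ, hμsum u v μ] at h1
    have h2 : ∀ x ∈ univ, w x (μ x) ≤ u x + v (μ x) := fun x _ => hf x _ (hμ x)
    have h3 := (sum_eq_sum_iff_of_le h2).1 (le_antisymm (sum_le_sum h2) h1)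
    exact fun x => h3 x (mem_univ x)
  · push Not at hall
    obtain ⟨s, hs⟩ := hall
    exfalso
    -- A violator `s` of Hall's condition improves the dual: lower `u` on `s` and raise `v` on the
    -- tight neighbours of `s`. A non-tight edge has slack at least one by integrality, so
    -- feasibility persists, and the gap falls below its minimum.
    let u' : X → ℤ := fun x => u x - if x ∈ s then 1 else 0
    let v' : R → ℤ := fun r => v r + if r ∈ s.biUnion t then 1 else 0
    have hf' : ∀ x r, Edge x r → w x r ≤ u' x + v' r := by
      intro x r he
      have h1 := hf x r he
      simp only [u', v']
      by_cases hx : x ∈ s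
      · by_cases hr : r ∈ s.biUnion t
        · rw [if_pos hx, if_pos hr]; omega
        · have : w x r ≠ u x + v r := fun heq =>
            hr (mem_biUnion.2 ⟨x, hx, by simp [t, he, heq]⟩)
          rw [if_pos hx, if_neg hr]; omega
      · rw [if_neg hx]; split <;> omega
    have hobj : ∑ x, u' x + ∑ r, v' r =
        ∑ x, u x + ∑ r, v r - s.card + (s.biUnion t).card := by
      simp only [u', v', sum_sub_distrib, sum_add_distrib, sum_ite_mem, univ_inter, sum_const,
        nsmul_eq_mul, mul_one]
      ring
    have hge : ∑ x, w x (μ x) ≤ ∑ x, u' x + ∑ r, v' r := by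
      rw [hμsum u' v' μ]
      exact sum_le_sum fun x _ => hf' x _ (hμ x)
    have hlt : (∑ x, u' x + ∑ r, v' r - ∑ x, w x (μ x)).toNat < Nat.find hex := by
      have : ((s.biUnion t).card : ℤ) < s.card := by exact_mod_cast hs
      omega
    exact Nat.find_min hex hlt ⟨u', v', hf', by omega⟩

/-! ### Prices as certificates of popularity. -/

namespace PopInstance

variable {p q : ℕ}

/-- Adjacency for agents and objects given by natural numbers. -/
def AdjN (G : PopInstance p q) (a b : ℕ) : Prop :=
  ∃ (ha : a < p) (hb : b < q), G.adj ⟨a, ha⟩ ⟨b, hb⟩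

/-- Preference for agents and objects given by natural numbers. -/
def PrefN (G : PopInstance p q) (a b b' : ℕ) : Prop :=
  ∃ (ha : a < p) (hb : b < q) (hb' : b' < q), G.pref ⟨a, ha⟩ ⟨b, hb⟩ ⟨b', hb'⟩

open Classical in
/-- Indicator of a preference. -/
noncomputable def prefVal (G : PopInstance p q) (a b b' : ℕ) : ℕ := if G.PrefN a b b' then 1 else 0

open Classical in
/-- Indicator of adjacency. -/
noncomputable def adjVal (G : PopInstance p q) (a b : ℕ) : ℕ := if G.AdjN a b then 1 else 0

/-- The edges that may be used at the prices `y`. The left side consists of the objects `b < q` and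
a private dummy object `q + a` for each agent `a`; the right side consists of the agents `a < p`
and of `q` further nodes `p + b` that absorb the left nodes of price zero. -/
def Allowed (G : PopInstance p q) (κ : ℕ) (y : ℕ → ℕ) (x r : ℕ) : Prop :=
  (G.AdjN r x ∧ ∀ b, G.AdjN r b → y x + G.prefVal r b x ≤ y b + G.prefVal r x b) ∨
  (r < p ∧ x = q + r ∧ ∀ b, G.AdjN r b → κ ≤ y b) ∨ (p ≤ r ∧ y x = 0)

/-- Prices are at most `κ`, and dummy objects have price zero. -/
structure IsPrice (q κ : ℕ) (y : ℕ → ℕ) : Prop where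
  le : ∀ x, y x ≤ κ
  dummy : ∀ x, q ≤ x → y x = 0

/-- `f` is a perfect matching along edges allowed at `y`, as a map on the left side. -/
structure IsPerfect (G : PopInstance p q) (κ : ℕ) (y f : ℕ → ℕ) : Prop where
  lt : ∀ x < p + q, f x < p + q
  allowed : ∀ x < p + q, G.Allowed κ y x (f x)
  inj : ∀ x < p + q, ∀ x' < p + q, f x = f x' → x = x'

theorem pref_asymm (G : PopInstance p q) {a : Fin p} {b b' : Fin q} (h : G.pref a b b') :
    ¬ G.pref a b' b := fun h' => G.pref_irrefl a b (G.pref_trans a b b' b h h')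

theorem prefN_coe (G : PopInstance p q) (a : Fin p) (b b' : Fin q) :
    G.PrefN a b b' ↔ G.pref a b b' :=
  ⟨fun ⟨_, _, _, h⟩ => h, fun h => ⟨a.2, b.2, b'.2, h⟩⟩

theorem adjN_coe (G : PopInstance p q) (a : Fin p) (b : Fin q) : G.AdjN a b ↔ G.adj a b :=
  ⟨fun ⟨_, _, h⟩ => h, fun h => ⟨a.2, b.2, h⟩⟩

theorem prefVal_le_one (G : PopInstance p q) (a b b' : ℕ) : G.prefVal a b b' ≤ 1 := by
  unfold prefVal; split <;> omega

open Classical in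
/-- The vote of an agent between two options. -/
noncomputable def choiceVote (G : PopInstance p q) (κ : ℕ) (a : Fin p) :
    Option (Fin q) → Option (Fin q) → ℤ
  | some b, some b' => if G.pref a b b' then 1 else if G.pref a b' b then -1 else 0
  | some _, none => (κ : ℤ)
  | none, some _ => -(κ : ℤ)
  | none, none => 0

theorem vote_eq (G : PopInstance p q) (κ : ℕ) (N M : G.Matching) (a : Fin p) :
    G.vote κ N M a = G.choiceVote κ a (N.partner a) (M.partner a) := by
  unfold vote choiceVote
  rcases N.partner a with _ | b <;> rcases M.partner a with _ | b' <;> rfl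

open Classical in
theorem choiceVote_some (G : PopInstance p q) (κ : ℕ) (a : Fin p) (b b' : Fin q) :
    G.choiceVote κ a (some b) (some b') = (G.prefVal a b b' : ℤ) - G.prefVal a b' b := by
  have hv : ∀ b b' : Fin q, G.prefVal a b b' = if G.pref a b b' then 1 else 0 :=
    fun b b' => if_congr (G.prefN_coe a b b') rfl rfl
  rw [hv, hv]
  by_cases h : G.pref a b b'
  · simp [choiceVote, h, G.pref_asymm h]
  · by_cases h' : G.pref a b' b <;> simp [choiceVote, h, h']

theorem choiceVote_self (G : PopInstance p q) (κ : ℕ) (a : Fin p) (o : Option (Fin q)) :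
    G.choiceVote κ a o o = 0 := by
  rcases o with _ | b
  · rfl
  · rw [choiceVote_some, sub_self]

/-- The price of an option. -/
def optPrice (y : ℕ → ℕ) : Option (Fin q) → ℤ
  | none => 0
  | some b => y b

theorem sum_optPrice {G : PopInstance p q} (y : ℕ → ℕ) (N : G.Matching) :
    ∑ a, optPrice y (N.partner a) =
      ∑ b : Fin q, ∑ a, if N.partner a = some b then (y b : ℤ) else 0 := by
  rw [Finset.sum_comm]
  refine Finset.sum_congr rfl fun a _ => ?_
  rcases h : N.partner a with _ | b
  · simp [optPrice]
  · simp [optPrice]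

/-- An object has at most one partner, so its price is paid at most once. -/
theorem sum_optPrice_le {G : PopInstance p q} (y : ℕ → ℕ) (N : G.Matching) :
    ∑ a, optPrice y (N.partner a) ≤ ∑ b : Fin q, (y b : ℤ) := by
  classical
  rw [sum_optPrice]
  refine Finset.sum_le_sum fun b _ => ?_
  by_cases h : ∃ a, N.partner a = some b
  · obtain ⟨a, ha⟩ := h
    rw [Finset.sum_eq_single a, if_pos ha]
    · intro a' _ hne
      exact if_neg fun h' => hne (N.partner_inj _ _ _ h' ha)
    · simp
  · push Not at h
    rw [Finset.sum_eq_zero fun a _ => if_neg (h a)]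
    positivity

/-- Only objects of price zero may stay unmatched, so every positive price is paid. Together with
the upper bound for any other matching, no rival can gain in total price. -/
theorem le_sum_optPrice {G : PopInstance p q} (y : ℕ → ℕ) (M : G.Matching)
    (hM : ∀ b : Fin q, y b ≠ 0 → ∃ a, M.partner a = some b) :
    ∑ b : Fin q, (y b : ℤ) ≤ ∑ a, optPrice y (M.partner a) := by
  rw [sum_optPrice]
  refine Finset.sum_le_sum fun b _ => ?_
  have hnn : ∀ a ∈ Finset.univ, (0 : ℤ) ≤ if M.partner a = some b then (y b : ℤ) else 0 := by
    intro a _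
    split <;> positivity
  by_cases hb : y b = 0
  · rw [hb]
    simp
  · obtain ⟨a, ha⟩ := hM b hb
    have := Finset.single_le_sum hnn (Finset.mem_univ a)
    simpa [ha] using this

/-- A matching that is supported by prices is popular. -/
theorem popular_of_prices {G : PopInstance p q} {κ : ℕ} {y : ℕ → ℕ} {M : G.Matching}
    (hM : ∀ b : Fin q, y b ≠ 0 → ∃ a, M.partner a = some b)
    (hle : ∀ a o, (∀ b, o = some b → G.adj a b) →
      G.choiceVote κ a o (M.partner a) ≤ optPrice y o - optPrice y (M.partner a)) :
    G.PopularWithPenalty κ M := by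
  intro N
  have h1 : ∑ a, G.vote κ N M a ≤ ∑ a, (optPrice y (N.partner a) - optPrice y (M.partner a)) :=
    Finset.sum_le_sum fun a _ => by
      rw [vote_eq]
      exact hle a _ fun b hb => N.adj_of_partner a b hb
  rw [Finset.sum_sub_distrib] at h1
  have h2 := sum_optPrice_le y N
  have h3 := le_sum_optPrice y M hM
  omega

/-- A perfect matching along allowed edges, as a map `g` on the right side, yields a popular
matching. -/
theorem exists_popular_of_mates (G : PopInstance p q) {κ : ℕ} {y g : ℕ → ℕ} (hy : IsPrice q κ y)
    (hg : ∀ r < p + q, g r < p + q ∧ G.Allowed κ y (g r) r)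
    (hinj : ∀ r < p + q, ∀ r' < p + q, g r = g r' → r = r') :
    ∃ M : G.Matching, G.PopularWithPenalty κ M ∧
      ∀ a : Fin p, M.partner a = if h : g a < q then some ⟨g a, h⟩ else none := by
  have hadj : ∀ a : Fin p, g a < q → G.AdjN a (g a) ∧
      ∀ b, G.AdjN a b → y (g a) + G.prefVal a b (g a) ≤ y b + G.prefVal a (g a) b := by
    intro a ha
    rcases (hg a (by omega)).2 with h | h | h
    · exact h
    · omega
    · omega
  let M : G.Matching :=
    { partner := fun a => if h : g a < q then some ⟨g a, h⟩ else none
      adj_of_partner := by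
        intro a b h
        split at h
        · rename_i hlt
          obtain rfl := Option.some.inj h
          exact (hadj a hlt).1.2.2
        · cases h
      partner_inj := by
        intro a a' b h h'
        split at h
        · split at h'
          · have h1 := congrArg Fin.val (Option.some.inj h)
            have h2 := congrArg Fin.val (Option.some.inj h')
            exact Fin.ext (hinj a (by omega) a' (by omega) (h1.trans h2.symm))
          · cases h'
        · cases h }
  refine ⟨M, popular_of_prices (y := y) ?_ ?_, fun _ => rfl⟩
  · intro b hb
    -- An injection of a finite set into itself is onto, so `b` is the mate of some right node; its
    -- positive price rules out the absorbing nodes.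
    have hsurj : ∃ r < p + q, g r = b := by
      have hmaps : Set.MapsTo g (Finset.range (p + q)) (Finset.range (p + q)) := fun r hr => by
        simpa using (hg r (by simpa using hr)).1
      have hio : Set.InjOn g (Finset.range (p + q)) := fun r hr r' hr' h =>
        hinj r (by simpa using hr) r' (by simpa using hr') h
      obtain ⟨r, hr, h⟩ := Finset.surjOn_of_injOn_of_card_le g hmaps hio le_rfl
        (show (b : ℕ) ∈ (Finset.range (p + q) : Set ℕ) by simp; omega)
      exact ⟨r, by simpa using hr, h⟩
    obtain ⟨r, hr, hrb⟩ := hsurj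
    have hrp : r < p := by
      rcases (hg r hr).2 with h | h | h
      · exact h.1.1
      · exact h.1
      · rw [hrb] at h; exact absurd h.2 hb
    refine ⟨⟨r, hrp⟩, ?_⟩
    have : g r < q := by rw [hrb]; exact b.2
    simp only [M]
    rw [dif_pos this]
    exact congrArg some (Fin.ext hrb)
  · intro a o ho
    by_cases ha : g a < q
    · have hMa : M.partner a = some ⟨g a, ha⟩ := dif_pos ha
      rw [hMa]
      rcases o with _ | b
      · have := hy.le (g a)
        simp only [choiceVote, optPrice]
        omega
      · rw [choiceVote_some]
        have := (hadj a ha).2 b ((G.adjN_coe a b).2 (ho b rfl))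
        simp only [optPrice]
        omega
    · have hMa : M.partner a = none := dif_neg ha
      rw [hMa]
      rcases o with _ | b
      · simp [choiceVote, optPrice]
      · have : κ ≤ y b := by
          rcases (hg a (by omega)).2 with h | h | h
          · exact absurd h.1.2.1 ha
          · exact h.2.2 b ((G.adjN_coe a b).2 (ho b rfl))
          · omega
        simp only [choiceVote, optPrice]
        omega

theorem _root_.Equiv.exists_eq_of_injective_sum (f : Fin q ⊕ Fin p → Fin p ⊕ Fin q)
    (hf : Function.Injective f) : ∃ e : (Fin q ⊕ Fin p) ≃ (Fin p ⊕ Fin q), ⇑e = f :=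
  ⟨Equiv.ofBijective f ((Fintype.bijective_iff_injective_and_card f).2
    ⟨hf, Fintype.card_congr (Equiv.sumComm _ _)⟩), rfl⟩

open Classical in
/-- Extension of a matching to a perfect matching between objects and dummies on the one side, and
agents and absorbing nodes on the other side. -/
noncomputable def Matching.complete {G : PopInstance p q} (M : G.Matching) :
    Fin q ⊕ Fin p → Fin p ⊕ Fin q
  | .inl b => if h : ∃ a, M.partner a = some b then .inl h.choose else .inr b
  | .inr a => match M.partner a with
    | none => .inl a
    | some b => .inr b

theorem Matching.complete_of_partner {G : PopInstance p q} (M : G.Matching) {a : Fin p} {b : Fin q}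
    (h : M.partner a = some b) : M.complete (.inl b) = .inl a ∧ M.complete (.inr a) = .inr b := by
  have hex : ∃ a, M.partner a = some b := ⟨a, h⟩
  refine ⟨?_, ?_⟩
  · simp only [complete]
    rw [dif_pos hex]
    exact congrArg _ (M.partner_inj _ _ b hex.choose_spec h)
  · simp only [complete, h]

theorem Matching.complete_of_none {G : PopInstance p q} (M : G.Matching) {a : Fin p}
    (h : M.partner a = none) : M.complete (.inr a) = .inl a := by
  simp only [complete, h]

theorem Matching.complete_of_free {G : PopInstance p q} (M : G.Matching) {b : Fin q}
    (h : ¬ ∃ a, M.partner a = some b) : M.complete (.inl b) = .inr b := by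
  simp only [complete]
  rw [dif_neg h]

/-- Each right node is claimed once: an agent by its object or else by its own dummy, and the
absorbing node of `b` by `b` itself if `b` is free and otherwise by the dummy of the partner of `b`.
-/
theorem Matching.complete_injective {G : PopInstance p q} (M : G.Matching) :
    Function.Injective M.complete := by
  rintro (b | a) (b' | a') h
  · by_cases hb : ∃ a, M.partner a = some b
    · obtain ⟨a, ha⟩ := hb
      rw [(M.complete_of_partner ha).1] at h
      by_cases hb' : ∃ a, M.partner a = some b'
      · obtain ⟨a', ha'⟩ := hb'
        rw [(M.complete_of_partner ha').1] at h
        obtain rfl := Sum.inl.inj h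
        rw [ha] at ha'
        rw [Option.some.inj ha']
      · rw [M.complete_of_free hb'] at h
        cases h
    · rw [M.complete_of_free hb] at h
      by_cases hb' : ∃ a, M.partner a = some b'
      · obtain ⟨a', ha'⟩ := hb'
        rw [(M.complete_of_partner ha').1] at h
        cases h
      · rw [M.complete_of_free hb'] at h
        rw [Sum.inr.inj h]
  · exfalso
    by_cases hb : ∃ a, M.partner a = some b
    · obtain ⟨a, ha⟩ := hb
      rw [(M.complete_of_partner ha).1] at h
      rcases ha' : M.partner a' with _ | b'
      · rw [M.complete_of_none ha'] at h
        rw [Sum.inl.inj h, ha'] at ha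
        cases ha
      · rw [(M.complete_of_partner ha').2] at h
        cases h
    · rw [M.complete_of_free hb] at h
      rcases ha' : M.partner a' with _ | b'
      · rw [M.complete_of_none ha'] at h
        cases h
      · rw [(M.complete_of_partner ha').2] at h
        rw [← Sum.inr.inj h] at ha'
        exact hb ⟨a', ha'⟩
  · exfalso
    by_cases hb : ∃ a, M.partner a = some b'
    · obtain ⟨a', ha⟩ := hb
      rw [(M.complete_of_partner ha).1] at h
      rcases ha' : M.partner a with _ | b'
      · rw [M.complete_of_none ha'] at h
        rw [← Sum.inl.inj h, ha'] at ha
        cases ha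
      · rw [(M.complete_of_partner ha').2] at h
        cases h
    · rw [M.complete_of_free hb] at h
      rcases ha' : M.partner a with _ | b'
      · rw [M.complete_of_none ha'] at h
        cases h
      · rw [(M.complete_of_partner ha').2] at h
        rw [Sum.inr.inj h] at ha'
        exact hb ⟨a, ha'⟩
  · rcases ha : M.partner a with _ | b
    · rw [M.complete_of_none ha] at h
      rcases ha' : M.partner a' with _ | b'
      · rw [M.complete_of_none ha'] at h
        rw [Sum.inl.inj h]
      · rw [(M.complete_of_partner ha').2] at h
        cases h
    · rw [(M.complete_of_partner ha).2] at h
      rcases ha' : M.partner a' with _ | b'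
      · rw [M.complete_of_none ha'] at h
        cases h
      · rw [(M.complete_of_partner ha').2] at h
        rw [← Sum.inr.inj h] at ha'
        rw [M.partner_inj _ _ _ ha ha']

/-- Edges of the graph in which the perfect matchings represent the matchings of `G`. -/
def SumEdge (G : PopInstance p q) : Fin q ⊕ Fin p → Fin p ⊕ Fin q → Prop
  | .inl b, .inl a => G.adj a b
  | .inr a', .inl a => a' = a
  | _, .inr _ => True

/-- Weights of the edges: the vote of the agent against the matching `M`. -/
noncomputable def sumWeight (G : PopInstance p q) (κ : ℕ) (M : G.Matching) :
    Fin q ⊕ Fin p → Fin p ⊕ Fin q → ℤ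
  | .inl b, .inl a => G.choiceVote κ a (some b) (M.partner a)
  | .inr _, .inl a => G.choiceVote κ a none (M.partner a)
  | _, .inr _ => 0

theorem sumEdge_complete {G : PopInstance p q} (M : G.Matching) (x : Fin q ⊕ Fin p) :
    G.SumEdge x (M.complete x) := by
  rcases x with b | a
  · by_cases hb : ∃ a, M.partner a = some b
    · obtain ⟨a, ha⟩ := hb
      rw [(M.complete_of_partner ha).1]
      exact M.adj_of_partner a b ha
    · rw [M.complete_of_free hb]
      trivial
  · rcases ha : M.partner a with _ | b
    · rw [M.complete_of_none ha]
      rfl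
    · rw [(M.complete_of_partner ha).2]
      trivial

theorem sumWeight_complete {G : PopInstance p q} (κ : ℕ) (M : G.Matching) (x : Fin q ⊕ Fin p) :
    G.sumWeight κ M x (M.complete x) = 0 := by
  rcases x with b | a
  · by_cases hb : ∃ a, M.partner a = some b
    · obtain ⟨a, ha⟩ := hb
      rw [(M.complete_of_partner ha).1]
      simp only [sumWeight, ha]
      exact G.choiceVote_self κ a _
    · rw [M.complete_of_free hb]
      rfl
  · rcases ha : M.partner a with _ | b
    · rw [M.complete_of_none ha]
      simp only [sumWeight, ha]
      exact G.choiceVote_self κ a _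
    · rw [(M.complete_of_partner ha).2]
      rfl

/-- Reading off the mates of the agents turns `σ` into a matching `N` of `G`, with the own dummy
read as being unmatched. Only the agents carry weight, so the total weight is the total vote for `N`
against `M`. -/
theorem sum_sumWeight_le {G : PopInstance p q} {κ : ℕ} {M : G.Matching}
    (hM : G.PopularWithPenalty κ M) (σ : (Fin q ⊕ Fin p) ≃ (Fin p ⊕ Fin q))
    (hσ : ∀ x, G.SumEdge x (σ x)) : ∑ x, G.sumWeight κ M x (σ x) ≤ 0 := by
  let N : G.Matching :=
    { partner := fun a => (σ.symm (.inl a)).getLeft?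
      adj_of_partner := by
        intro a b h
        rw [Sum.getLeft?_eq_some_iff] at h
        have := hσ (σ.symm (.inl a))
        rw [Equiv.apply_symm_apply, h] at this
        exact this
      partner_inj := by
        intro a a' b h h'
        rw [Sum.getLeft?_eq_some_iff] at h h'
        exact Sum.inl.inj (σ.symm.injective (h.trans h'.symm)) }
  have h1 : ∑ x, G.sumWeight κ M x (σ x) = ∑ r, G.sumWeight κ M (σ.symm r) r := by
    rw [← Equiv.sum_comp σ]
    simp
  have h2 : ∀ b : Fin q, G.sumWeight κ M (σ.symm (.inr b)) (.inr b) = 0 := fun b => by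
    rcases σ.symm (.inr b) with _ | _ <;> rfl
  rw [h1, Fintype.sum_sum_type, Finset.sum_eq_zero fun b _ => h2 b, add_zero]
  refine le_trans (le_of_eq (Finset.sum_congr rfl fun a _ => ?_)) (hM N)
  rw [vote_eq]
  have h3 : N.partner a = (σ.symm (.inl a)).getLeft? := rfl
  rw [h3]
  rcases σ.symm (.inl a) with b | a' <;> rfl

/-- A popular matching is supported by prices. -/
theorem exists_prices {G : PopInstance p q} {κ : ℕ} {M : G.Matching}
    (hM : G.PopularWithPenalty κ M) : ∃ y f, IsPrice q κ y ∧ G.IsPerfect κ y f := by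
  obtain ⟨μ, hμ⟩ := Equiv.exists_eq_of_injective_sum _ M.complete_injective
  obtain ⟨u, v, hle, heq⟩ := exists_assignment_potentials G.SumEdge (G.sumWeight κ M) μ
    (fun x => by rw [hμ]; exact sumEdge_complete M x)
    (fun σ hσ => by
      refine (sum_sumWeight_le hM σ hσ).trans (le_of_eq ?_)
      rw [hμ]
      exact (Finset.sum_eq_zero fun x _ => sumWeight_complete κ M x).symm)
  have htight : ∀ x, u x + v (M.complete x) = 0 := fun x => by
    have := heq x
    rw [hμ, sumWeight_complete] at this
    exact this.symm
  have hzero : ∀ x (b : Fin q), 0 ≤ u x + v (.inr b) := fun x b => by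
    have := hle x (.inr b) (by rcases x with _ | _ <;> trivial)
    rcases x with _ | _ <;> exact this
  -- Every absorbing node is joined to all left nodes by edges of weight zero, one of which is
  -- tight. Its potential is therefore minus the minimum of `u`, the same for all absorbing nodes.
  have hattained : ∀ b : Fin q, ∃ x, u x + v (.inr b) = 0 := fun b => by
    by_cases hb : ∃ a, M.partner a = some b
    · obtain ⟨a, ha⟩ := hb
      have := htight (.inr a)
      rw [(M.complete_of_partner ha).2] at this
      exact ⟨_, this⟩
    · have := htight (.inl b)
      rw [M.complete_of_free hb] at this
      exact ⟨_, this⟩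
  have hconst : ∀ b b' : Fin q, v (.inr b) = v (.inr b') := by
    have : ∀ b b' : Fin q, v (.inr b) ≤ v (.inr b') := fun b b' => by
      obtain ⟨x, hx⟩ := hattained b
      have := hzero x b'
      omega
    exact fun b b' => le_antisymm (this b b') (this b' b)
  -- The prices are the potentials of the objects, shifted so that the absorbing nodes have
  -- potential zero.
  let y : ℕ → ℕ := fun x => if h : x < q then (u (.inl ⟨x, h⟩) + v (.inr ⟨x, h⟩)).toNat else 0
  have hyval : ∀ b : Fin q, (y b : ℤ) = u (.inl b) + v (.inr b) := fun b => by
    have : y b = (u (.inl b) + v (.inr b)).toNat := dif_pos b.2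
    rw [this, Int.toNat_of_nonneg (hzero _ _)]
  have hfree : ∀ b : Fin q, (¬ ∃ a, M.partner a = some b) → y b = 0 := fun b hb => by
    have h1 := htight (.inl b)
    rw [M.complete_of_free hb] at h1
    have := hyval b
    omega
  have hmatched : ∀ (a : Fin p) (b : Fin q), M.partner a = some b → y b ≤ κ ∧
      ∀ b', G.adj a b' → y b + G.prefVal a b' b ≤ y b' + G.prefVal a b b' := by
    intro a b ha
    obtain ⟨c1, c2⟩ := M.complete_of_partner ha
    have h1 := htight (.inl b)
    have h2 := htight (.inr a)
    rw [c1] at h1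
    rw [c2] at h2
    have h3 := hyval b
    refine ⟨?_, fun b' hb' => ?_⟩
    -- The edge from the dummy of `a`, of weight `-κ`, caps the price of the partner of `a` at `κ`.
    · have := hle (.inr a) (.inl a) rfl
      simp only [sumWeight, ha, choiceVote] at this
      omega
    · have := hle (.inl b') (.inl a) hb'
      simp only [sumWeight, ha, choiceVote_some] at this
      have h4 := hyval b'
      have h5 := hconst b b'
      omega
  have hunmatched : ∀ a : Fin p, M.partner a = none → ∀ b, G.adj a b → κ ≤ y b := by
    intro a ha b hb
    have h1 := htight (.inr a)
    rw [M.complete_of_none ha] at h1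
    have := hle (.inl b) (.inl a) hb
    simp only [sumWeight, ha, choiceVote] at this
    have h2 := hzero (.inr a) b
    have h3 := hyval b
    omega
  let ofN : ∀ x : ℕ, x < p + q → Fin q ⊕ Fin p := fun x hx =>
    if h : x < q then .inl ⟨x, h⟩ else .inr ⟨x - q, by omega⟩
  have hofN : ∀ x hx x' hx', ofN x hx = ofN x' hx' → x = x' := by
    intro x hx x' hx' h
    simp only [ofN] at h
    split at h <;> split at h
    · simpa using h
    · cases h
    · cases h
    · simp only [Sum.inr.injEq, Fin.mk.injEq] at h
      omega
  let encR : Fin p ⊕ Fin q → ℕ := Sum.elim (fun a => a) (fun b => p + b)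
  have hencR : Function.Injective encR := by
    rintro (a | b) (a' | b') h <;> simp only [encR, Sum.elim_inl, Sum.elim_inr] at h
    · rw [Fin.ext h]
    · omega
    · omega
    · rw [Fin.ext (by omega : (b : ℕ) = b')]
  refine ⟨y, fun x => if h : x < p + q then encR (M.complete (ofN x h)) else 0, ⟨?_, ?_⟩,
    ⟨?_, ?_, ?_⟩⟩
  · intro x
    by_cases hx : x < q
    · by_cases hb : ∃ a, M.partner a = some ⟨x, hx⟩
      · obtain ⟨a, ha⟩ := hb
        exact (hmatched a _ ha).1
      · have := hfree ⟨x, hx⟩ hb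
        simp only at this
        omega
    · simp [y, hx]
  · intro x hx
    simp [y, hx]
  · intro x hx
    simp only [hx, dif_pos]
    rcases M.complete (ofN x hx) with a | b
    · simp only [encR, Sum.elim_inl]; omega
    · simp only [encR, Sum.elim_inr]; omega
  · intro x hx
    simp only [hx, dif_pos]
    by_cases hxq : x < q
    · have hx1 : ofN x hx = .inl ⟨x, hxq⟩ := dif_pos hxq
      rw [hx1]
      by_cases hb : ∃ a, M.partner a = some ⟨x, hxq⟩
      · obtain ⟨a, ha⟩ := hb
        rw [(M.complete_of_partner ha).1]
        refine Or.inl ⟨(G.adjN_coe a ⟨x, hxq⟩).2 (M.adj_of_partner _ _ ha), ?_⟩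
        rintro b' ⟨_, hb', hadj⟩
        exact (hmatched a _ ha).2 ⟨b', hb'⟩ hadj
      · rw [M.complete_of_free hb]
        exact Or.inr (Or.inr ⟨Nat.le_add_right _ _, hfree _ hb⟩)
    · have hx1 : ofN x hx = .inr ⟨x - q, by omega⟩ := dif_neg hxq
      rw [hx1]
      rcases ha : M.partner ⟨x - q, by omega⟩ with _ | b
      · rw [M.complete_of_none ha]
        refine Or.inr (Or.inl ⟨by simp only [encR, Sum.elim_inl]; omega,
          by simp only [encR, Sum.elim_inl]; omega, ?_⟩)
        rintro b ⟨h1, hb, hadj⟩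
        exact hunmatched _ ha ⟨b, hb⟩ hadj
      · rw [(M.complete_of_partner ha).2]
        exact Or.inr (Or.inr ⟨Nat.le_add_right _ _, by simp [y, hxq]⟩)
  · intro x hx x' hx' h
    simp only [hx, hx', dif_pos] at h
    exact hofN x hx x' hx' (M.complete_injective (hencR h))

/-! ### Comparison of the current prices with supporting prices below them. -/

theorem Allowed.of_tight {G : PopInstance p q} {κ : ℕ} {y z : ℕ → ℕ} {x r : ℕ}
    (hzy : ∀ x, z x ≤ y x) (hx : y x = z x) (h : G.Allowed κ z x r) : G.Allowed κ y x r := by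
  rcases h with h | h | h
  · refine Or.inl ⟨h.1, fun b hb => ?_⟩
    have := h.2 b hb
    have := hzy b
    omega
  · exact Or.inr (Or.inl ⟨h.1, h.2.1, fun b hb => (h.2.2 b hb).trans (hzy b)⟩)
  · exact Or.inr (Or.inr ⟨h.1, by omega⟩)

/-- For two objects at an agent, adding the inequality for `x` at `z` to that for `x'` at `y`
cancels the preferences and leaves `y x' - z x' ≤ y x - z x = 0`. If `r` takes its dummy at `z`, all
its neighbours already have the maximal price `κ` at `z`; at an absorbing node `y x'` is zero. -/
theorem Allowed.tight {G : PopInstance p q} {κ : ℕ} {y z : ℕ → ℕ} {x x' r : ℕ}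
    (hy : IsPrice q κ y) (hzy : ∀ x, z x ≤ y x) (hx : y x = z x)
    (h : G.Allowed κ z x r) (h' : G.Allowed κ y x' r) : y x' = z x' := by
  have hzx' := hzy x'
  rcases h with h | h | h
  · rcases h' with h' | h' | h'
    · have h1 := h.2 x' h'.1
      have h2 := h'.2 x h.1
      omega
    · have := hy.dummy x' (by omega)
      omega
    · have := h.1.1
      omega
  · rcases h' with h' | h' | h'
    · have h1 := h.2.2 x' h'.1
      have h2 := hy.le x'
      omega
    · have := hy.dummy x' (by omega)
      omega
    · omega
  · rcases h' with h' | h' | h'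
    · have := h'.1.1
      omega
    · omega
    · omega

/-- A set `U` of left nodes that is closed under alternating paths with respect to the matching
`mr` (`mr r = x + 1` if the right node `r` is matched with `x`) contains no tight free node. -/
theorem not_tight_of_closed {G : PopInstance p q} {κ : ℕ} {y z f mr : ℕ → ℕ} {U : ℕ → Prop}
    (hy : IsPrice q κ y) (hzy : ∀ x, z x ≤ y x) (hf : G.IsPerfect κ z f)
    (hmr : ∀ r < p + q, mr r ≠ 0 → mr r ≤ p + q ∧ G.Allowed κ y (mr r - 1) r)
    (hinj : ∀ r < p + q, ∀ r' < p + q, mr r ≠ 0 → mr r = mr r' → r = r')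
    (hU : ∀ x < p + q, U x → ∀ r < p + q, G.Allowed κ y x r → mr r ≠ 0 ∧ U (mr r - 1))
    {x₀ : ℕ} (hx₀ : x₀ < p + q) (hUx₀ : U x₀) (hfree : ∀ r < p + q, mr r ≠ x₀ + 1) :
    z x₀ < y x₀ := by
  classical
  refine lt_of_le_of_ne (hzy x₀) fun heq => ?_
  let T : Finset ℕ := (Finset.range (p + q)).filter fun x => U x ∧ y x = z x
  have hmem : ∀ x, x ∈ T ↔ x < p + q ∧ U x ∧ y x = z x := fun x => by simp [T]
  -- For a tight `x` in `U` the edge to `f x` is allowed at `y` as well, so `f x` has a mate in `U`,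
  -- and this mate is tight again. The resulting injection of the finite set `T` into itself is
  -- onto, so a tight `x₀` would be a mate.
  have hall : ∀ x ∈ T, mr (f x) ≠ 0 ∧ mr (f x) ≤ p + q ∧ mr (f x) - 1 ∈ T := by
    intro x hx
    obtain ⟨hx1, hx2, hx3⟩ := (hmem x).1 hx
    have hfx := hf.lt x hx1
    have h1 := hf.allowed x hx1
    obtain ⟨h2, h3⟩ := hU x hx1 hx2 _ hfx (h1.of_tight hzy hx3)
    obtain ⟨h4, h5⟩ := hmr _ hfx h2
    exact ⟨h2, h4, (hmem _).2 ⟨by omega, h3, h1.tight hy hzy hx3 h5⟩⟩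
  have hmaps : Set.MapsTo (fun x => mr (f x) - 1) T T := fun x hx => (hall x hx).2.2
  have hio : Set.InjOn (fun x => mr (f x) - 1) T := by
    intro x hx x' hx' h
    have hx1 := ((hmem x).1 hx).1
    have hx1' := ((hmem x').1 hx').1
    have h1 := (hall x hx).1
    have h2 := (hall x' hx').1
    simp only at h
    exact hf.inj x hx1 x' hx1' (hinj _ (hf.lt x hx1) _ (hf.lt x' hx1') h1 (by omega))
  obtain ⟨x, hx, h⟩ := Finset.surjOn_of_injOn_of_card_le _ hmaps hio le_rfl
    (show x₀ ∈ (T : Set ℕ) from (hmem x₀).2 ⟨hx₀, hUx₀, heq.symm⟩)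
  have h1 := (hall x hx).1
  simp only at h
  exact hfree _ (hf.lt x ((hmem x).1 hx).1) (by omega)

end PopInstance

/-! ### Mate tables, and labels that certify a nearly maximum matching. -/

/-- `mr` describes a matching of the bipartite graph `E` on two sides of size `N`: the right node
`r` is matched with the left node `x` if `mr r = x + 1`, and it is free if `mr r = 0`. -/
structure IsMatch (N : ℕ) (E : ℕ → ℕ → Prop) (mr : ℕ → ℕ) : Prop where
  le : ∀ r < N, mr r ≤ N
  edge : ∀ r < N, mr r ≠ 0 → E (mr r - 1) r
  inj : ∀ r < N, ∀ r' < N, mr r ≠ 0 → mr r = mr r' → r = r'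

/-- The number of edges of a matching. -/
def matchSize (N : ℕ) (mr : ℕ → ℕ) : ℕ := ((Finset.range N).filter fun r => mr r ≠ 0).card

theorem matchSize_update_of_ne {N : ℕ} {mr : ℕ → ℕ} {r x : ℕ} (hx : x ≠ 0) (h : mr r ≠ 0) :
    matchSize N (Function.update mr r x) = matchSize N mr := by
  unfold matchSize
  congr 1
  ext r'
  by_cases hr : r' = r
  · subst hr; simp [h, hx]
  · simp [hr]

theorem matchSize_update_of_eq {N : ℕ} {mr : ℕ → ℕ} {r x : ℕ} (hr : r < N) (hx : x ≠ 0)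
    (h : mr r = 0) : matchSize N (Function.update mr r x) = matchSize N mr + 1 := by
  unfold matchSize
  rw [← Finset.card_insert_of_notMem (a := r) (by simp [h])]
  congr 1
  ext r'
  by_cases hr' : r' = r
  · subst hr'; simp [hx, hr]
  · simp [hr']

/-- Here `x` is the successor of a left node, as in the mate table. The old mate of `r` is
overwritten, so `r` need not be free. -/
theorem IsMatch.update {N : ℕ} {E : ℕ → ℕ → Prop} {mr : ℕ → ℕ} (h : IsMatch N E mr) {x r : ℕ}
    (hxN : x ≤ N) (hE : E (x - 1) r) (hfree : ∀ r' < N, mr r' ≠ x) :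
    IsMatch N E (Function.update mr r x) := by
  refine ⟨?_, ?_, ?_⟩
  · intro r' hr'
    rw [Function.update_apply]
    split
    · exact hxN
    · exact h.le r' hr'
  · intro r' hr' h0
    rw [Function.update_apply] at h0 ⊢
    split
    · rename_i h1; rw [h1]; exact hE
    · rename_i h1
      rw [if_neg h1] at h0
      exact h.edge r' hr' h0
  · intro r₁ h₁ r₂ h₂ h0 heq
    rw [Function.update_apply, Function.update_apply] at heq
    rw [Function.update_apply] at h0
    by_cases e₁ : r₁ = r <;> by_cases e₂ : r₂ = r
    · rw [e₁, e₂]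
    · rw [if_pos e₁, if_neg e₂] at heq; exact absurd heq.symm (hfree r₂ h₂)
    · rw [if_neg e₁, if_pos e₂] at heq; exact absurd heq (hfree r₁ h₁)
    · rw [if_neg e₁, if_neg e₂] at heq
      rw [if_neg e₁] at h0
      exact h.inj r₁ h₁ r₂ h₂ h0 heq

theorem IsMatch.update_free {N : ℕ} {E : ℕ → ℕ → Prop} {mr : ℕ → ℕ} (h : IsMatch N E mr) {x r : ℕ}
    (hr : r < N) (hfree : ∀ r' < N, mr r' ≠ x) (hold : mr r ≠ 0) :
    ∀ r' < N, Function.update mr r x r' ≠ mr r := by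
  intro r' hr'
  rw [Function.update_apply]
  split
  · exact (hfree r hr).symm
  · rename_i hne
    exact fun heq => hne (h.inj r hr r' hr' hold heq.symm).symm

open Finset in
/-- Labels with the slack conditions of an auction bound the size of every matching. -/
theorem matchSize_le_of_labels {N L : ℕ} {E : ℕ → ℕ → Prop} {mr mr' π : ℕ → ℕ}
    (h' : IsMatch N E mr') (hfree : ∀ r < N, mr r = 0 → π r = 0)
    (hslack : ∀ r < N, mr r ≠ 0 → ∀ r' < N, E (mr r - 1) r' → π r ≤ π r' + 1)
    (hout : ∀ x < N, (∀ r < N, mr r ≠ x + 1) → ∀ r < N, E x r → L ≤ π r) :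
    L * matchSize N mr' ≤ L * matchSize N mr + N := by
  classical
  -- Each threshold `t` gives a cover of `mr'` by edges of `mr`. A right node of label at least `t`
  -- is matched in `mr`. If the label is below `t ≤ L`, the left end of the edge of `mr'` cannot be
  -- free in `mr`, and by the slack condition its mate there has label at most `t`. Edges of `mr`
  -- counted twice have label exactly `t`.
  have key : ∀ t ∈ Icc 1 L, matchSize N mr' ≤
      matchSize N mr + ((range N).filter fun r => π r = t).card := by
    intro t ht
    rw [mem_Icc] at ht
    let A := (range N).filter fun r => mr r ≠ 0 ∧ t ≤ π r
    let B := (range N).filter fun r => mr r ≠ 0 ∧ π r ≤ t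
    have h1 : A.card + B.card ≤ matchSize N mr + ((range N).filter fun r => π r = t).card := by
      rw [← card_union_add_card_inter]
      refine Nat.add_le_add (card_le_card ?_) (card_le_card ?_)
      · intro r hr
        simp only [A, B, mem_union, mem_filter, mem_range] at hr ⊢
        tauto
      · intro r hr
        simp only [A, B, mem_inter, mem_filter, mem_range] at hr ⊢
        exact ⟨hr.1.1, by omega⟩
    have h2 : ((range N).filter fun r => mr' r ≠ 0 ∧ t ≤ π r).card ≤ A.card := by
      refine card_le_card fun r hr => ?_
      simp only [A, mem_filter, mem_range] at hr ⊢
      refine ⟨hr.1, fun h0 => ?_, hr.2.2⟩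
      have := hfree r hr.1 h0
      omega
    have h3 : ((range N).filter fun r => mr' r ≠ 0 ∧ ¬ t ≤ π r).card ≤ B.card := by
      have hex : ∀ r ∈ (range N).filter fun r => mr' r ≠ 0 ∧ ¬ t ≤ π r,
          ∃ s < N, mr s = mr' r ∧ π s ≤ t := by
        intro r hr
        simp only [mem_filter, mem_range] at hr
        obtain ⟨hrN, h0, hlt⟩ := hr
        have hle := h'.le r hrN
        have hedge := h'.edge r hrN h0
        by_cases hm : ∃ s < N, mr s = mr' r
        · obtain ⟨s, hs, heq⟩ := hm
          have := hslack s hs (by rw [heq]; exact h0) r hrN (by rw [heq]; exact hedge)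
          exact ⟨s, hs, heq, by omega⟩
        · push Not at hm
          have := hout (mr' r - 1) (by omega) (fun s hs => by
            have := hm s hs
            omega) r hrN hedge
          omega
      choose! s hs using hex
      refine card_le_card_of_injOn s ?_ ?_
      · intro r hr
        have h1 := hs r hr
        simp only [coe_filter, Set.mem_ofPred_eq, mem_range] at hr
        simp only [B, coe_filter, Set.mem_ofPred_eq, mem_range]
        exact ⟨h1.1, by rw [h1.2.1]; exact hr.2.1, h1.2.2⟩
      · intro r hr r' hr' heq
        have h1 := hs r hr
        have h2 := hs r' hr'
        simp only [coe_filter, Set.mem_ofPred_eq, mem_range] at hr hr'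
        rw [heq] at h1
        exact h'.inj r hr.1 r' hr'.1 hr.2.1 (h1.2.1.symm.trans h2.2.1)
    have h4 : matchSize N mr' = ((range N).filter fun r => mr' r ≠ 0 ∧ t ≤ π r).card +
        ((range N).filter fun r => mr' r ≠ 0 ∧ ¬ t ≤ π r).card := by
      unfold matchSize
      rw [← card_filter_add_card_filter_not (s := (range N).filter fun r => mr' r ≠ 0)
        (fun r => t ≤ π r), filter_filter, filter_filter]
    omega
  -- The level sets of the label are disjoint, so over all thresholds the excess terms add up to at
  -- most `N`.
  have hsum := sum_le_sum key
  have hcount : ∑ t ∈ Icc 1 L, ((range N).filter fun r => π r = t).card ≤ N := by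
    rw [← card_biUnion]
    · exact (card_le_card (t := range N) fun r hr => by
        simp only [mem_biUnion, mem_filter] at hr
        exact hr.choose_spec.2.1).trans (by simp)
    · intro t _ t' _ hne
      rw [Function.onFun, disjoint_left]
      intro r hr hr'
      simp only [mem_filter] at hr hr'
      exact hne (hr.2.symm.trans hr'.2)
  simp only [sum_const, Nat.card_Icc, Nat.add_sub_cancel, smul_eq_mul, sum_add_distrib] at hsum
  omega

theorem sum_range_update_succ {N r : ℕ} {f : ℕ → ℕ} (hr : r < N) :
    ∑ i ∈ Finset.range N, Function.update f r (f r + 1) i = ∑ i ∈ Finset.range N, f i + 1 := by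
  have hmem : r ∈ Finset.range N := Finset.mem_range.2 hr
  rw [Finset.sum_update_of_mem hmem, ← Finset.add_sum_erase _ f hmem,
    Finset.sdiff_singleton_eq_erase]
  omega

/-! ### The auction. -/

namespace WordRAM

open Ex Cmd

/-- The sizes that occur fit into words and arrays. -/
structure Fits (N W K : ℕ) : Prop where
  two_le : 2 ≤ N
  sq : N * N + N + 1 ≤ K
  word : 16 * K ≤ W

theorem idx_lt {N a b : ℕ} (ha : a < N) (hb : b < N) : a * N + b < N * N := by
  have := Nat.mul_le_mul_right N (Nat.succ_le_of_lt ha)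
  rw [Nat.succ_mul] at this
  omega

theorem idx_inj {N a b a' b' : ℕ} (hb : b < N) (hb' : b' < N) (h : a * N + b = a' * N + b') :
    a = a' ∧ b = b' := cell_inj hb hb' h

/-- The edges stored in an adjacency table with rows for the left nodes. -/
def tableEdge (N : ℕ) (tab : ℕ → ℕ) (x r : ℕ) : Prop := tab (x * N + r) ≠ 0

/-! Variables: `0`, `1`, `2` hold `p`, `q`, `κ`; `3` holds `N = p + q`; `5` holds the label
bound `L`.
Arrays: `0` input and output, `1` prices, `2` adjacency table, `3` mates of the right nodes,
`4` labels, `5` mates of the left nodes, `6` search tree, `7` queue. -/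

/-- Finds the neighbour with the least label below `L` of the left node `v 7 - 1`. -/
def scanLabels : Cmd :=
  asg 8 (var 5) ;; asg 9 0 ;;
  forLoop 10 3
    (ite 0 (get 2 ((var 7 - 1) * var 3 + var 10))
      (ite (get 4 (var 10)) (var 8) (asg 8 (get 4 (var 10)) ;; asg 9 (var 10 + 1)) skip)
      skip)

/-- The running minimum `v 8` starts at `L` and only strict improvements count, while `v 9` is the
successor of the minimizer. Hence `v 9 = 0` means that no neighbour has a label below `L`. -/
theorem wp_scanLabels {N W K L c : ℕ} (hF : Fits N W K) {σ : St} {Q : St → Prop} (h3 : σ.v 3 = N)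
    (h5 : σ.v 5 = L) (h7 : σ.v 7 = c + 1) (hc : c < N)
    (hQ : ∀ τ : St, (∀ x, x ≠ 8 → x ≠ 9 → x ≠ 10 → τ.v x = σ.v x) → τ.a = σ.a →
      τ.time ≤ σ.time + 40 * N + 10 →
      (τ.v 9 = 0 → ∀ r < N, tableEdge N (σ.a 2) c r → L ≤ σ.a 4 r) →
      (τ.v 9 ≠ 0 → τ.v 9 ≤ N ∧ tableEdge N (σ.a 2) c (τ.v 9 - 1) ∧ τ.v 8 = σ.a 4 (τ.v 9 - 1) ∧
        τ.v 8 < L ∧ ∀ r < N, tableEdge N (σ.a 2) c r → τ.v 8 ≤ σ.a 4 r) → Q τ) :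
    scanLabels.wp W K Q σ := by
  obtain ⟨hN2, hsq, hword⟩ := hF
  refine ⟨trivial, trivial, ?_⟩
  simp only [eval_var, cost_var, eval_ofNat, cost_ofNat]
  obtain ⟨I, hI⟩ : ∃ I : ℕ → St → Prop, ∀ k τ, I k τ ↔
      (∀ x, x ≠ 8 → x ≠ 9 → x ≠ 10 → τ.v x = σ.v x) ∧
      τ.a = σ.a ∧ τ.time ≤ σ.time + 40 * k + 7 ∧ τ.v 8 ≤ L ∧
      (∀ r < k, tableEdge N (σ.a 2) c r → τ.v 8 ≤ σ.a 4 r) ∧ (τ.v 9 = 0 → τ.v 8 = L) ∧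
      (τ.v 9 ≠ 0 → τ.v 9 ≤ N ∧ tableEdge N (σ.a 2) c (τ.v 9 - 1) ∧ τ.v 8 = σ.a 4 (τ.v 9 - 1) ∧
        τ.v 8 < L) := ⟨_, fun _ _ => Iff.rfl⟩
  refine wp_forLoop (n := N) I (by decide) (by simp [h3]) (by omega) ?_ ?_ ?_
  · exact (hI _ _).2 ⟨fun x h8 h9 h10 => by simp [h8, h9, h10], rfl, by simp, by simp [h5],
      by simp, by simp [h5], by simp⟩
  · intro k τ hk hk' h10 h3'
    obtain ⟨fr, ha, ht, hL, hmin, h0, h1⟩ := (hI _ _).1 hk'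
    have h7' : τ.v 7 = c + 1 := (fr 7 (by decide) (by decide) (by decide)).trans h7
    have hidx := idx_lt hc hk
    simp only [wp, eval_var, eval_ofNat, eval_get, eval_add, eval_sub, eval_mul, cost_var,
      cost_ofNat, cost_get, cost_add, cost_sub, cost_mul, ok_var, ok_ofNat, ok_get, ok_add, ok_sub,
      ok_mul, St.tick_v, St.tick_a, St.asg_v, h7', h3', h10, true_and,
      Nat.add_sub_cancel, ha]
    refine ⟨by omega, fun he => ⟨by omega, fun hlt => ⟨by omega, ?_⟩, fun hge => ?_⟩, fun he => ?_⟩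
    · have hW : k + 1 < W := by omega
      refine ⟨by simp [h10, hW], by simp [h10], by simp [h3'], (hI _ _).2 ?_⟩
      refine ⟨fun x h8 h9 h10 => by simp [h8, h9, h10, fr x h8 h9 h10], by simp [ha],
        by simp; omega, by simp; omega, ?_, by simp [h10], ?_⟩
      · intro r hr hE
        simp only [St.asg_v, ne_eq, Nat.reduceEqDiff, not_false_eq_true,
          Function.update_of_ne, Function.update_self]
        rcases Nat.lt_succ_iff_lt_or_eq.1 hr with hr | hr
        · exact hlt.le.trans (hmin r hr hE)
        · rw [hr]
      · simp [h10, tableEdge]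
        omega
    · refine (hI _ _).2 ?_
      refine ⟨fun x h8 h9 h10 => by simp [h10, fr x h8 h9 h10], by simp [ha],
        by simp; omega, by simp; omega, ?_, by simpa using h0, by simpa using h1⟩
      intro r hr hE
      simp only [St.asg_v, St.tick_v, ne_eq, Nat.reduceEqDiff, not_false_eq_true,
          Function.update_of_ne]
      rcases Nat.lt_succ_iff_lt_or_eq.1 hr with hr | hr
      · exact hmin r hr hE
      · rw [hr]; omega
    · refine (hI _ _).2 ?_
      refine ⟨fun x h8 h9 h10 => by simp [h10, fr x h8 h9 h10], by simp [ha],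
        by simp; omega, by simp; omega, ?_, by simpa using h0, by simpa using h1⟩
      intro r hr hE
      simp only [St.asg_v, St.tick_v, ne_eq, Nat.reduceEqDiff, not_false_eq_true,
          Function.update_of_ne]
      rcases Nat.lt_succ_iff_lt_or_eq.1 hr with hr | hr
      · exact hmin r hr hE
      · rw [hr] at hE; exact absurd (Nat.pos_of_ne_zero hE) he
  · intro τ hτ
    obtain ⟨fr, ha, ht, hL, hmin, h0, h1⟩ := (hI _ _).1 hτ
    refine hQ _ fr ha (by simp; omega) ?_ ?_
    · intro h9 r hr hE
      have := h0 h9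
      have := hmin r hr hE
      omega
    · intro h9
      obtain ⟨a, b, c, d⟩ := h1 h9
      exact ⟨a, b, c, d, hmin⟩

end WordRAM

/-- The invariant of the auction: the left nodes below `s` have been processed, except that
`cur - 1` is waiting for a partner if `cur ≠ 0`. -/
structure AuctionInv (N L : ℕ) (E : ℕ → ℕ → Prop) (s cur : ℕ) (mr π : ℕ → ℕ) : Prop where
  isMatch : IsMatch N E mr
  le : ∀ r < N, π r ≤ L
  free : ∀ r < N, mr r = 0 → π r = 0
  slack : ∀ r < N, mr r ≠ 0 → ∀ r' < N, E (mr r - 1) r' → π r ≤ π r' + 1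
  out : ∀ x < s, x + 1 ≠ cur → (∀ r < N, mr r ≠ x + 1) → ∀ r < N, E x r → L ≤ π r
  fresh : ∀ x, s ≤ x → ∀ r < N, mr r ≠ x + 1
  cur_le : cur ≤ s
  cur_free : cur ≠ 0 → ∀ r < N, mr r ≠ cur
  le_size : s ≤ N

namespace AuctionInv

variable {N L : ℕ} {E : ℕ → ℕ → Prop} {s cur : ℕ} {mr π : ℕ → ℕ}

theorem init (hm : ∀ r < N, mr r = 0) (hπ : ∀ r < N, π r = 0) : AuctionInv N L E 0 0 mr π where
  isMatch := ⟨fun r hr => by simp [hm r hr], fun r hr h => absurd (hm r hr) h,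
    fun r hr _ _ h => absurd (hm r hr) h⟩
  le r hr := by simp [hπ r hr]
  free r hr _ := hπ r hr
  slack r hr h := absurd (hm r hr) h
  out x hx := absurd hx (Nat.not_lt_zero x)
  fresh x _ r hr := by simp [hm r hr]
  cur_le := le_rfl
  cur_free h := absurd rfl h
  le_size := Nat.zero_le N

theorem start (h : AuctionInv N L E s 0 mr π) (hs : s < N) :
    AuctionInv N L E (s + 1) (s + 1) mr π where
  isMatch := h.isMatch
  le := h.le
  free := h.free
  slack := h.slack
  out x hx hne := h.out x (by omega) (by omega)
  fresh x hx := h.fresh x (by omega)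
  cur_le := le_rfl
  cur_free _ := h.fresh s le_rfl
  le_size := hs

theorem giveUp (h : AuctionInv N L E s cur mr π) (hout : ∀ r < N, E (cur - 1) r → L ≤ π r) :
    AuctionInv N L E s 0 mr π where
  isMatch := h.isMatch
  le := h.le
  free := h.free
  slack := h.slack
  out x hx _ hfree r hr hE := by
    by_cases hc : x + 1 = cur
    · exact hout r hr (by rw [← hc]; exact hE)
    · exact h.out x hx hc hfree r hr hE
  fresh := h.fresh
  cur_le := Nat.zero_le s
  cur_free h := absurd rfl h
  le_size := h.le_size

/-- The label of `r` is minimal among the neighbours of the bidder, so after an increase by one the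
new pair just meets the slack condition. A larger label only relaxes the conditions on other pairs.
The displaced mate waits next, and `mr r = 0` means that nobody does. -/
theorem bid (h : AuctionInv N L E s cur mr π) (hcur : cur ≠ 0) {r : ℕ} (hr : r < N)
    (hE : E (cur - 1) r) (hlt : π r < L) (hmin : ∀ r' < N, E (cur - 1) r' → π r ≤ π r') :
    AuctionInv N L E s (mr r) (Function.update mr r cur) (Function.update π r (π r + 1)) := by
  have hmono : ∀ r', π r' ≤ Function.update π r (π r + 1) r' := fun r' => by
    rw [Function.update_apply]; split
    · rename_i h; subst h; omega
    · exact le_rfl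
  refine ⟨h.isMatch.update (h.cur_le.trans h.le_size) hE (h.cur_free hcur), ?_, ?_, ?_, ?_, ?_, ?_,
    ?_, h.le_size⟩
  · intro r' hr'
    rw [Function.update_apply]; split
    · omega
    · exact h.le r' hr'
  · intro r' hr' h0
    rw [Function.update_apply] at h0 ⊢
    split
    · rename_i h1; rw [if_pos h1] at h0; exact absurd h0 hcur
    · rename_i h1; rw [if_neg h1] at h0; exact h.free r' hr' h0
  · intro r₁ h₁ h0 r₂ h₂ he
    refine le_trans ?_ (Nat.succ_le_succ (hmono r₂))
    by_cases e₁ : r₁ = r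
    · subst e₁
      simp only [Function.update_self] at he ⊢
      exact Nat.succ_le_succ (hmin r₂ h₂ he)
    · simp only [Function.update_of_ne e₁] at he h0 ⊢
      exact h.slack r₁ h₁ h0 r₂ h₂ he
  · intro x hx hne hfree r' hr' he
    refine le_trans (h.out x hx ?_ ?_ r' hr' he) (hmono r')
    · intro hc
      exact hfree r hr (by rw [Function.update_self, hc])
    · intro r'' hr''
      by_cases e : r'' = r
      · rw [e]; exact hne.symm
      · have := hfree r'' hr''
        rwa [Function.update_of_ne e] at this
  · intro x hx r' hr'
    rw [Function.update_apply]; split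
    · have := h.cur_le; omega
    · exact h.fresh x hx r' hr'
  · by_contra hc
    exact h.fresh (mr r - 1) (by omega) r hr (by omega)
  · exact fun h0 => h.isMatch.update_free hr (h.cur_free hcur) h0

end AuctionInv

namespace WordRAM

open Ex Cmd

/-- One bid of the left node `v 7 - 1`; the displaced left node becomes the next bidder. -/
def auctionBid : Cmd :=
  scanLabels ;;
  ite 0 (var 9)
    (asg 11 (get 3 (var 9 - 1)) ;; put 4 (var 9 - 1) (var 8 + 1) ;; put 3 (var 9 - 1) (var 7) ;;
      asg 7 (var 11))
    (asg 7 0)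

/-- Either the label sum grows by one or the bidder gives up; this alternative drives both the
termination and the time bound of the auction. -/
theorem wp_auctionBid {N W K L s cur : ℕ} (hF : Fits N W K) (hLN : L ≤ N) {σ : St} {Q : St → Prop}
    (h3 : σ.v 3 = N) (h5 : σ.v 5 = L) (h7 : σ.v 7 = cur) (hcur : cur ≠ 0)
    (hI : AuctionInv N L (tableEdge N (σ.a 2)) s cur (σ.a 3) (σ.a 4))
    (hQ : ∀ τ : St, (∀ x, x < 7 ∨ 11 < x → τ.v x = σ.v x) →
      (∀ j, j ≠ 3 → j ≠ 4 → τ.a j = σ.a j) → τ.time ≤ σ.time + 40 * N + 60 →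
      AuctionInv N L (tableEdge N (σ.a 2)) s (τ.v 7) (τ.a 3) (τ.a 4) →
      (∑ r ∈ Finset.range N, τ.a 4 r = ∑ r ∈ Finset.range N, σ.a 4 r + 1 ∨
        τ.v 7 = 0 ∧ ∑ r ∈ Finset.range N, τ.a 4 r = ∑ r ∈ Finset.range N, σ.a 4 r) → Q τ) :
    auctionBid.wp W K Q σ := by
  have hcN : cur - 1 < N := by
    have := hI.cur_le
    have := hI.le_size
    omega
  have hsq := hF.sq
  have hword := hF.word
  refine wp_scanLabels hF h3 h5 (by omega : σ.v 7 = (cur - 1) + 1) hcN fun τ fr ha ht hn hs => ?_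
  have h7' : τ.v 7 = cur := (fr 7 (by decide) (by decide) (by decide)).trans h7
  refine ⟨trivial, trivial, fun hlt => ?_, fun hge => ?_⟩
  · have h9 : τ.v 9 ≠ 0 := by
      simp only [eval_ofNat, eval_var] at hlt
      omega
    obtain ⟨hle, hE, h8, hL, hmin⟩ := hs h9
    have hr : τ.v 9 - 1 < N := by omega
    simp only [wp, eval_var, eval_ofNat, eval_get, eval_add, eval_sub, cost_var,
      cost_ofNat, cost_get, cost_add, cost_sub, ok_var, ok_ofNat, ok_get, ok_add, ok_sub,
      St.tick_v, St.tick_a, St.asg_v, true_and, St.put_v, ne_eq,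
      Nat.reduceEqDiff, not_false_eq_true, Function.update_of_ne, Function.update_self, ha, h7',
      and_true]
    refine ⟨by omega, by omega, by omega, by omega, ?_⟩
    rw [h8] at hmin hL
    have hbid := hI.bid hcur hr hE hL hmin
    rw [← h8] at hbid
    apply hQ
    · intro x hx
      have h1 : x ≠ 7 := by omega
      have h2 : x ≠ 11 := by omega
      simp [h1, h2, fr x (by omega) (by omega) (by omega)]
    · intro j h1 h2
      simp [h1, h2, ha]
    · simp; omega
    · simpa [ha] using hbid
    · left
      simp [ha, h8]
      exact sum_range_update_succ hr
  · have h9 : τ.v 9 = 0 := by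
      simp only [eval_ofNat, eval_var] at hge
      omega
    refine ⟨trivial, hQ _ ?_ ?_ ?_ ?_ ?_⟩
    · intro x hx
      have h1 : x ≠ 7 := by omega
      simp [h1, fr x (by omega) (by omega) (by omega)]
    · intro j _ _
      simp [ha]
    · simp; omega
    · simpa [ha] using hI.giveUp (hn h9)
    · right
      simp [ha]

/-- Finds a matching such that all augmenting paths are long. -/
def auction : Cmd :=
  forLoop 6 3 (put 3 (var 6) 0 ;; put 4 (var 6) 0) ;;
  forLoop 6 3 (asg 7 (var 6 + 1) ;; loop 0 (var 7) auctionBid)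

/-- The labels sum to at most `N * L`, and each left node enters once and gives up at most once. So
there are at most `N * L + N` bids, each linear in `N`. -/
theorem wp_auction {N W K L : ℕ} (hF : Fits N W K) (hLN : L ≤ N) {σ : St} {Q : St → Prop}
    (h3 : σ.v 3 = N) (h5 : σ.v 5 = L)
    (hQ : ∀ τ : St, (∀ x, x < 6 ∨ 11 < x → τ.v x = σ.v x) →
      (∀ j, j ≠ 3 → j ≠ 4 → τ.a j = σ.a j) →
      τ.time ≤ σ.time + 120 * (N * (N * L)) + 120 * (N * N) + 20 * N + 20 →
      AuctionInv N L (tableEdge N (σ.a 2)) N 0 (τ.a 3) (τ.a 4) → Q τ) :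
    auction.wp W K Q σ := by
  have hN2 := hF.two_le
  have hsq := hF.sq
  have hword := hF.word
  obtain ⟨I, hI⟩ : ∃ I : ℕ → St → Prop, ∀ k τ, I k τ ↔ (∀ x, x < 6 ∨ 11 < x → τ.v x = σ.v x) ∧
      (∀ j, j ≠ 3 → j ≠ 4 → τ.a j = σ.a j) ∧ τ.time ≤ σ.time + 20 * k + 2 ∧
      (∀ r < k, τ.a 3 r = 0) ∧ (∀ r < k, τ.a 4 r = 0) := ⟨_, fun _ _ => Iff.rfl⟩
  refine wp_forLoop (n := N) I (by decide) h3 (by omega) ?_ ?_ ?_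
  · refine (hI _ _).2 ⟨fun x hx => ?_, fun _ _ _ => rfl, by simp, by simp, by simp⟩
    have h1 : x ≠ 6 := by omega
    simp [h1]
  · intro k τ hk hk' h6 h3'
    obtain ⟨fr, ha, ht, hz, hz'⟩ := (hI _ _).1 hk'
    simp only [wp, eval_var, eval_ofNat, cost_var, cost_ofNat, ok_var, ok_ofNat,
      St.tick_v, true_and, St.put_v, h6, h3']
    refine ⟨by omega, by omega, (hI _ _).2 ⟨?_, ?_, ?_, ?_, ?_⟩⟩
    · intro x hx
      have h1 : x ≠ 6 := by omega
      simp [h1, fr x hx]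
    · intro j h1 h2
      simp [h1, h2, ha j h1 h2]
    · simp; omega
    · intro r hr
      rcases Nat.lt_succ_iff_lt_or_eq.1 hr with hr | hr
      · simp [hr.ne, hz r hr]
      · simp [hr]
    · intro r hr
      rcases Nat.lt_succ_iff_lt_or_eq.1 hr with hr | hr
      · simp [hr.ne, hz' r hr]
      · simp [hr]
  intro σ₁ hσ₁
  obtain ⟨fr₁, ha₁, ht₁, hz, hz'⟩ := (hI _ _).1 hσ₁
  have hE₁ := ha₁ 2 (by decide) (by decide)
  obtain ⟨J, hJ⟩ : ∃ J : ℕ → St → Prop, ∀ k τ, J k τ ↔ (∀ x, x < 6 ∨ 11 < x → τ.v x = σ.v x) ∧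
      (∀ j, j ≠ 3 → j ≠ 4 → τ.a j = σ.a j) ∧
      τ.time ≤ σ.time + 120 * (N * (∑ r ∈ Finset.range N, τ.a 4 r + k)) + 20 * N + 7 ∧
      AuctionInv N L (tableEdge N (σ.a 2)) k 0 (τ.a 3) (τ.a 4) := ⟨_, fun _ _ => Iff.rfl⟩
  refine wp_forLoop (n := N) J (by decide) ((fr₁ 3 (by decide)).trans h3) (by omega) ?_ ?_ ?_
  · refine (hJ _ _).2 ⟨fun x hx => ?_, ha₁, ?_, ?_⟩
    · have h1 : x ≠ 6 := by omega
      simp [h1, fr₁ x hx]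
    · simp; omega
    · exact AuctionInv.init hz hz'
  · intro k τ hk hk' h6 h3'
    obtain ⟨fr, ha, ht, hA⟩ := (hJ _ _).1 hk'
    refine ⟨⟨trivial, trivial, by simp [h6]; omega⟩, ?_⟩
    -- While somebody waits, `40 * N + 63` steps are held in reserve for a bid that raises no label.
    -- Every other bid is paid for by the growth of the label sum.
    refine ⟨fun υ => υ.v 6 = k ∧ (∀ x, x < 6 ∨ 11 < x → υ.v x = σ.v x) ∧
      (∀ j, j ≠ 3 → j ≠ 4 → υ.a j = σ.a j) ∧
      υ.time + 10 + (if υ.v 7 = 0 then 0 else 40 * N + 63) ≤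
        σ.time + 120 * (N * (∑ r ∈ Finset.range N, υ.a 4 r + k + 1)) + 20 * N + 7 ∧
      AuctionInv N L (tableEdge N (σ.a 2)) (k + 1) (υ.v 7) (υ.a 3) (υ.a 4),
      fun υ => 2 * (N * L - ∑ r ∈ Finset.range N, υ.a 4 r) + (if υ.v 7 = 0 then 0 else 1), ?_, ?_⟩
    · refine ⟨by simp [h6], ?_, ha, ?_, ?_⟩
      · intro x hx
        have h1 : x ≠ 7 := by omega
        simp [h1, fr x hx]
      · simp [Nat.mul_add] at ht ⊢
        omega
      · simpa [h6] using hA.start hk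
    · rintro υ ⟨g6, gfr, ga, gt, gA⟩
      refine ⟨trivial, trivial, fun hlt => ?_, fun hge => ?_⟩
      · simp only [eval_ofNat, eval_var] at hlt
        have gE := ga 2 (by decide) (by decide)
        have g0 : υ.v 7 ≠ 0 := by omega
        refine wp_auctionBid (s := k + 1) hF hLN (σ := υ.tick _) ((gfr 3 (by decide)).trans h3)
          ((gfr 5 (by decide)).trans h5) rfl g0 (by simpa [gE] using gA) ?_
        intro υ' fr' ha' ht' hA' hsum
        simp only [St.tick_v, St.tick_a, St.tick_time, gE, cost_var, cost_ofNat]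
          at fr' ha' ht' hA' hsum
        rw [if_neg g0] at gt
        have hle : ∑ r ∈ Finset.range N, υ'.a 4 r ≤ N * L := by
          have := Finset.sum_le_card_nsmul (Finset.range N) (υ'.a 4) L
            fun r hr => hA'.le r (Finset.mem_range.1 hr)
          simpa using this
        refine ⟨⟨(fr' 6 (by decide)).trans g6, fun x hx => ?_, fun j h1 h2 => ?_, ?_, hA'⟩, ?_⟩
        · exact (fr' x (by omega)).trans (gfr x hx)
        · exact (ha' j h1 h2).trans (ga j h1 h2)
        · rcases hsum with hsum | ⟨h0, hsum⟩
          · rw [hsum]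
            simp only [Nat.mul_add] at gt ⊢
            split <;> omega
          · rw [hsum, if_pos h0]
            omega
        · simp only [if_neg g0]
          rcases hsum with hsum | ⟨h0, hsum⟩
          · split <;> omega
          · rw [hsum, if_pos h0]
            omega
      · simp only [eval_ofNat, eval_var] at hge
        have g0 : υ.v 7 = 0 := by omega
        refine ⟨g6, (gfr 3 (by decide)).trans h3, (hJ _ _).2 ⟨?_, ga, ?_, ?_⟩⟩
        · intro x hx
          have h1 : x ≠ 6 := by omega
          simp [h1, gfr x hx]
        · rw [if_pos g0] at gt
          simp [← Nat.add_assoc]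
          omega
        · rw [g0] at gA
          exact gA
  · intro τ hτ
    obtain ⟨fr, ha, ht, hA⟩ := (hJ _ _).1 hτ
    refine hQ _ fr ha ?_ hA
    have hle : ∑ r ∈ Finset.range N, τ.a 4 r ≤ N * L := by
      have := Finset.sum_le_card_nsmul (Finset.range N) (τ.a 4) L
        fun r hr => hA.le r (Finset.mem_range.1 hr)
      simpa using this
    have := Nat.mul_le_mul_left N hle
    simp only [Nat.mul_add] at ht
    simp
    omega

end WordRAM

/-! ### Search for augmenting paths, and maximum matchings. -/

/-- `ml` is the mate table of the left nodes that belongs to `mr`. -/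
structure IsMateTable (N : ℕ) (mr ml : ℕ → ℕ) : Prop where
  le : ∀ x < N, ml x ≤ N
  iff : ∀ x < N, ∀ r < N, ml x = r + 1 ↔ mr r = x + 1

theorem IsMateTable.free {N : ℕ} {mr ml : ℕ → ℕ} (h : IsMateTable N mr ml) {x : ℕ} (hx : x < N)
    (h0 : ml x = 0) : ∀ r < N, mr r ≠ x + 1 := fun r hr he => by
  have := (h.iff x hx r hr).2 he
  omega

theorem IsMateTable.mate {N : ℕ} {mr ml : ℕ → ℕ} (h : IsMateTable N mr ml) {x : ℕ} (hx : x < N)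
    (h0 : ml x ≠ 0) : ml x - 1 < N ∧ mr (ml x - 1) = x + 1 := by
  have := h.le x hx
  exact ⟨by omega, (h.iff x hx _ (by omega)).1 (by omega)⟩

/-- The invariant of a search backwards from the free right nodes. The queue `Q` holds the reached
right nodes; `nxt x = r + 1` if the left node `x` was reached from `r`; `fnd` is `0` or the
successor of a reached free left node. -/
structure SearchInv (N : ℕ) (E : ℕ → ℕ → Prop) (mr nxt Q : ℕ → ℕ) (tail fnd : ℕ) : Prop where
  lt : ∀ i < tail, Q i < N
  inj : ∀ i < tail, ∀ j < tail, Q i = Q j → i = j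
  free : ∀ r < N, mr r = 0 → ∃ i < tail, Q i = r
  parent : ∀ i < tail, mr (Q i) ≠ 0 → ∃ j < i, nxt (mr (Q i) - 1) = Q j + 1
  nxt_eq : ∀ x < N, nxt x ≠ 0 → ∃ i < tail, nxt x = Q i + 1 ∧ E x (Q i)
  mate : ∀ x < N, nxt x ≠ 0 → ∀ r < N, mr r = x + 1 → ∃ i < tail, Q i = r
  fnd_spec : fnd ≠ 0 → fnd ≤ N ∧ nxt (fnd - 1) ≠ 0 ∧ ∀ r < N, mr r ≠ fnd
  not_fnd : fnd = 0 → ∀ x < N, nxt x ≠ 0 → ∃ r < N, mr r = x + 1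

namespace SearchInv

variable {N : ℕ} {E : ℕ → ℕ → Prop} {mr ml nxt Q : ℕ → ℕ} {tail fnd : ℕ}

theorem tail_le (h : SearchInv N E mr nxt Q tail fnd) : tail ≤ N := by
  have := Finset.card_le_card_of_injOn (s := Finset.range tail) (t := Finset.range N) Q
    (fun i hi => by simpa using h.lt i (by simpa using hi))
    (fun i hi j hj he => h.inj i (by simpa using hi) j (by simpa using hj) he)
  simpa using this

/-- Reaching a matched left node. -/
theorem visit (h : SearchInv N E mr nxt Q tail fnd) (hm : IsMateTable N mr ml) {x i : ℕ}
    (hx : x < N) (h0 : nxt x = 0) (hi : i < tail) (hE : E x (Q i)) (hml : ml x ≠ 0) :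
    SearchInv N E mr (Function.update nxt x (Q i + 1)) (Function.update Q tail (ml x - 1))
      (tail + 1) fnd := by
  obtain ⟨hlt, hmr⟩ := hm.mate hx hml
  -- Had the mate of `x` been queued already, its parent entry would show that `x` was reached,
  -- contrary to `nxt x = 0`.
  have hnew : ∀ j < tail, Q j ≠ ml x - 1 := by
    intro j hj he
    obtain ⟨k, _, hk⟩ := h.parent j hj (by rw [he, hmr]; omega)
    rw [he, hmr, Nat.add_sub_cancel, h0] at hk
    omega
  have hQ : ∀ j < tail, Function.update Q tail (ml x - 1) j = Q j :=
    fun j hj => Function.update_of_ne hj.ne _ _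
  have hnxt : ∀ z, Function.update nxt x (Q i + 1) z ≠ 0 → z = x ∨ nxt z ≠ 0 := fun z hz => by
    by_cases hzx : z = x
    · exact Or.inl hzx
    · rw [Function.update_of_ne hzx] at hz; exact Or.inr hz
  have hnxt' : ∀ z, nxt z ≠ 0 → Function.update nxt x (Q i + 1) z = nxt z := fun z hz =>
    Function.update_of_ne (by rintro rfl; exact hz h0) _ _
  refine ⟨?_, ?_, ?_, ?_, ?_, ?_, ?_, ?_⟩
  · intro j hj
    rcases Nat.lt_succ_iff_lt_or_eq.1 hj with hj | rfl
    · rw [hQ j hj]; exact h.lt j hj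
    · simpa using hlt
  · intro j hj k hk he
    rcases Nat.lt_succ_iff_lt_or_eq.1 hj with hj | hj <;>
    rcases Nat.lt_succ_iff_lt_or_eq.1 hk with hk | hk
    · rw [hQ j hj, hQ k hk] at he
      exact h.inj j hj k hk he
    · rw [hQ j hj, hk, Function.update_self] at he
      exact absurd he (hnew j hj)
    · rw [hQ k hk, hj, Function.update_self] at he
      exact absurd he.symm (hnew k hk)
    · omega
  · intro r hr hr0
    obtain ⟨j, hj, he⟩ := h.free r hr hr0
    exact ⟨j, by omega, by rw [hQ j hj, he]⟩
  · intro j hj hne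
    rcases Nat.lt_succ_iff_lt_or_eq.1 hj with hj | hj
    · rw [hQ j hj] at hne ⊢
      obtain ⟨k, hk, he⟩ := h.parent j hj hne
      exact ⟨k, hk, by rw [hQ k (by omega), hnxt' _ (by omega), he]⟩
    · subst hj
      rw [Function.update_self, hmr, Nat.add_sub_cancel, Function.update_self]
      exact ⟨i, hi, by rw [hQ i hi]⟩
  · intro z hz hne
    rcases hnxt z hne with rfl | hz0
    · exact ⟨i, by omega, by rw [Function.update_self, hQ i hi], by rw [hQ i hi]; exact hE⟩
    · obtain ⟨j, hj, h1, h2⟩ := h.nxt_eq z hz hz0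
      exact ⟨j, by omega, by rw [hnxt' z hz0, hQ j hj, h1], by rw [hQ j hj]; exact h2⟩
  · intro z hz hne r hr hmz
    rcases hnxt z hne with rfl | hz0
    · refine ⟨tail, by omega, ?_⟩
      rw [Function.update_self]
      have := (hm.iff z hz r hr).2 hmz
      omega
    · obtain ⟨j, hj, he⟩ := h.mate z hz hz0 r hr hmz
      exact ⟨j, by omega, by rw [hQ j hj, he]⟩
  · intro hf
    obtain ⟨h1, h2, h3⟩ := h.fnd_spec hf
    exact ⟨h1, by rw [hnxt' _ h2]; exact h2, h3⟩
  · intro hf z hz hne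
    rcases hnxt z hne with rfl | hz0
    · exact ⟨_, hlt, hmr⟩
    · exact h.not_fnd hf z hz hz0

/-- Reaching a free left node. -/
theorem visit_free (h : SearchInv N E mr nxt Q tail fnd) (hm : IsMateTable N mr ml) {x i : ℕ}
    (hx : x < N) (h0 : nxt x = 0) (hi : i < tail) (hE : E x (Q i)) (hml : ml x = 0) :
    SearchInv N E mr (Function.update nxt x (Q i + 1)) Q tail (x + 1) := by
  have hfree := hm.free hx hml
  have hnxt : ∀ z, Function.update nxt x (Q i + 1) z ≠ 0 → z = x ∨ nxt z ≠ 0 := fun z hz => by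
    by_cases hzx : z = x
    · exact Or.inl hzx
    · rw [Function.update_of_ne hzx] at hz; exact Or.inr hz
  have hnxt' : ∀ z, nxt z ≠ 0 → Function.update nxt x (Q i + 1) z = nxt z := fun z hz =>
    Function.update_of_ne (by rintro rfl; exact hz h0) _ _
  refine ⟨h.lt, h.inj, h.free, ?_, ?_, ?_, ?_, ?_⟩
  · intro j hj hne
    obtain ⟨k, hk, he⟩ := h.parent j hj hne
    exact ⟨k, hk, by rw [hnxt' _ (by omega), he]⟩
  · intro z hz hne
    rcases hnxt z hne with rfl | hz0
    · exact ⟨i, hi, by rw [Function.update_self], hE⟩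
    · rw [hnxt' z hz0]; exact h.nxt_eq z hz hz0
  · intro z hz hne r hr hmz
    rcases hnxt z hne with rfl | hz0
    · exact absurd hmz (hfree r hr)
    · exact h.mate z hz hz0 r hr hmz
  · intro _
    refine ⟨hx, ?_, hfree⟩
    rw [Nat.add_sub_cancel, Function.update_self]
    omega
  · intro hf
    omega

/-- A finished search that reached no free left node leaves a set of left nodes that is closed under
alternating paths and contains all free left nodes. -/
theorem closed (h : SearchInv N E mr nxt Q tail 0)
    (hdone : ∀ i < tail, ∀ x < N, E x (Q i) → nxt x ≠ 0) :
    (∀ x < N, nxt x = 0 → ∀ r < N, E x r → mr r ≠ 0 ∧ nxt (mr r - 1) = 0 ∨ N < mr r) ∧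
      ∀ x < N, (∀ r < N, mr r ≠ x + 1) → nxt x = 0 := by
  refine ⟨fun x hx h0 r hr hE => ?_, fun x hx hfree => ?_⟩
  · have hnot : ∀ i < tail, Q i ≠ r := fun i hi he => hdone i hi x hx (by rw [he]; exact hE) h0
    have hr0 : mr r ≠ 0 := fun hr0 => by
      obtain ⟨i, hi, he⟩ := h.free r hr hr0
      exact hnot i hi he
    -- The range of `mr` is not among the hypotheses, so an entry above `N` is kept as a separate
    -- alternative.
    by_cases hle : mr r ≤ N
    · refine Or.inl ⟨hr0, ?_⟩
      by_contra hne
      obtain ⟨i, hi, he⟩ := h.mate (mr r - 1) (by omega) hne r hr (by omega)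
      exact hnot i hi he
    · omega
  · by_contra hne
    obtain ⟨r, hr, he⟩ := h.not_fnd rfl x hx hne
    exact hfree r hr he

end SearchInv

/-- The invariant of augmenting along the search tree: `cur - 1` waits for a partner if `cur ≠ 0`,
and the right nodes at queue positions below `b` still have their original mates. -/
structure AugmentInv (N : ℕ) (E : ℕ → ℕ → Prop) (mr₀ nxt Q : ℕ → ℕ) (tail b cur : ℕ)
    (mr : ℕ → ℕ) : Prop where
  isMatch : IsMatch N E mr
  le : cur ≤ N
  bound : b ≤ tail
  same : ∀ i < b, mr (Q i) = mr₀ (Q i)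
  free : cur ≠ 0 → ∀ r < N, mr r ≠ cur
  next : cur ≠ 0 → ∃ i < b, nxt (cur - 1) = Q i + 1
  size : matchSize N mr = matchSize N mr₀ + if cur = 0 then 1 else 0

/-- The waiting node takes the right node `Q i` through which it was reached. The mate displaced
there was itself reached through an earlier queue position, where the mates are still the original
ones. So `b` decreases, and reaching a free right node adds an edge. -/
theorem AugmentInv.step {N : ℕ} {E : ℕ → ℕ → Prop} {mr₀ nxt Q mr : ℕ → ℕ} {tail b cur fnd : ℕ}
    (h : AugmentInv N E mr₀ nxt Q tail b cur mr) (hS : SearchInv N E mr₀ nxt Q tail fnd)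
    (hcur : cur ≠ 0) : nxt (cur - 1) - 1 < N ∧ ∃ b' < b, AugmentInv N E mr₀ nxt Q tail b'
      (mr (nxt (cur - 1) - 1)) (Function.update mr (nxt (cur - 1) - 1) cur) := by
  obtain ⟨i, hi, he⟩ := h.next hcur
  have hle := h.le
  have hb := h.bound
  have hr : nxt (cur - 1) - 1 = Q i := by omega
  obtain ⟨j, hj, hej, hE⟩ := hS.nxt_eq (cur - 1) (by omega) (by omega)
  have hij : Q j = Q i := by omega
  rw [hij] at hE
  have hQN := hS.lt i (by omega)
  rw [hr]
  refine ⟨hQN, i, hi, h.isMatch.update hle hE (h.free hcur), h.isMatch.le _ hQN, by omega, ?_,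
    ?_, ?_, ?_⟩
  · intro k hk
    rw [Function.update_of_ne, h.same k (by omega)]
    intro hc
    have := hS.inj k (by omega) i (by omega) hc
    omega
  · exact h.isMatch.update_free hQN (h.free hcur)
  · intro hne
    rw [h.same i hi] at hne ⊢
    exact hS.parent i (by omega) hne
  · have hsz := h.size
    rw [if_neg hcur] at hsz
    split
    · rename_i h0
      rw [matchSize_update_of_eq hQN hcur h0, hsz]
    · rename_i h0
      rw [matchSize_update_of_ne hcur h0, hsz]

theorem SearchInv.augment {N : ℕ} {E : ℕ → ℕ → Prop} {mr nxt Q : ℕ → ℕ} {tail fnd : ℕ}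
    (h : SearchInv N E mr nxt Q tail fnd) (hm : IsMatch N E mr) (hf : fnd ≠ 0) :
    AugmentInv N E mr nxt Q tail tail fnd mr where
  isMatch := hm
  le := (h.fnd_spec hf).1
  bound := le_rfl
  same _ _ := rfl
  free _ := (h.fnd_spec hf).2.2
  next _ := by
    obtain ⟨h1, h2, -⟩ := h.fnd_spec hf
    obtain ⟨i, hi, he, -⟩ := h.nxt_eq (fnd - 1) (by omega) h2
    exact ⟨i, hi, he⟩
  size := by rw [if_neg hf, Nat.add_zero]

namespace WordRAM

open Ex Cmd

/-- Computes the mates of the left nodes, empties the search tree and fills the queue with the free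
right nodes. -/
def prepareSearch : Cmd :=
  forLoop 12 3 (put 5 (var 12) 0 ;; put 6 (var 12) 0) ;;
  asg 13 0 ;;
  forLoop 12 3 (ite 0 (get 3 (var 12)) (put 5 (get 3 (var 12) - 1) (var 12 + 1))
    (put 7 (var 13) (var 12) ;; asg 13 (var 13 + 1)))

theorem wp_prepareSearch {N W K : ℕ} (hF : Fits N W K) {σ : St} {Q : St → Prop}
    {E : ℕ → ℕ → Prop} (h3 : σ.v 3 = N) (hM : IsMatch N E (σ.a 3))
    (hQ : ∀ τ : St, (∀ x, x ≠ 12 → x ≠ 13 → τ.v x = σ.v x) →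
      (∀ j, j ≠ 5 → j ≠ 6 → j ≠ 7 → τ.a j = σ.a j) → τ.time ≤ σ.time + 60 * N + 20 →
      IsMateTable N (σ.a 3) (τ.a 5) → (∀ x < N, τ.a 6 x = 0) →
      SearchInv N E (σ.a 3) (τ.a 6) (τ.a 7) (τ.v 13) 0 → Q τ) :
    prepareSearch.wp W K Q σ := by
  have hN2 := hF.two_le
  have hsq := hF.sq
  have hword := hF.word
  obtain ⟨I, hI⟩ : ∃ I : ℕ → St → Prop, ∀ k τ, I k τ ↔ (∀ x, x ≠ 12 → τ.v x = σ.v x) ∧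
      (∀ j, j ≠ 5 → j ≠ 6 → τ.a j = σ.a j) ∧ τ.time ≤ σ.time + 20 * k + 2 ∧
      (∀ r < k, τ.a 5 r = 0) ∧ (∀ r < k, τ.a 6 r = 0) := ⟨_, fun _ _ => Iff.rfl⟩
  refine wp_forLoop (n := N) I (by decide) h3 (by omega) ?_ ?_ ?_
  · exact (hI _ _).2 ⟨fun x h1 => by simp [h1], fun _ _ _ => rfl, by simp, by simp, by simp⟩
  · intro k τ hk hk' h6 h3'
    obtain ⟨fr, ha, ht, hz, hz'⟩ := (hI _ _).1 hk'
    simp only [wp, eval_var, eval_ofNat, cost_var, cost_ofNat, ok_var, ok_ofNat,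
      St.tick_v, true_and, St.put_v, h6, h3']
    refine ⟨by omega, by omega, (hI _ _).2 ⟨?_, ?_, ?_, ?_, ?_⟩⟩
    · intro x h1
      simp [h1, fr x h1]
    · intro j h1 h2
      simp [h1, h2, ha j h1 h2]
    · simp; omega
    · intro r hr
      rcases Nat.lt_succ_iff_lt_or_eq.1 hr with hr | hr
      · simp [hr.ne, hz r hr]
      · simp [hr]
    · intro r hr
      rcases Nat.lt_succ_iff_lt_or_eq.1 hr with hr | hr
      · simp [hr.ne, hz' r hr]
      · simp [hr]
  intro σ₁ hσ₁
  obtain ⟨fr₁, ha₁, ht₁, hz, hz'⟩ := (hI _ _).1 hσ₁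
  refine ⟨trivial, ?_⟩
  simp only [eval_ofNat, cost_ofNat]
  obtain ⟨J, hJ⟩ : ∃ J : ℕ → St → Prop, ∀ k τ, J k τ ↔
      (∀ x, x ≠ 12 → x ≠ 13 → τ.v x = σ.v x) ∧
      (∀ j, j ≠ 5 → j ≠ 6 → j ≠ 7 → τ.a j = σ.a j) ∧ τ.time ≤ σ.time + 20 * N + 40 * k + 10 ∧
      (∀ r < N, τ.a 6 r = 0) ∧ τ.v 13 ≤ k ∧
      (∀ x < N, τ.a 5 x ≤ k ∧ ∀ r, τ.a 5 x = r + 1 ↔ r < k ∧ σ.a 3 r = x + 1) ∧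
      (∀ i < τ.v 13, τ.a 7 i < k ∧ σ.a 3 (τ.a 7 i) = 0) ∧
      (∀ i < τ.v 13, ∀ j < τ.v 13, τ.a 7 i = τ.a 7 j → i = j) ∧
      (∀ r < k, σ.a 3 r = 0 → ∃ i < τ.v 13, τ.a 7 i = r) := ⟨_, fun _ _ => Iff.rfl⟩
  refine wp_forLoop (n := N) J (by decide) (by simp [fr₁ 3, h3]) (by omega) ?_ ?_ ?_
  · refine (hJ _ _).2 ⟨fun x h1 h2 => by simp [h1, h2, fr₁ x h1], fun j h1 h2 h3 => ha₁ j h1 h2, ?_,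
      hz', by simp, ?_, by simp, by simp, by simp⟩
    · simp; omega
    · intro x hx
      simp [hz x hx]
  · intro k τ hk hk' h12 h3'
    obtain ⟨fr, ha, ht, h6, h13, h5, hq, hinj, hfree⟩ := (hJ _ _).1 hk'
    have ha3 := ha 3 (by decide) (by decide) (by decide)
    have hle := hM.le k hk
    simp only [wp, eval_var, eval_ofNat, eval_get, eval_add, eval_sub, cost_var,
      cost_ofNat, cost_get, cost_add, cost_sub, ok_var, ok_ofNat, ok_get, ok_add, ok_sub,
      St.tick_v, St.tick_a, St.put_v, true_and, and_true, St.asg_v, h12, h3', ha3, ne_eq,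
      Nat.reduceEqDiff, not_false_eq_true, Function.update_of_ne]
    refine ⟨by omega, fun hlt => ⟨by omega, by omega, by omega, (hJ _ _).2 ?_⟩,
      fun hge => ⟨by omega, by omega, (hJ _ _).2 ?_⟩⟩
    · refine ⟨fun x h1 h2 => by simp [h1, fr x h1 h2], fun j h1 h2 h3 => by
        simp [h1, ha j h1 h2 h3], by simp; omega, by simpa using h6, by simp; omega, ?_, ?_,
        by simpa using hinj, ?_⟩
      · intro x hx
        by_cases hxk : x = σ.a 3 k - 1
        · subst hxk
          simp only [St.asg_a, St.put_a, St.tick_a, Function.update_self]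
          refine ⟨le_rfl, fun r => ⟨fun h => ?_, fun h => ?_⟩⟩
          · obtain rfl : k = r := by omega
            exact ⟨by omega, by omega⟩
          · rw [hM.inj r (by omega) k hk (by omega) (by omega)]
        · simp only [St.asg_a, St.put_a, St.tick_a, Function.update_self,
            Function.update_of_ne hxk]
          obtain ⟨h1, h2⟩ := h5 x hx
          refine ⟨by omega, fun r => (h2 r).trans ⟨fun h => ⟨by omega, h.2⟩, fun h => ⟨?_, h.2⟩⟩⟩
          rcases Nat.lt_succ_iff_lt_or_eq.1 h.1 with hr | hr
          · exact hr
          · have := h.2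
            rw [hr] at this
            omega
      · intro i hi
        have := hq i (by simpa using hi)
        simp only [St.asg_a, St.put_a, St.tick_a, ne_eq, Nat.reduceEqDiff, not_false_eq_true,
          Function.update_of_ne]
        exact ⟨by omega, this.2⟩
      · intro r hr h0
        rcases Nat.lt_succ_iff_lt_or_eq.1 hr with hr | hr
        · simpa using hfree r hr h0
        · rw [hr] at h0; omega
    · have hk0 : σ.a 3 k = 0 := by omega
      refine ⟨fun x h1 h2 => by simp [h1, h2, fr x h1 h2], fun j h1 h2 h3 => by
        simp [h3, ha j h1 h2 h3], by simp; omega, by simpa using h6, by simp; omega, ?_, ?_, ?_, ?_⟩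
      · intro x hx
        simp only [St.asg_a, St.put_a, St.tick_a, ne_eq, Nat.reduceEqDiff, not_false_eq_true,
          Function.update_of_ne]
        obtain ⟨h1, h2⟩ := h5 x hx
        refine ⟨by omega, fun r => (h2 r).trans ⟨fun h => ⟨by omega, h.2⟩, fun h => ⟨?_, h.2⟩⟩⟩
        rcases Nat.lt_succ_iff_lt_or_eq.1 h.1 with hr | hr
        · exact hr
        · have := h.2
          rw [hr] at this
          omega
      · intro i hi
        simp only [St.asg_v, St.put_v, St.tick_v, ne_eq, Nat.reduceEqDiff, not_false_eq_true,
          Function.update_of_ne, Function.update_self] at hi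
        simp only [St.asg_a, St.put_a, St.tick_a, Function.update_self, Function.update_apply]
        split
        · exact ⟨by omega, hk0⟩
        · have := hq i (by omega)
          exact ⟨by omega, this.2⟩
      · intro i hi j hj he
        simp only [St.asg_v, St.put_v, St.tick_v, ne_eq, Nat.reduceEqDiff, not_false_eq_true,
          Function.update_of_ne, Function.update_self] at hi hj
        simp only [St.asg_a, St.put_a, St.tick_a, Function.update_self, Function.update_apply] at he
        split at he <;> split at he
        · omega
        · have := hq j (by omega); omega
        · have := hq i (by omega); omega
        · exact hinj i (by omega) j (by omega) he
      · intro r hr h0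
        simp only [St.asg_v, St.put_v, St.tick_v, ne_eq, Nat.reduceEqDiff, not_false_eq_true,
          Function.update_of_ne, Function.update_self, St.asg_a, St.put_a, St.tick_a]
        rcases Nat.lt_succ_iff_lt_or_eq.1 hr with hr | hr
        · obtain ⟨i, hi, he⟩ := hfree r hr h0
          exact ⟨i, by omega, by rw [Function.update_of_ne hi.ne, he]⟩
        · exact ⟨τ.v 13, by omega, by rw [Function.update_self, hr]⟩
  · intro τ hτ
    obtain ⟨fr, ha, ht, h6, h13, h5, hq, hinj, hfree⟩ := (hJ _ _).1 hτ
    refine hQ _ fr ha (by simp; omega) ⟨fun x hx => (h5 x hx).1, fun x hx r hr => ?_⟩ h6 ?_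
    · exact ((h5 x hx).2 r).trans ⟨fun h => h.2, fun h => ⟨hr, h⟩⟩
    · exact ⟨fun i hi => (hq i hi).1, hinj, hfree, fun i hi hne => absurd (hq i hi).2 hne,
        fun x hx hne => absurd (h6 x hx) hne, fun x hx hne => absurd (h6 x hx) hne,
        fun h => absurd rfl h, fun _ x hx hne => absurd (h6 x hx) hne⟩

/-- Processes the right node `v 16`. -/
def searchNode : Cmd :=
  forLoop 17 3 (ite 0 (get 2 (var 17 * var 3 + var 16))
    (ite (get 6 (var 17)) 1
      (put 6 (var 17) (var 16 + 1) ;;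
        ite 0 (get 5 (var 17)) (put 7 (var 13) (get 5 (var 17) - 1) ;; asg 13 (var 13 + 1))
          (asg 15 (var 17 + 1)))
      skip)
    skip)

theorem wp_searchNode {N W K i : ℕ} (hF : Fits N W K) {σ : St} {Q : St → Prop} {mr : ℕ → ℕ}
    (h3 : σ.v 3 = N) (hM : IsMateTable N mr (σ.a 5)) (hi : i < σ.v 13) (h16 : σ.v 16 = σ.a 7 i)
    (hS : SearchInv N (tableEdge N (σ.a 2)) mr (σ.a 6) (σ.a 7) (σ.v 13) (σ.v 15))
    (hQ : ∀ τ : St, (∀ x, x ≠ 13 → x ≠ 15 → x ≠ 17 → τ.v x = σ.v x) →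
      (∀ j, j ≠ 6 → j ≠ 7 → τ.a j = σ.a j) → τ.time ≤ σ.time + 70 * N + 5 →
      SearchInv N (tableEdge N (σ.a 2)) mr (τ.a 6) (τ.a 7) (τ.v 13) (τ.v 15) →
      σ.v 13 ≤ τ.v 13 → (∀ j < σ.v 13, τ.a 7 j = σ.a 7 j) →
      (∀ x < N, σ.a 6 x ≠ 0 → τ.a 6 x ≠ 0) →
      (∀ x < N, tableEdge N (σ.a 2) x (σ.a 7 i) → τ.a 6 x ≠ 0) → Q τ) :
    searchNode.wp W K Q σ := by
  have hN2 := hF.two_le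
  have hsq := hF.sq
  have hword := hF.word
  have hrN := hS.lt i hi
  obtain ⟨I, hI⟩ : ∃ I : ℕ → St → Prop, ∀ k τ, I k τ ↔
      (∀ x, x ≠ 13 → x ≠ 15 → x ≠ 17 → τ.v x = σ.v x) ∧
      (∀ j, j ≠ 6 → j ≠ 7 → τ.a j = σ.a j) ∧ τ.time ≤ σ.time + 70 * k + 2 ∧
      SearchInv N (tableEdge N (σ.a 2)) mr (τ.a 6) (τ.a 7) (τ.v 13) (τ.v 15) ∧
      σ.v 13 ≤ τ.v 13 ∧ (∀ j < σ.v 13, τ.a 7 j = σ.a 7 j) ∧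
      (∀ x < N, σ.a 6 x ≠ 0 → τ.a 6 x ≠ 0) ∧
      (∀ x < k, tableEdge N (σ.a 2) x (σ.a 7 i) → τ.a 6 x ≠ 0) := ⟨_, fun _ _ => Iff.rfl⟩
  refine wp_forLoop (n := N) I (by decide) h3 (by omega) ?_ ?_ ?_
  · exact (hI _ _).2 ⟨fun x _ _ h => by simp [h], fun _ _ _ => rfl, by simp, by simpa using hS,
      by simp, by simp, by simp, by simp⟩
  · intro k τ hk hk' h17 h3'
    obtain ⟨fr, ha, ht, hSτ, hmono, hq, hn, hdone⟩ := (hI _ _).1 hk'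
    have ha5 := ha 5 (by decide) (by decide)
    have ha2 := ha 2 (by decide) (by decide)
    have h16' := (fr 16 (by decide) (by decide) (by decide)).trans h16
    have hidx := idx_lt hk hrN
    have htail := hSτ.tail_le
    have hqi := hq i hi
    have hMle := hM.le k hk
    simp only [wp, eval_var, eval_ofNat, eval_get, eval_add, eval_sub, eval_mul, cost_var,
      cost_ofNat, cost_get, cost_add, cost_sub, cost_mul, ok_var, ok_ofNat, ok_get, ok_add, ok_sub,
      ok_mul, St.tick_v, St.tick_a, St.put_v, St.put_a, true_and, and_true, St.asg_v, h17, h3', ha2,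
      h16', ne_eq, Nat.reduceEqDiff, not_false_eq_true, Function.update_of_ne, ha5]
    refine ⟨by omega, fun hE => ⟨by omega, fun h0 => ⟨by omega, by omega, by omega,
      fun h5 => ⟨by omega, by omega, by omega, (hI _ _).2 ?_⟩,
      fun h5 => ⟨by omega, (hI _ _).2 ?_⟩⟩, fun h0 => (hI _ _).2 ?_⟩, fun hE => (hI _ _).2 ?_⟩
    · have hv := hSτ.visit hM hk (by omega) (by omega : i < τ.v 13)
        (by rw [hqi]; exact Nat.pos_iff_ne_zero.1 hE) (by omega)
      rw [hqi] at hv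
      refine ⟨fun x h1 h2 h3 => by simp [h1, h3, fr x h1 h2 h3], fun j h1 h2 => by
        simp [h1, h2, ha j h1 h2], by simp; omega, by simpa using hv, by simp; omega, ?_, ?_, ?_⟩
      · intro j hj
        have : j ≠ τ.v 13 := by omega
        simp [this, hq j hj]
      · intro x hx hne
        have := hn x hx hne
        by_cases hxk : x = k
        · simp [hxk]
        · simp [hxk, this]
      · intro x hx hE'
        by_cases hxk : x = k
        · simp [hxk]
        · have := hdone x (by omega) hE'
          simp [hxk, this]
    · have hv := hSτ.visit_free hM hk (by omega) (by omega : i < τ.v 13)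
        (by rw [hqi]; exact Nat.pos_iff_ne_zero.1 hE) (by omega)
      rw [hqi] at hv
      refine ⟨fun x h1 h2 h3 => by simp [h2, h3, fr x h1 h2 h3], fun j h1 h2 => by
        simp [h1, ha j h1 h2], by simp; omega, by simpa using hv, by simp; omega, ?_, ?_, ?_⟩
      · intro j hj
        simp [hq j hj]
      · intro x hx hne
        have := hn x hx hne
        by_cases hxk : x = k
        · simp [hxk]
        · simp [hxk, this]
      · intro x hx hE'
        by_cases hxk : x = k
        · simp [hxk]
        · have := hdone x (by omega) hE'
          simp [hxk, this]
    · refine ⟨fun x h1 h2 h3 => by simp [h3, fr x h1 h2 h3], ha, by simp; omega, by simpa using hSτ,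
        by simp; omega, hq, hn, ?_⟩
      intro x hx hE'
      by_cases hxk : x = k
      · simp only [St.asg_a, St.tick_a, hxk]
        omega
      · exact hdone x (by omega) hE'
    · refine ⟨fun x h1 h2 h3 => by simp [h3, fr x h1 h2 h3], ha, by simp; omega, by simpa using hSτ,
        by simp; omega, hq, hn, ?_⟩
      intro x hx hE'
      by_cases hxk : x = k
      · rw [hxk] at hE'
        exact absurd (Nat.pos_iff_ne_zero.2 hE') hE
      · exact hdone x (by omega) hE'
  · intro τ hτ
    obtain ⟨fr, ha, ht, hSτ, hmono, hq, hn, hdone⟩ := (hI _ _).1 hτ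
    exact hQ _ fr ha (by simp; omega) hSτ hmono hq hn hdone

/-- Searches backwards from the free right nodes. -/
def search : Cmd :=
  asg 14 0 ;; asg 15 0 ;;
  loop (var 14) (var 13) (asg 16 (get 7 (var 14)) ;; asg 14 (var 14 + 1) ;; searchNode)

/-- A right node enters the queue at most once, which limits the search to `N` scans of linear
length. The search runs to the end even after a free left node has been found. -/
theorem wp_search {N W K : ℕ} (hF : Fits N W K) {σ : St} {Q : St → Prop} {mr : ℕ → ℕ}
    (h3 : σ.v 3 = N) (hM : IsMateTable N mr (σ.a 5))
    (hS : SearchInv N (tableEdge N (σ.a 2)) mr (σ.a 6) (σ.a 7) (σ.v 13) 0)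
    (hQ : ∀ τ : St, (∀ x, x < 13 ∨ 17 < x → τ.v x = σ.v x) →
      (∀ j, j ≠ 6 → j ≠ 7 → τ.a j = σ.a j) → τ.time ≤ σ.time + 70 * (N * N) + 30 * N + 10 →
      SearchInv N (tableEdge N (σ.a 2)) mr (τ.a 6) (τ.a 7) (τ.v 13) (τ.v 15) →
      (∀ i < τ.v 13, ∀ x < N, tableEdge N (σ.a 2) x (τ.a 7 i) → τ.a 6 x ≠ 0) → Q τ) :
    search.wp W K Q σ := by
  have hN2 := hF.two_le
  have hsq := hF.sq
  have hword := hF.word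
  refine ⟨trivial, trivial, fun τ => (∀ x, x < 13 ∨ 17 < x → τ.v x = σ.v x) ∧
      (∀ j, j ≠ 6 → j ≠ 7 → τ.a j = σ.a j) ∧
      τ.time ≤ σ.time + τ.v 14 * (70 * N + 30) + 4 ∧ τ.v 14 ≤ τ.v 13 ∧
      SearchInv N (tableEdge N (σ.a 2)) mr (τ.a 6) (τ.a 7) (τ.v 13) (τ.v 15) ∧
      (∀ i < τ.v 14, ∀ x < N, tableEdge N (σ.a 2) x (τ.a 7 i) → τ.a 6 x ≠ 0),
      fun τ => N - τ.v 14, ?_, ?_⟩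
  · refine ⟨fun x hx => ?_, fun _ _ _ => rfl, by simp, by simp, by simpa using hS, by simp⟩
    have h1 : x ≠ 14 := by omega
    have h2 : x ≠ 15 := by omega
    simp [h1, h2]
  · rintro τ ⟨fr, ha, ht, hle, hSτ, hdone⟩
    have htail := hSτ.tail_le
    have ha2 := ha 2 (by decide) (by decide)
    have ha5 := ha 5 (by decide) (by decide)
    refine ⟨trivial, trivial, fun hlt => ?_, fun hge => ?_⟩
    · simp only [eval_var] at hlt
      have h3' := (fr 3 (by decide)).trans h3
      have hmul : (τ.v 14 + 1) * (70 * N + 30) = τ.v 14 * (70 * N + 30) + (70 * N + 30) :=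
        Nat.succ_mul _ _
      simp only [wp, eval_var, eval_ofNat, eval_get, eval_add, cost_var,
        cost_ofNat, cost_get, cost_add, ok_var, ok_ofNat, ok_get, ok_add,
        St.tick_v, St.tick_a, true_and, St.asg_v, ne_eq, Nat.reduceEqDiff, not_false_eq_true,
        Function.update_of_ne]
      refine ⟨by omega, by omega, ?_⟩
      refine wp_searchNode (i := τ.v 14) (mr := mr) hF (by simp [h3']) (by simpa [ha5] using hM)
        (by simpa using hlt) (by simp) (by simpa [ha2] using hSτ) ?_
      intro υ fr' ha' ht' hS' hmono hq hn hnew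
      simp [ha2] at fr' ha' ht' hS' hmono hq hn hnew
      have h14 : υ.v 14 = τ.v 14 + 1 := by simp [fr' 14]
      refine ⟨⟨fun x hx => ?_, fun j h1 h2 => (ha' j h1 h2).trans (ha j h1 h2), ?_, ?_,
        hS', ?_⟩, ?_⟩
      · rw [fr' x (by omega) (by omega) (by omega), Function.update_of_ne (by omega),
          Function.update_of_ne (by omega), fr x hx]
      · rw [h14, hmul]
        omega
      · omega
      · rw [h14]
        intro i hi x hx hE
        rw [hq i (by omega)] at hE
        rcases Nat.lt_succ_iff_lt_or_eq.1 hi with hi | hi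
        · exact hn x hx (hdone i hi x hx hE)
        · rw [hi] at hE
          exact hnew x hx hE
      · simp only [h14]
        omega
    · simp only [eval_var] at hge
      have h14 : τ.v 14 = τ.v 13 := by omega
      rw [h14] at hdone
      refine hQ _ fr ha ?_ hSτ hdone
      have h1 := Nat.mul_le_mul_right (70 * N + 30) (h14.le.trans htail)
      have h2 : N * (70 * N + 30) = 70 * (N * N) + 30 * N := by ring
      simp only [St.tick_time, cost_var]
      omega

/-- Augments the matching along the search tree, starting with the left node `v 15 - 1`. -/
def augment : Cmd :=
  asg 18 (var 15) ;;
  loop 0 (var 18) (asg 16 (get 6 (var 18 - 1) - 1) ;; asg 19 (get 3 (var 16)) ;;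
    put 3 (var 16) (var 18) ;; asg 18 (var 19))

theorem wp_augment {N W K : ℕ} (hF : Fits N W K) {σ : St} {Q : St → Prop} {E : ℕ → ℕ → Prop}
    (hM : IsMatch N E (σ.a 3))
    (hS : SearchInv N E (σ.a 3) (σ.a 6) (σ.a 7) (σ.v 13) (σ.v 15)) (h15 : σ.v 15 ≠ 0)
    (hQ : ∀ τ : St, (∀ x, x < 13 ∨ 19 < x → τ.v x = σ.v x) →
      (∀ j, j ≠ 3 → τ.a j = σ.a j) → τ.time ≤ σ.time + 40 * N + 10 →
      IsMatch N E (τ.a 3) → matchSize N (τ.a 3) = matchSize N (σ.a 3) + 1 → Q τ) :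
    augment.wp W K Q σ := by
  have hN2 := hF.two_le
  have hsq := hF.sq
  have htail := hS.tail_le
  refine ⟨trivial, fun τ => (∀ x, x < 13 ∨ 19 < x → τ.v x = σ.v x) ∧
      (∀ j, j ≠ 3 → τ.a j = σ.a j) ∧ ∃ b, τ.time + 40 * b ≤ σ.time + 40 * N + 4 ∧
      AugmentInv N E (σ.a 3) (σ.a 6) (σ.a 7) (σ.v 13) b (τ.v 18) (τ.a 3),
      -- The remaining time budget serves as the measure: the invariant bounds the elapsed time, and
      -- each pass increases it.
      fun τ => σ.time + 40 * N + 10 - τ.time, ?_, ?_⟩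
  · refine ⟨fun x hx => ?_, fun _ _ => rfl, σ.v 13, by simp; omega, by
      simpa using hS.augment hM h15⟩
    have h1 : x ≠ 18 := by omega
    simp [h1]
  · rintro τ ⟨fr, ha, b, ht, hA⟩
    have ha6 := ha 6 (by decide)
    have hle := hA.le
    refine ⟨trivial, trivial, fun hlt => ?_, fun hge => ?_⟩
    · simp only [eval_var, eval_ofNat] at hlt
      obtain ⟨hrN, b', hb', hA'⟩ := hA.step hS (by omega)
      simp only [wp, eval_var, eval_ofNat, eval_get, eval_sub, cost_var,
        cost_ofNat, cost_get, cost_sub, ok_var, ok_ofNat, ok_get, ok_sub,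
        St.tick_v, St.tick_a, true_and, and_true, St.asg_v, St.asg_a, ne_eq, Nat.reduceEqDiff,
        not_false_eq_true, Function.update_of_ne, Function.update_self, ha6, St.put_v]
      refine ⟨by omega, by omega, by omega, ⟨fun x hx => ?_, fun j h1 => by simp [h1, ha j h1],
        b', by simp; omega, by simpa using hA'⟩, by simp; omega⟩
      have h1 : x ≠ 18 := by omega
      have h2 : x ≠ 16 := by omega
      have h3 : x ≠ 19 := by omega
      simp [h1, h2, h3, fr x hx]
    · simp only [eval_var, eval_ofNat] at hge
      have h18 : τ.v 18 = 0 := by omega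
      have hsz := hA.size
      rw [if_pos h18] at hsz
      exact hQ _ fr ha (by simp; omega) hA.isMatch hsz

/-- Augments the matching until it is maximum. -/
def maximize : Cmd :=
  asg 20 1 ;;
  loop 0 (var 20) (prepareSearch ;; search ;; ite 0 (var 15) augment (asg 20 0))

/-- Each successful search adds an edge, so at most `D` of them succeed. The failed one leaves the
unreached left nodes, marked by `0` in array `6`, as the closed set that the price argument needs.
-/
theorem wp_maximize {N W K D : ℕ} (hF : Fits N W K) {σ : St} {Q : St → Prop} (h3 : σ.v 3 = N)
    (hM : IsMatch N (tableEdge N (σ.a 2)) (σ.a 3))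
    (hD : ∀ mr, IsMatch N (tableEdge N (σ.a 2)) mr → matchSize N mr ≤ matchSize N (σ.a 3) + D)
    (hQ : ∀ τ : St, (∀ x, x < 12 ∨ 20 < x → τ.v x = σ.v x) →
      (∀ j, j < 3 → τ.a j = σ.a j) → τ.time ≤ σ.time + (D + 1) * (200 * (N * N)) + 5 →
      IsMatch N (tableEdge N (σ.a 2)) (τ.a 3) → IsMateTable N (τ.a 3) (τ.a 5) →
      (∀ x < N, τ.a 6 x = 0 → ∀ r < N, tableEdge N (σ.a 2) x r →
        τ.a 3 r ≠ 0 ∧ τ.a 6 (τ.a 3 r - 1) = 0) →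
      (∀ x < N, (∀ r < N, τ.a 3 r ≠ x + 1) → τ.a 6 x = 0) → Q τ) :
    maximize.wp W K Q σ := by
  have hN2 := hF.two_le
  have hsq := hF.sq
  have hword := hF.word
  have hNN : 2 * N ≤ N * N := Nat.mul_le_mul_right N hN2
  refine ⟨trivial, fun τ => (∀ x, x < 12 ∨ 20 < x → τ.v x = σ.v x) ∧
      (∀ j, j < 3 → τ.a j = σ.a j) ∧ IsMatch N (tableEdge N (σ.a 2)) (τ.a 3) ∧
      ∃ d, matchSize N (τ.a 3) = matchSize N (σ.a 3) + d ∧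
      τ.time ≤ σ.time + (d + if τ.v 20 = 0 then 1 else 0) * (200 * (N * N)) + 2 ∧
      (τ.v 20 = 0 → IsMateTable N (τ.a 3) (τ.a 5) ∧
        (∀ x < N, τ.a 6 x = 0 → ∀ r < N, tableEdge N (σ.a 2) x r →
          τ.a 3 r ≠ 0 ∧ τ.a 6 (τ.a 3 r - 1) = 0) ∧
        (∀ x < N, (∀ r < N, τ.a 3 r ≠ x + 1) → τ.a 6 x = 0)),
      fun τ => 2 * (matchSize N (σ.a 3) + D - matchSize N (τ.a 3)) + if τ.v 20 = 0 then 0 else 1,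
      ?_, ?_⟩
  · refine ⟨fun x hx => ?_, fun _ _ => rfl, hM, 0, rfl, by simp, by simp⟩
    have h1 : x ≠ 20 := by omega
    simp [h1]
  · rintro τ ⟨fr, ha, hMτ, d, hd, ht, hfin⟩
    refine ⟨trivial, trivial, fun hlt => ?_, fun hge => ?_⟩
    · simp only [eval_var, eval_ofNat] at hlt
      have h20 : τ.v 20 ≠ 0 := by omega
      rw [if_neg h20] at ht
      have ha2 := ha 2 (by decide)
      refine wp_prepareSearch hF (by simp [fr 3, h3]) (E := tableEdge N (σ.a 2)) hMτ ?_
      intro υ₁ fr₁ ha₁ ht₁ hT₁ hz₁ hS₁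
      have hE₁ : υ₁.a 2 = σ.a 2 := (ha₁ 2 (by decide) (by decide) (by decide)).trans ha2
      refine wp_search hF (by simp [fr₁ 3, fr 3, h3]) hT₁ (by rw [hE₁]; exact hS₁) ?_
      intro υ₂ fr₂ ha₂ ht₂ hS₂ hdone₂
      rw [hE₁] at hS₂ hdone₂
      have h3₂ : υ₂.a 3 = τ.a 3 := (ha₂ 3 (by decide) (by decide)).trans
        (ha₁ 3 (by decide) (by decide) (by decide))
      simp only [St.tick_time, St.tick_a, St.tick_v, cost_var, cost_ofNat] at ht₁ fr₁ ha₁ hS₂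
      have hfr₂ : ∀ x, x < 12 ∨ 17 < x → υ₂.v x = τ.v x := fun x hx =>
        (fr₂ x (by omega)).trans (fr₁ x (by omega) (by omega))
      refine ⟨trivial, trivial, fun hf => ?_, fun hf => ?_⟩
      · simp only [eval_var, eval_ofNat] at hf
        refine wp_augment hF (E := tableEdge N (σ.a 2)) (by simpa [h3₂] using hMτ)
          (by simpa [h3₂] using hS₂) (by simp; omega) ?_
        intro υ₃ fr₃ ha₃ ht₃ hM₃ hsz₃
        simp only [St.tick_time, St.tick_a, St.tick_v, cost_var, cost_ofNat, h3₂]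
          at ht₃ fr₃ ha₃ hsz₃
        have h20' : υ₃.v 20 = τ.v 20 := (fr₃ 20 (by decide)).trans (hfr₂ 20 (by decide))
        have hbound := hD _ hM₃
        have hmul : (d + 1) * (200 * (N * N)) = d * (200 * (N * N)) + 200 * (N * N) :=
          Nat.succ_mul _ _
        refine ⟨⟨fun x hx => ?_, fun j hj => ?_, hM₃, d + 1, by omega, ?_, fun h => ?_⟩, ?_⟩
        · exact (fr₃ x (by omega)).trans ((hfr₂ x (by omega)).trans (fr x hx))
        · exact (ha₃ j (by omega)).trans ((ha₂ j (by omega) (by omega)).trans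
            ((ha₁ j (by omega) (by omega) (by omega)).trans (ha j hj)))
        · rw [h20', if_neg h20, Nat.add_zero, hmul]
          simp only [add_zero] at ht
          omega
        · exact absurd (h20'.symm.trans h) h20
        · simp only [h20', if_neg h20]
          omega
      · simp only [eval_var, eval_ofNat] at hf
        have h15 : υ₂.v 15 = 0 := by omega
        rw [h15] at hS₂
        obtain ⟨hc1, hc2⟩ := hS₂.closed hdone₂
        have hmul : (d + 1) * (200 * (N * N)) = d * (200 * (N * N)) + 200 * (N * N) :=
          Nat.succ_mul _ _
        refine ⟨trivial, ⟨fun x hx => ?_, fun j hj => ?_, by simpa [h3₂] using hMτ, d,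
          by simpa [h3₂] using hd, ?_, fun _ => ⟨?_, ?_, ?_⟩⟩, ?_⟩
        · have h1 : x ≠ 20 := by omega
          simp [h1, hfr₂ x (by omega), fr x hx]
        · exact (ha₂ j (by omega) (by omega)).trans
            ((ha₁ j (by omega) (by omega) (by omega)).trans (ha j hj))
        · simp [hmul]
          simp only [add_zero] at ht
          omega
        · have h5 := ha₂ 5 (by decide) (by decide)
          simpa [h3₂, h5] using hT₁
        · intro x hx h0 r hr hE
          rcases hc1 x hx h0 r hr hE with h | h
          · simpa [h3₂] using h
          · exact absurd (hMτ.le r hr) (by simpa using h)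
        · intro x hx hfree
          exact hc2 x hx (by simpa [h3₂] using hfree)
        · simp [h20, h3₂]
    · simp only [eval_var, eval_ofNat] at hge
      have h20 : τ.v 20 = 0 := by omega
      obtain ⟨h1, h2, h4⟩ := hfin h20
      refine hQ _ fr ha ?_ hMτ h1 h2 h4
      rw [if_pos h20] at ht
      have hdD : d ≤ D := by
        have := hD _ hMτ
        omega
      have := Nat.mul_le_mul_right (200 * (N * N)) (Nat.succ_le_succ hdD)
      simp only [Nat.succ_eq_add_one] at this
      simp
      omega

end WordRAM

/-! ### The table of allowed edges. -/

namespace WordRAM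

open Ex Cmd PopInstance

variable {p q : ℕ}

/-- The variables `0`, …, `3` and the array `0` hold the input. -/
structure HasInput (G : PopInstance p q) (κ : ℕ) (σ : St) : Prop where
  agents : σ.v 0 = p
  objects : σ.v 1 = q
  penalty : σ.v 2 = κ
  size : σ.v 3 = p + q
  adj : ∀ a < p, ∀ b < q, σ.a 0 (a * q + b) = G.adjVal a b
  pref : ∀ a < p, ∀ b < q, ∀ b' < q, σ.a 0 (p * q + ((a * q + b) * q + b')) = G.prefVal a b b'

theorem HasInput.congr {G : PopInstance p q} {κ : ℕ} {σ τ : St} (h : HasInput G κ σ)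
    (hv : ∀ x < 4, τ.v x = σ.v x) (ha : τ.a 0 = σ.a 0) : HasInput G κ τ :=
  ⟨(hv 0 (by decide)).trans h.agents, (hv 1 (by decide)).trans h.objects,
    (hv 2 (by decide)).trans h.penalty, (hv 3 (by decide)).trans h.size,
    by rw [ha]; exact h.adj, by rw [ha]; exact h.pref⟩

/-- The input and all tables fit into words and arrays. -/
structure FitsInput (p q κ W K : ℕ) : Prop where
  fits : Fits (p + q) W K
  input : p * q + p * q * q ≤ K
  one_le : 1 ≤ κ
  lt : κ < p + q

theorem prod_idx_lt {m n a b : ℕ} (ha : a < m) (hb : b < n) : a * n + b < m * n := by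
  have := Nat.mul_le_mul_right n (Nat.succ_le_of_lt ha)
  rw [Nat.succ_mul] at this
  omega

theorem adjVal_pos {G : PopInstance p q} {a b : ℕ} : 0 < G.adjVal a b ↔ G.AdjN a b := by
  unfold adjVal
  split <;> simp [*]

/-- The ranges of `x` and `r` determine which of the three kinds of edges is possible, so each block
of the table has its own simple criterion. -/
theorem allowed_object_iff {G : PopInstance p q} {κ : ℕ} {y : ℕ → ℕ} {x r : ℕ} (hx : x < q)
    (hr : r < p) : G.Allowed κ y x r ↔
      G.AdjN r x ∧ ∀ b, G.AdjN r b → y x + G.prefVal r b x ≤ y b + G.prefVal r x b := by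
  refine ⟨fun h => ?_, Or.inl⟩
  rcases h with h | h | h
  · exact h
  · omega
  · omega

theorem allowed_dummy_iff {G : PopInstance p q} {κ : ℕ} {y : ℕ → ℕ} {x r : ℕ} (hx : q ≤ x)
    (hr : r < p) : G.Allowed κ y x r ↔ x = q + r ∧ ∀ b, G.AdjN r b → κ ≤ y b := by
  refine ⟨fun h => ?_, fun h => Or.inr (Or.inl ⟨hr, h⟩)⟩
  rcases h with h | h | h
  · have := h.1.2.1
    omega
  · exact h.2
  · omega

theorem allowed_absorb_iff {G : PopInstance p q} {κ : ℕ} {y : ℕ → ℕ} {x r : ℕ} (hr : p ≤ r) :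
    G.Allowed κ y x r ↔ y x = 0 := by
  refine ⟨fun h => ?_, fun h => Or.inr (Or.inr ⟨hr, h⟩)⟩
  rcases h with h | h | h
  · have := h.1.1
    omega
  · omega
  · exact h.2

/-- Adjacency of the agent `v 21` and the object `v b`. -/
def adjEx (b : ℕ) : Ex := get 0 (var 21 * var 1 + var b)

/-- Preference of the agent `v 21` for the object `v b` over the object `v b'`. -/
def prefEx (b b' : ℕ) : Ex := get 0 (var 0 * var 1 + ((var 21 * var 1 + var b) * var 1 + var b'))

theorem adjEx_spec {G : PopInstance p q} {κ W K : ℕ} (hF : FitsInput p q κ W K) {σ : St}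
    (h : HasInput G κ σ) {x a b : ℕ} (h21 : σ.v 21 = a) (ha : a < p) (hx : σ.v x = b) (hb : b < q) :
    (adjEx x).ok W K σ ∧ (adjEx x).eval σ = G.adjVal a b := by
  have h1 := prod_idx_lt ha hb
  have h2 := hF.input
  have h3 := hF.fits.word
  simp only [adjEx, ok_get, ok_add, ok_mul, ok_var, eval_add, eval_mul, eval_var, eval_get, h21, hx,
    h.objects, h.adj a ha b hb, true_and, and_true]
  omega

theorem prefEx_spec {G : PopInstance p q} {κ W K : ℕ} (hF : FitsInput p q κ W K) {σ : St}
    (h : HasInput G κ σ) {x x' a b b' : ℕ} (h21 : σ.v 21 = a) (ha : a < p) (hx : σ.v x = b)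
    (hb : b < q) (hx' : σ.v x' = b') (hb' : b' < q) :
    (prefEx x x').ok W K σ ∧ (prefEx x x').eval σ = G.prefVal a b b' := by
  have h1 := prod_idx_lt ha hb
  have h1' := prod_idx_lt h1 hb'
  have h2 := hF.input
  have h3 := hF.fits.word
  -- Intermediate values have to fit into a word too; `0 < q` bounds this one by the product that
  -- follows.
  have h4 : a * q + b ≤ (a * q + b) * q := Nat.le_mul_of_pos_right _ (by omega)
  simp only [prefEx, ok_get, ok_add, ok_mul, ok_var, eval_add, eval_mul, eval_var, eval_get, h21,
    hx, hx', h.agents, h.objects, h.pref a ha b hb b' hb', true_and, and_true]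
  omega

@[simp] theorem cost_adjEx (b : ℕ) : (adjEx b).cost = 9 := rfl

@[simp] theorem cost_prefEx (b b' : ℕ) : (prefEx b b').cost = 17 := rfl

/-- Computes the table entry for the object `v 22` and the agent `v 21`. -/
def computeEdge : Cmd :=
  asg 24 (adjEx 22) ;;
  forLoop 23 1 (ite 0 (adjEx 23)
    (ite (get 1 (var 23) + prefEx 22 23) (get 1 (var 22) + prefEx 23 22) (asg 24 0) skip) skip) ;;
  put 2 (var 22 * var 3 + var 21) (var 24)

/-- The flag `v 24` starts as the adjacency of `a` and `b` and is cleared by any neighbour of `a`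
that violates the price inequality. -/
theorem wp_computeEdge {G : PopInstance p q} {κ W K a b : ℕ} (hF : FitsInput p q κ W K) {σ : St}
    {Q : St → Prop} (hin : HasInput G κ σ) (hy : IsPrice q κ (σ.a 1)) (h21 : σ.v 21 = a)
    (ha : a < p) (h22 : σ.v 22 = b) (hb : b < q)
    (hQ : ∀ (τ : St) (e : ℕ), (∀ x, x ≠ 23 → x ≠ 24 → τ.v x = σ.v x) →
      τ.a = Function.update σ.a 2 (Function.update (σ.a 2) (b * (p + q) + a) e) →
      (e ≠ 0 ↔ G.Allowed κ (σ.a 1) b a) → τ.time ≤ σ.time + 80 * q + 40 → Q τ) :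
    computeEdge.wp W K Q σ := by
  have hK := hF.lt
  have hsq := hF.fits.sq
  have hword := hF.fits.word
  obtain ⟨o1, e1⟩ := adjEx_spec hF hin h21 ha h22 hb
  refine ⟨o1, ?_⟩
  rw [e1]
  obtain ⟨I, hI⟩ : ∃ I : ℕ → St → Prop, ∀ k τ, I k τ ↔
      (∀ x, x ≠ 23 → x ≠ 24 → τ.v x = σ.v x) ∧ τ.a = σ.a ∧
      τ.time ≤ σ.time + 80 * k + 12 ∧ (τ.v 24 ≠ 0 ↔ G.AdjN a b ∧ ∀ b' < k, G.AdjN a b' →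
        σ.a 1 b + G.prefVal a b' b ≤ σ.a 1 b' + G.prefVal a b b') := ⟨_, fun _ _ => Iff.rfl⟩
  refine wp_forLoop (n := q) I (by decide) (by simp [hin.objects]) (by omega) ?_ ?_ ?_
  · refine (hI _ _).2 ⟨fun x h1 h2 => by simp [h1, h2], rfl, by simp, ?_⟩
    simp [← adjVal_pos, Nat.pos_iff_ne_zero]
  · intro k τ hk hk' h23 h1'
    obtain ⟨fr, hτa, ht, hok⟩ := (hI _ _).1 hk'
    have hinτ : HasInput G κ (τ.tick 3) := hin.congr (fun x hx => fr x (by omega) (by omega))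
      (by simp [hτa])
    have g21 : (τ.tick 3).v 21 = a := (fr 21 (by decide) (by decide)).trans h21
    have g22 : (τ.tick 3).v 22 = b := (fr 22 (by decide) (by decide)).trans h22
    obtain ⟨o1, e1⟩ := adjEx_spec hF hinτ g21 ha (x := 23) h23 hk
    have hinτ' : HasInput G κ ((τ.tick 3).tick (1 + 9 + 1)) :=
      hinτ.congr (fun x hx => rfl) rfl
    obtain ⟨o2, e2⟩ := prefEx_spec hF hinτ' (x := 22) (x' := 23) g21 ha g22 hb h23 hk
    obtain ⟨o3, e3⟩ := prefEx_spec hF hinτ' (x := 23) (x' := 22) g21 ha h23 hk g22 hb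
    have b1 := hy.le b
    have b2 := hy.le k
    have b3 := G.prefVal_le_one a b k
    have b4 := G.prefVal_le_one a k b
    have g22' : τ.v 22 = b := g22
    have hstep : ∀ υ : St, (∀ x, x ≠ 23 → x ≠ 24 → υ.v x = τ.v x) → υ.v 23 = k → υ.a = τ.a →
        υ.time ≤ τ.time + 70 → ((υ.v 24 ≠ 0) ↔ (τ.v 24 ≠ 0) ∧ (G.AdjN a k →
          σ.a 1 b + G.prefVal a k b ≤ σ.a 1 k + G.prefVal a b k)) →
        υ.v 23 = k ∧ υ.v 1 = q ∧ I (k + 1) (υ.asg 23 (k + 1) 4) := by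
      intro υ hfr hv23 hua hut hiff
      refine ⟨hv23, (hfr 1 (by decide) (by decide)).trans h1', (hI _ _).2 ⟨fun x h1 h2 => ?_,
        hua.trans hτa, by simp; omega, ?_⟩⟩
      · simp [h1, hfr x h1 h2, fr x h1 h2]
      · simp only [St.asg_v, ne_eq, Nat.reduceEqDiff, not_false_eq_true, Function.update_of_ne]
        rw [← ne_eq, hiff, hok]
        refine ⟨fun ⟨⟨h1, h2⟩, h3⟩ => ⟨h1, fun b' hb' => ?_⟩, fun ⟨h1, h2⟩ =>
          ⟨⟨h1, fun b' hb' => h2 b' (by omega)⟩, h2 k (by omega)⟩⟩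
        rcases Nat.lt_succ_iff_lt_or_eq.1 hb' with hb' | rfl
        · exact h2 b' hb'
        · exact h3
    refine ⟨trivial, o1, fun hlt => ?_, fun hge => ?_⟩
    · rw [e1, eval_ofNat] at hlt
      have hadj := adjVal_pos.1 hlt
      simp only [wp, ok_add, ok_get, ok_var, eval_add, eval_get, eval_var, true_and, cost_add,
        cost_get, cost_var, cost_prefEx, cost_ofNat, cost_adjEx, eval_ofNat, o2, o3, e2, e3,
        St.tick_v, St.tick_a, h23, g22', hτa, ok_ofNat]
      refine ⟨⟨by omega, by omega⟩, ⟨by omega, by omega⟩, fun hv => ?_, fun hv => ?_⟩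
      · refine hstep _ (fun x h1 h2 => by simp [h2]) (by simp [h23]) rfl (by simp) ?_
        simp only [St.asg_v, Function.update_self]
        refine iff_of_false (by simp) fun h => ?_
        have := h.2 hadj
        omega
      · refine And.right (hstep (St.tick (St.tick (St.tick (St.tick τ _) _) _) _)
          (fun x h1 h2 => rfl) (by simp [h23]) rfl (by simp) ?_)
        simp only [St.tick_v]
        exact ⟨fun h => ⟨h, fun _ => by omega⟩, fun h => h.1⟩
    · rw [e1, eval_ofNat] at hge
      have hadj : ¬ G.AdjN a k := fun h => hge (adjVal_pos.2 h)
      refine hstep _ (fun x h1 h2 => rfl) (by simp [h23]) rfl (by simp) ?_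
      simp only [St.tick_v]
      exact ⟨fun h => ⟨h, fun h => absurd h hadj⟩, fun h => h.1⟩
  · intro τ hτ
    obtain ⟨fr, hτa, ht, hok⟩ := (hI _ _).1 hτ
    have g21 : τ.v 21 = a := (fr 21 (by decide) (by decide)).trans h21
    have g22 : τ.v 22 = b := (fr 22 (by decide) (by decide)).trans h22
    have g3 : τ.v 3 = p + q := (fr 3 (by decide) (by decide)).trans hin.size
    have hidx := idx_lt (N := p + q) (a := b) (b := a) (by omega) (by omega)
    simp only [wp, ok_add, ok_mul, ok_var, eval_add, eval_mul, eval_var, true_and, cost_add,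
      cost_mul, cost_var, St.tick_v, g21, g22, g3]
    refine ⟨⟨by omega, by omega⟩, by omega, hQ _ (τ.v 24) (fun x h1 h2 => fr x h1 h2)
      (by simp [hτa]) ?_ (by simp; omega)⟩
    rw [hok, allowed_object_iff hb ha]
    exact ⟨fun h => ⟨h.1, fun b' hb' => h.2 b' hb'.2.1 hb'⟩, fun h => ⟨h.1, fun b' _ => h.2 b'⟩⟩

/-- The entries of the table `tab` that satisfy `S` are the edges allowed at `y`, and all other
entries vanish. -/
def TableOn (G : PopInstance p q) (κ : ℕ) (y tab : ℕ → ℕ) (S : ℕ → ℕ → Prop) : Prop :=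
  ∀ x < p + q, ∀ r < p + q, tableEdge (p + q) tab x r ↔ G.Allowed κ y x r ∧ S x r

/-- Entries outside the region vanish, so forbidden edges are recorded correctly even before they
are visited. The two regions therefore have to be compared on allowed edges only. -/
theorem TableOn.update {G : PopInstance p q} {κ : ℕ} {y tab : ℕ → ℕ} {S S' : ℕ → ℕ → Prop}
    (h : TableOn G κ y tab S) {x₀ r₀ e : ℕ} (hr₀ : r₀ < p + q)
    (he : e ≠ 0 ↔ G.Allowed κ y x₀ r₀)
    (hS : ∀ x < p + q, ∀ r < p + q, G.Allowed κ y x r → (S' x r ↔ S x r ∨ x = x₀ ∧ r = r₀)) :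
    TableOn G κ y (Function.update tab (x₀ * (p + q) + r₀) e) S' := by
  intro x hx r hr
  unfold tableEdge
  by_cases hc : x = x₀ ∧ r = r₀
  · obtain ⟨rfl, rfl⟩ := hc
    rw [Function.update_self, he]
    exact ⟨fun hA => ⟨hA, (hS x hx r hr hA).2 (Or.inr ⟨rfl, rfl⟩)⟩, fun hA => hA.1⟩
  · rw [Function.update_of_ne fun heq => hc (idx_inj hr hr₀ heq)]
    refine (h x hx r hr).trans ⟨fun hA => ⟨hA.1, (hS x hx r hr hA.1).2 (Or.inl hA.2)⟩,
      fun hA => ⟨hA.1, ((hS x hx r hr hA.1).1 hA.2).resolve_right hc⟩⟩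

/-- Initializes the prices and the table. -/
def initTable : Cmd :=
  forLoop 22 1 (put 1 (var 22) (var 2)) ;;
  forLoop 21 0
    (put 2 ((var 1 + var 21) * var 3 + var 21) 1 ;;
      forLoop 22 1 computeEdge ;;
      forLoop 22 1 (put 2 ((var 1 + var 21) * var 3 + (var 0 + var 22)) 1))

/-- When all objects cost `κ`, every agent may take its dummy, and since `1 ≤ κ` only the dummies
have price zero. So only the entries between objects and agents require a computation. -/
theorem wp_initTable {G : PopInstance p q} {κ W K : ℕ} (hF : FitsInput p q κ W K) {σ : St}
    {Q : St → Prop} (hin : HasInput G κ σ) (h1z : ∀ i, σ.a 1 i = 0) (h2z : ∀ i, σ.a 2 i = 0)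
    (hQ : ∀ τ : St, (∀ x < 21, τ.v x = σ.v x) → τ.a 0 = σ.a 0 → (∀ x < q, τ.a 1 x = κ) →
      IsPrice q κ (τ.a 1) → TableOn G κ (τ.a 1) (τ.a 2) (fun _ _ => True) →
      τ.time ≤ σ.time + 200 * (p * (q * q)) + 200 * (p * q) + 200 * (p + q) + 20 → Q τ) :
    initTable.wp W K Q σ := by
  have hK := hF.lt
  have hsq := hF.fits.sq
  have hword := hF.fits.word
  obtain ⟨I, hI⟩ : ∃ I : ℕ → St → Prop, ∀ k τ, I k τ ↔ (∀ x < 21, τ.v x = σ.v x) ∧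
      (∀ j, j ≠ 1 → τ.a j = σ.a j) ∧ τ.time ≤ σ.time + 20 * k + 2 ∧
      (∀ x, τ.a 1 x = if x < k then κ else 0) := ⟨_, fun _ _ => Iff.rfl⟩
  refine wp_forLoop (n := q) I (by decide) hin.objects (by omega) ?_ ?_ ?_
  · exact (hI _ _).2 ⟨fun x hx => by
      have h1 : x ≠ 22 := by omega
      simp [h1], fun _ _ => rfl, by simp, by simp [h1z]⟩
  · intro k τ hk hk' h22 h1
    obtain ⟨fr, ha, ht, hy⟩ := (hI _ _).1 hk'
    have g2 : τ.v 2 = κ := (fr 2 (by decide)).trans hin.penalty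
    simp only [wp, ok_var, eval_var, true_and, cost_var, St.tick_v, h22, g2, St.put_v, h1]
    refine ⟨by omega, (hI _ _).2 ⟨fun x hx => ?_, fun j hj => by simp [hj, ha j hj], by simp; omega,
      fun x => ?_⟩⟩
    · have h1 : x ≠ 22 := by omega
      simp [h1, fr x hx]
    · simp only [St.asg_a, St.put_a, St.tick_a, Function.update_self, Function.update_apply, hy]
      split_ifs <;> first | rfl | omega
  intro σ₁ hσ₁
  obtain ⟨fr₁, ha₁, ht₁, hy₁⟩ := (hI _ _).1 hσ₁
  obtain ⟨y, hy⟩ : ∃ y, y = σ₁.a 1 := ⟨_, rfl⟩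
  have hyP : IsPrice q κ y := by
    rw [hy]
    refine ⟨fun x => ?_, fun x hx => ?_⟩
    · rw [hy₁]; split <;> omega
    · rw [hy₁, if_neg (by omega)]
  have hyq : ∀ x < q, y x = κ := fun x hx => by rw [hy, hy₁, if_pos hx]
  obtain ⟨J, hJ⟩ : ∃ J : ℕ → St → Prop, ∀ k τ, J k τ ↔ (∀ x < 21, τ.v x = σ.v x) ∧
      τ.a 0 = σ.a 0 ∧ τ.a 1 = y ∧
      TableOn G κ y (τ.a 2) (fun x r => r < k ∨ (q ≤ x ∧ x < q + k)) ∧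
      τ.time ≤ σ.time + k * (80 * (q * q) + 80 * q + 60) + 20 * q + 7 := ⟨_, fun _ _ => Iff.rfl⟩
  refine wp_forLoop (n := p) J (by decide) (by simp [fr₁ 0, hin.agents]) (by omega) ?_ ?_ ?_
  · refine (hJ _ _).2 ⟨fun x hx => ?_, ?_, ?_, ?_, ?_⟩
    · have h1 : x ≠ 21 := by omega
      simp [h1, fr₁ x hx]
    · simp [ha₁ 0]
    · simp [hy]
    · intro x hx r hr
      simp only [St.asg_a, St.tick_a, ha₁ 2 (by decide), tableEdge, h2z]
      simp
    · simp; omega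
  · intro a τ hap hk' h21 h0
    obtain ⟨fr, ha0, ha1, hT, ht⟩ := (hJ _ _).1 hk'
    have g1 : τ.v 1 = q := (fr 1 (by decide)).trans hin.objects
    have g3 : τ.v 3 = p + q := (fr 3 (by decide)).trans hin.size
    have hidx := idx_lt (N := p + q) (a := q + a) (b := a) (by omega) (by omega)
    refine ⟨?_, trivial, ?_, ?_⟩
    · simp only [ok_add, ok_mul, ok_var, eval_add, eval_mul, eval_var, true_and, St.tick_v, h21, g1,
        g3]
      omega
    · simp only [eval_add, eval_mul, eval_var, St.tick_v, h21, g1, g3]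
      omega
    simp only [eval_add, eval_mul, eval_var, St.tick_v, h21, g1, g3, cost_add, cost_mul, cost_var,
      eval_ofNat, cost_ofNat]
    obtain ⟨I₂, hI₂⟩ : ∃ I : ℕ → St → Prop, ∀ k υ, I k υ ↔ (∀ x < 22, υ.v x = τ.v x) ∧
        υ.a 0 = σ.a 0 ∧ υ.a 1 = y ∧
        TableOn G κ y (υ.a 2) (fun x r => r < a ∨ (q ≤ x ∧ x < q + a) ∨
          (r = a ∧ (x < k ∨ x = q + a))) ∧
        υ.time ≤ τ.time + k * (80 * q + 50) + 20 := ⟨_, fun _ _ => Iff.rfl⟩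
    refine wp_forLoop (n := q) I₂ (by decide) (by simp [g1]) (by omega) ?_ ?_ ?_
    · refine (hI₂ _ _).2 ⟨fun x hx => ?_, by simp [ha0], by simp [ha1], ?_, by simp⟩
      · have h1 : x ≠ 22 := by omega
        simp [h1]
      · simp only [St.asg_a, St.put_a, St.tick_a, Function.update_self]
        refine hT.update (by omega) ⟨fun _ => ?_, fun _ => by simp⟩ fun x hx r hr hA => by omega
        refine (allowed_dummy_iff (by omega) hap).2 ⟨rfl, ?_⟩
        rintro b ⟨_, hb, _⟩
        exact (hyq b hb).ge
    · intro b υ hbq hυ h22 h1'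
      obtain ⟨fr', ha0', ha1', hT', ht'⟩ := (hI₂ _ _).1 hυ
      have hinυ : HasInput G κ (υ.tick 3) := hin.congr (fun x hx =>
        (fr' x (by omega)).trans (fr x (by omega))) ha0'
      refine wp_computeEdge (a := a) (b := b) hF hinυ (by simpa [ha1'] using hyP)
        ((fr' 21 (by decide)).trans h21) hap h22 hbq ?_
      intro ω e frω haω he htω
      simp only [St.tick_v, St.tick_a, St.tick_time] at frω haω he htω
      refine ⟨(frω 22 (by decide) (by decide)).trans h22, (frω 1 (by decide) (by decide)).trans h1',
        (hI₂ _ _).2 ⟨fun x hx => ?_, by simp [haω, ha0'], by simp [haω, ha1'], ?_, ?_⟩⟩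
      · have h1 : x ≠ 22 := by omega
        simp [h1, frω x (by omega) (by omega), fr' x hx]
      · simp only [St.asg_a, haω, Function.update_self]
        rw [ha1'] at he
        exact hT'.update (by omega) he fun x hx r hr hA => by omega
      · have : (b + 1) * (80 * q + 50) = b * (80 * q + 50) + (80 * q + 50) := Nat.succ_mul _ _
        simp [this]
        omega
    intro υ₁ hυ₁
    obtain ⟨fr', ha0', ha1', hT', ht'⟩ := (hI₂ _ _).1 hυ₁
    obtain ⟨I₃, hI₃⟩ : ∃ I : ℕ → St → Prop, ∀ k υ, I k υ ↔ (∀ x < 22, υ.v x = τ.v x) ∧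
        υ.a 0 = σ.a 0 ∧ υ.a 1 = y ∧
        TableOn G κ y (υ.a 2) (fun x r => r ≤ a ∨ (q ≤ x ∧ x < q + a) ∨
          (x = q + a ∧ r < p + k)) ∧
        υ.time ≤ τ.time + q * (80 * q + 50) + 30 * k + 30 := ⟨_, fun _ _ => Iff.rfl⟩
    refine wp_forLoop (n := q) I₃ (by decide) (by simp [fr' 1, g1]) (by omega) ?_ ?_ ?_
    · refine (hI₃ _ _).2 ⟨fun x hx => ?_, by simp [ha0'], by simp [ha1'], ?_, by simp; omega⟩
      · have h1 : x ≠ 22 := by omega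
        simp [h1, fr' x hx]
      · intro x hx r hr
        refine (hT' x hx r hr).trans (and_congr_right fun hA => ?_)
        by_cases hrp : r < p
        · by_cases hxq : x < q
          · omega
          · have := ((allowed_dummy_iff (by omega) hrp).1 hA).1
            omega
        · omega
    · intro b υ hbq hυ h22 h1'
      obtain ⟨fr'', ha0'', ha1'', hT'', ht''⟩ := (hI₃ _ _).1 hυ
      have g0' : υ.v 0 = p := (fr'' 0 (by decide)).trans ((fr 0 (by decide)).trans hin.agents)
      have g3' : υ.v 3 = p + q := (fr'' 3 (by decide)).trans g3
      have g21 : υ.v 21 = a := (fr'' 21 (by decide)).trans h21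
      have hidx' := idx_lt (N := p + q) (a := q + a) (b := p + b) (by omega) (by omega)
      simp only [wp, ok_add, ok_mul, ok_var, eval_add, eval_mul, eval_var, true_and, St.tick_v, g21,
        h1', g3', g0', h22, cost_add, cost_mul, cost_var, eval_ofNat, cost_ofNat, ok_ofNat,
        St.put_v]
      refine ⟨⟨⟨by omega, by omega⟩, by omega, by omega⟩, by omega, (hI₃ _ _).2 ⟨fun x hx => ?_,
        by simp [ha0''], by simp [ha1''], ?_, by simp; omega⟩⟩
      · have h1 : x ≠ 22 := by omega
        simp [h1, fr'' x hx]
      · simp only [St.asg_a, St.put_a, St.tick_a, Function.update_self]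
        refine hT''.update (by omega) ⟨fun _ => ?_, fun _ => by simp⟩ fun x hx r hr hA => ?_
        · exact (allowed_absorb_iff (by omega)).2 (hyP.dummy _ (by omega))
        · omega
    · intro υ hυ
      obtain ⟨fr'', ha0'', ha1'', hT'', ht''⟩ := (hI₃ _ _).1 hυ
      refine ⟨(fr'' 21 (by decide)).trans h21, (fr'' 0 (by decide)).trans h0,
        (hJ _ _).2 ⟨fun x hx => ?_, ha0'', ha1'', ?_, ?_⟩⟩
      · have h1 : x ≠ 21 := by omega
        simp [h1, fr'' x (by omega), fr x hx]
      · intro x hx r hr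
        refine (hT'' x hx r hr).trans (and_congr_right fun hA => ?_)
        omega
      · have h1 : (a + 1) * (80 * (q * q) + 80 * q + 60) =
          a * (80 * (q * q) + 80 * q + 60) + (80 * (q * q) + 80 * q + 60) := Nat.succ_mul _ _
        have h2 : q * (80 * q + 50) = 80 * (q * q) + 50 * q := by ring
        simp [h1]
        omega
  · intro τ hτ
    obtain ⟨fr, ha0, ha1, hT, ht⟩ := (hJ _ _).1 hτ
    refine hQ _ fr ha0 (fun x hx => ?_) (by simpa [ha1] using hyP) ?_ ?_
    · simp [ha1, hyq x hx]
    · intro x hx r hr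
      simp only [St.tick_a, ha1]
      refine (hT x hx r hr).trans (and_congr_right fun hA => iff_of_true ?_ trivial)
      by_cases hrp : r < p
      · omega
      · have h0 := (allowed_absorb_iff (by omega)).1 hA
        by_contra hc
        have := hyq x (by omega)
        have := hF.one_le
        omega
    · have : p * (80 * (q * q) + 80 * q + 60) =
          80 * (p * (q * q)) + 80 * (p * q) + 60 * p := by ring
      simp
      omega

/-! ### Updating the table after lowering one price. -/

/-- The entries in the region `S` of the table agree with `A'`, those in the region `S₀` with `A`.
-/
def TableMix (N : ℕ) (A A' : ℕ → ℕ → Prop) (tab : ℕ → ℕ) (S S₀ : ℕ → ℕ → Prop) : Prop :=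
  ∀ x < N, ∀ r < N, (S x r → (tableEdge N tab x r ↔ A' x r)) ∧
    (S₀ x r → (tableEdge N tab x r ↔ A x r))

theorem TableMix.write {N : ℕ} {A A' : ℕ → ℕ → Prop} {tab : ℕ → ℕ} {S S₀ S' S₀' : ℕ → ℕ → Prop}
    (h : TableMix N A A' tab S S₀) {x₀ r₀ e : ℕ} (hr₀ : r₀ < N)
    (he : S' x₀ r₀ → (e ≠ 0 ↔ A' x₀ r₀))
    (hS : ∀ x < N, ∀ r < N, S' x r → S x r ∨ x = x₀ ∧ r = r₀)
    (hS₀ : ∀ x < N, ∀ r < N, S₀' x r → S₀ x r ∧ ¬ (x = x₀ ∧ r = r₀)) :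
    TableMix N A A' (Function.update tab (x₀ * N + r₀) e) S' S₀' := by
  intro x hx r hr
  unfold tableEdge
  by_cases hc : x = x₀ ∧ r = r₀
  · refine ⟨fun hs => ?_, fun hs => absurd hc (hS₀ x hx r hr hs).2⟩
    obtain ⟨rfl, rfl⟩ := hc
    rw [Function.update_self]
    exact he hs
  · rw [Function.update_of_ne fun heq => hc (idx_inj hr hr₀ heq)]
    exact ⟨fun hs => (h x hx r hr).1 ((hS x hx r hr hs).resolve_right hc),
      fun hs => (h x hx r hr).2 (hS₀ x hx r hr hs).1⟩

/-- An entry on which the old and the new edge set agree passes from the old region to the new one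
without being written. -/
theorem TableMix.keep {N : ℕ} {A A' : ℕ → ℕ → Prop} {tab : ℕ → ℕ} {S S₀ S' S₀' : ℕ → ℕ → Prop}
    (h : TableMix N A A' tab S S₀)
    (hS : ∀ x < N, ∀ r < N, S' x r → S x r ∨ S₀ x r ∧ (A x r ↔ A' x r))
    (hS₀ : ∀ x < N, ∀ r < N, S₀' x r → S₀ x r) : TableMix N A A' tab S' S₀' := by
  intro x hx r hr
  refine ⟨fun hs => ?_, fun hs => (h x hx r hr).2 (hS₀ x hx r hr hs)⟩
  rcases hS x hx r hr hs with h1 | ⟨h1, h2⟩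
  · exact (h x hx r hr).1 h1
  · exact ((h x hx r hr).2 h1).trans h2

section Lower

variable {G : PopInstance p q} {κ : ℕ} {y : ℕ → ℕ} {b₀ : ℕ}

/-- A lower price of `b₀` only sharpens the comparison with `b₀`. Away from the row of `b₀` edges
can only disappear, and one inequality per entry decides. -/
theorem allowed_lower_object {x r : ℕ} (hx : x < q) (hr : r < p) (hne : x ≠ b₀)
    (hadj : G.AdjN r b₀) : G.Allowed κ (Function.update y b₀ (y b₀ - 1)) x r ↔
      G.Allowed κ y x r ∧ y x + G.prefVal r b₀ x ≤ y b₀ - 1 + G.prefVal r x b₀ := by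
  rw [allowed_object_iff hx hr, allowed_object_iff hx hr, Function.update_of_ne hne]
  refine ⟨fun ⟨h1, h2⟩ => ⟨⟨h1, fun b hb => ?_⟩, ?_⟩, fun ⟨⟨h1, h2⟩, h3⟩ => ⟨h1, fun b hb => ?_⟩⟩
  · have := h2 b hb
    by_cases hb0 : b = b₀
    · subst hb0
      rw [Function.update_self] at this
      omega
    · rwa [Function.update_of_ne hb0] at this
  · have := h2 b₀ hadj
    rwa [Function.update_self] at this
  · by_cases hb0 : b = b₀
    · subst hb0
      rwa [Function.update_self]
    · rw [Function.update_of_ne hb0]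
      exact h2 b hb

theorem allowed_lower_of_not_adj {x r : ℕ} (hne : x ≠ b₀) (hadj : ¬ G.AdjN r b₀) :
    G.Allowed κ y x r ↔ G.Allowed κ (Function.update y b₀ (y b₀ - 1)) x r := by
  have h : ∀ b, G.AdjN r b → Function.update y b₀ (y b₀ - 1) b = y b := fun b hb =>
    Function.update_of_ne (by rintro rfl; exact hadj hb) _ _
  unfold Allowed
  rw [Function.update_of_ne hne]
  refine or_congr (and_congr_right fun _ => forall₂_congr fun b hb => by rw [h b hb])
    (or_congr (and_congr_right fun _ => and_congr_right fun _ =>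
      forall₂_congr fun b hb => by rw [h b hb]) Iff.rfl)

/-- The new price of `b₀` is below `κ`, so no neighbour of `b₀` may stay unmatched any longer. -/
theorem not_allowed_lower_dummy {x r : ℕ} (hy : IsPrice q κ y) (h0 : y b₀ ≠ 0) (hx : q ≤ x)
    (hr : r < p) (hadj : G.AdjN r b₀) :
    ¬ G.Allowed κ (Function.update y b₀ (y b₀ - 1)) x r := by
  rw [allowed_dummy_iff hx hr]
  rintro ⟨-, h⟩
  have h1 := h b₀ hadj
  rw [Function.update_self] at h1
  have := hy.le b₀
  omega

theorem allowed_lower_absorb {x r : ℕ} (hr : p ≤ r) (hne : x ≠ b₀) :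
    G.Allowed κ y x r ↔ G.Allowed κ (Function.update y b₀ (y b₀ - 1)) x r := by
  rw [allowed_absorb_iff hr, allowed_absorb_iff hr, Function.update_of_ne hne]

theorem IsPrice.lower (hy : IsPrice q κ y) : IsPrice q κ (Function.update y b₀ (y b₀ - 1)) := by
  refine ⟨fun x => ?_, fun x hx => ?_⟩
  · have h1 := hy.le x
    have h2 := hy.le b₀
    rw [Function.update_apply]
    split <;> omega
  · have h1 := hy.dummy x hx
    rw [Function.update_apply]
    split
    · rename_i h; subst h; omega
    · exact h1

end Lower

/-- Deletes the entries of the agent `v 21` that the lower price of the object `v 25` forbids. -/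
def deleteEdges : Cmd :=
  ite 0 (adjEx 25)
    (put 2 ((var 1 + var 21) * var 3 + var 21) 0 ;;
      forLoop 22 1 (ite 0 (adjEx 22)
        (ite (get 1 (var 25) + prefEx 22 25) (get 1 (var 22) + prefEx 25 22)
          (put 2 (var 22 * var 3 + var 21) 0) skip) skip))
    skip

/-- The entry of `b₀` itself ends up in neither region: the lower price can make that edge allowed,
so deletion does not suffice and the entry is computed afresh afterwards. -/
theorem wp_deleteEdges {G : PopInstance p q} {κ W K a b₀ : ℕ} (hF : FitsInput p q κ W K) {σ : St}
    {Q : St → Prop} (hin : HasInput G κ σ) {y : ℕ → ℕ} (hy : IsPrice q κ y) (h0 : y b₀ ≠ 0)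
    (hb₀ : b₀ < q) (h25 : σ.v 25 = b₀) (h21 : σ.v 21 = a) (ha : a < p)
    (h1 : σ.a 1 = Function.update y b₀ (y b₀ - 1))
    (hT : TableMix (p + q) (G.Allowed κ y) (G.Allowed κ (Function.update y b₀ (y b₀ - 1))) (σ.a 2)
      (fun _ r => r < a) (fun _ r => a ≤ r))
    (hQ : ∀ τ : St, (∀ x, x ≠ 22 → τ.v x = σ.v x) → τ.a 0 = σ.a 0 → τ.a 1 = σ.a 1 →
      TableMix (p + q) (G.Allowed κ y) (G.Allowed κ (Function.update y b₀ (y b₀ - 1))) (τ.a 2)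
        (fun x r => r ≤ a ∧ (x ≠ b₀ ∨ r ≠ a)) (fun _ r => a < r) →
      τ.time ≤ σ.time + 100 * q + 50 → Q τ) :
    deleteEdges.wp W K Q σ := by
  have hK := hF.lt
  have hsq := hF.fits.sq
  have hword := hF.fits.word
  obtain ⟨o1, e1⟩ := adjEx_spec hF hin h21 ha h25 hb₀
  have g3 := hin.size
  have g1 := hin.objects
  refine ⟨trivial, o1, fun hlt => ?_, fun hge => ?_⟩
  · rw [e1, eval_ofNat, adjVal_pos] at hlt
    have hidx := idx_lt (N := p + q) (a := q + a) (b := a) (by omega) (by omega)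
    refine ⟨?_, trivial, ?_, ?_⟩
    · simp only [ok_add, ok_mul, ok_var, eval_add, eval_mul, eval_var, true_and, St.tick_v, h21, g1,
        g3]
      omega
    · simp only [eval_add, eval_mul, eval_var, St.tick_v, h21, g1, g3]
      omega
    simp only [eval_add, eval_mul, eval_var, St.tick_v, h21, g1, g3, cost_add, cost_mul, cost_var,
      eval_ofNat, cost_ofNat, cost_adjEx]
    obtain ⟨I, hI⟩ : ∃ I : ℕ → St → Prop, ∀ k τ, I k τ ↔ (∀ x, x ≠ 22 → τ.v x = σ.v x) ∧
        τ.a 0 = σ.a 0 ∧ τ.a 1 = σ.a 1 ∧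
        TableMix (p + q) (G.Allowed κ y) (G.Allowed κ (Function.update y b₀ (y b₀ - 1))) (τ.a 2)
          (fun x r => r < a ∨ (r = a ∧ (x < k ∨ q ≤ x) ∧ x ≠ b₀))
          (fun x r => a < r ∨ (r = a ∧ k ≤ x ∧ x < q ∧ x ≠ b₀)) ∧
        τ.time ≤ σ.time + 100 * k + 40 := ⟨_, fun _ _ => Iff.rfl⟩
    refine wp_forLoop (n := q) I (by decide) (by simp [g1]) (by omega) ?_ ?_ ?_
    · refine (hI _ _).2 ⟨fun x hx => by simp [hx], by simp, by simp, ?_, by simp⟩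
      simp only [St.asg_a, St.put_a, St.tick_a, Function.update_self]
      have hT' := hT.keep (S' := fun x r => r < a ∨ (r = a ∧ q ≤ x ∧ x ≠ q + a))
        (S₀' := fun _ r => a ≤ r) (fun x hx r hr hs => ?_) (fun _ _ _ _ h => h)
      · refine hT'.write (by omega) (fun _ => iff_of_false (by simp)
          (not_allowed_lower_dummy hy h0 (by omega) ha hlt)) (fun x hx r hr hs => by omega)
          (fun x hx r hr hs => by omega)
      · rcases hs with hs | ⟨rfl, hs1, hs2⟩
        · exact Or.inl hs
        · refine Or.inr ⟨le_rfl, iff_of_false (fun hA => ?_) (fun hA => ?_)⟩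
          · exact hs2 ((allowed_dummy_iff hs1 ha).1 hA).1
          · exact hs2 ((allowed_dummy_iff hs1 ha).1 hA).1
    · intro b τ hb hτ h22 h1'
      obtain ⟨fr, ha0, ha1, hM, ht⟩ := (hI _ _).1 hτ
      have hin1 : HasInput G κ (τ.tick 3) := hin.congr (fun x hx => fr x (by omega)) ha0
      have g21 : τ.v 21 = a := (fr 21 (by decide)).trans h21
      have g25 : τ.v 25 = b₀ := (fr 25 (by decide)).trans h25
      have g3' : τ.v 3 = p + q := (fr 3 (by decide)).trans g3
      obtain ⟨o2, e2⟩ := adjEx_spec hF hin1 (x := 22) g21 ha h22 hb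
      have hin2 : HasInput G κ ((τ.tick 3).tick (1 + 9 + 1)) :=
        hin1.congr (fun x hx => rfl) rfl
      obtain ⟨o3, e3⟩ := prefEx_spec hF hin2 (x := 22) (x' := 25) g21 ha h22 hb g25 hb₀
      obtain ⟨o4, e4⟩ := prefEx_spec hF hin2 (x := 25) (x' := 22) g21 ha g25 hb₀ h22 hb
      have b1 := hy.le b
      have b2 := hy.le b₀
      have b3 := G.prefVal_le_one a b b₀
      have b4 := G.prefVal_le_one a b₀ b
      have hidx := idx_lt (N := p + q) (a := b) (b := a) (by omega) (by omega)
      have hyb : b ≠ b₀ → τ.a 1 b = y b := fun hne => by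
        rw [ha1, h1, Function.update_of_ne hne]
      have hyb₀ : τ.a 1 b₀ = y b₀ - 1 := by rw [ha1, h1, Function.update_self]
      have hyle : τ.a 1 b ≤ κ := by
        by_cases hne : b = b₀
        · rw [hne, hyb₀]; omega
        · rw [hyb hne]; exact b1
      have hdone : ∀ υ : St, (∀ x, υ.v x = τ.v x) → υ.a = τ.a → υ.time ≤ τ.time + 80 →
          (b ≠ b₀ → (G.Allowed κ y b a ↔ G.Allowed κ (Function.update y b₀ (y b₀ - 1)) b a)) →
          I (b + 1) (υ.asg 22 (b + 1) 4) := by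
        intro υ hv hυa hυt hiff
        refine (hI _ _).2 ⟨fun x hx => by simp [hx, hv, fr x hx], by simp [hυa, ha0],
          by simp [hυa, ha1], ?_, by simp; omega⟩
        simp only [St.asg_a, hυa]
        refine hM.keep (fun x hx r hr hs => ?_) (fun x hx r hr hs => by omega)
        by_cases hxb : x = b ∧ r = a
        · obtain ⟨rfl, rfl⟩ := hxb
          exact Or.inr ⟨by omega, hiff (by omega)⟩
        · exact Or.inl (by omega)
      refine ⟨trivial, o2, fun hE => ?_, fun hE => ?_⟩
      · rw [e2, eval_ofNat, adjVal_pos] at hE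
        simp only [wp, ok_add, ok_mul, ok_get, ok_var, eval_add, eval_mul, eval_get, eval_var,
          true_and, cost_add, cost_mul, cost_get, cost_var, cost_prefEx, cost_ofNat, cost_adjEx,
          eval_ofNat, o3, o4, e3, e4, St.tick_v, St.tick_a, h22, g21, g25, g3', ok_ofNat, hyb₀,
          St.put_v]
        refine ⟨⟨by omega, by omega⟩, ⟨by omega, by omega⟩,
          fun hv => ⟨⟨by omega, by omega⟩, by omega, h1', ?_⟩, fun hv => ⟨h1', ?_⟩⟩
        · refine (hI _ _).2 ⟨fun x hx => by simp [hx, fr x hx], by simp [ha0], by simp [ha1], ?_,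
            by simp; omega⟩
          simp only [St.asg_a, St.put_a, St.tick_a, Function.update_self]
          refine hM.write (by omega) (fun hs => iff_of_false (by simp) ?_)
            (fun x hx r hr hs => by omega) (fun x hx r hr hs => by omega)
          have hne : b ≠ b₀ := by omega
          rw [hyb hne] at hv
          rw [allowed_lower_object hb ha hne hlt]
          rintro ⟨-, h⟩
          omega
        · refine hdone (St.tick (St.tick (St.tick (St.tick τ _) _) _) _) (fun x => rfl) rfl
            (by simp) fun hne => ?_
          rw [hyb hne] at hv
          rw [allowed_lower_object hb ha hne hlt]
          exact ⟨fun h => ⟨h, by omega⟩, fun h => h.1⟩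
      · rw [e2, eval_ofNat, adjVal_pos] at hE
        refine ⟨h22, h1', hdone _ (fun x => rfl) rfl (by simp) fun hne => iff_of_false ?_ ?_⟩
        · exact fun h => hE ((allowed_object_iff hb ha).1 h).1
        · exact fun h => hE ((allowed_object_iff hb ha).1 h).1
    · intro τ hτ
      obtain ⟨fr, ha0, ha1, hM, ht⟩ := (hI _ _).1 hτ
      refine hQ _ fr ha0 ha1 ?_ (by simp; omega)
      exact hM.keep (fun x hx r hr hs => Or.inl (by omega)) (fun x hx r hr hs => by omega)
  · rw [e1, eval_ofNat, adjVal_pos] at hge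
    refine hQ _ (fun x hx => rfl) rfl rfl ?_ (by simp; omega)
    refine hT.keep (fun x hx r hr hs => ?_) (fun x hx r hr hs => by omega)
    by_cases hra : r = a
    · subst hra
      exact Or.inr ⟨le_rfl, allowed_lower_of_not_adj (by omega) hge⟩
    · exact Or.inl (by omega)

/-- Lowers the price of the object `v 25` by one and updates the table. -/
def lowerPrice : Cmd :=
  put 1 (var 25) (get 1 (var 25) - 1) ;;
  forLoop 21 0 (deleteEdges ;; asg 22 (var 25) ;; computeEdge) ;;
  ite (get 1 (var 25)) 1 (forLoop 22 1 (put 2 (var 25 * var 3 + (var 0 + var 22)) 1)) skip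

/-- For each agent there is one linear pass of deletions and one recomputed entry. The edges from
`b₀` to the absorbing nodes appear only when the price reaches zero. The quadratic cost keeps the
update below that of the matching round. -/
theorem wp_lowerPrice {G : PopInstance p q} {κ W K b₀ : ℕ} (hF : FitsInput p q κ W K) {σ : St}
    {Q : St → Prop} (hin : HasInput G κ σ) (hy : IsPrice q κ (σ.a 1)) (h0 : σ.a 1 b₀ ≠ 0)
    (hb₀ : b₀ < q) (h25 : σ.v 25 = b₀)
    (hT : TableOn G κ (σ.a 1) (σ.a 2) (fun _ _ => True))
    (hQ : ∀ τ : St, (∀ x, x < 21 ∨ 24 < x → τ.v x = σ.v x) → τ.a 0 = σ.a 0 →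
      τ.a 1 = Function.update (σ.a 1) b₀ (σ.a 1 b₀ - 1) →
      TableOn G κ (τ.a 1) (τ.a 2) (fun _ _ => True) →
      τ.time ≤ σ.time + 200 * (p * q) + 200 * (p + q) + 60 → Q τ) :
    lowerPrice.wp W K Q σ := by
  have hK := hF.lt
  have hsq := hF.fits.sq
  have hword := hF.fits.word
  obtain ⟨y, hyy⟩ : ∃ y, y = σ.a 1 := ⟨_, rfl⟩
  rw [← hyy] at hy h0 hT
  refine ⟨trivial, ⟨⟨trivial, by simp [h25]; omega⟩, trivial⟩, by simp [h25]; omega, ?_⟩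
  simp only [eval_sub, eval_get, eval_var, eval_ofNat, h25, cost_sub, cost_get, cost_var,
    cost_ofNat, ← hyy]
  obtain ⟨I, hI⟩ : ∃ I : ℕ → St → Prop, ∀ k τ, I k τ ↔ (∀ x, x < 21 ∨ 24 < x → τ.v x = σ.v x) ∧
      τ.a 0 = σ.a 0 ∧ τ.a 1 = Function.update y b₀ (y b₀ - 1) ∧
      TableMix (p + q) (G.Allowed κ y) (G.Allowed κ (Function.update y b₀ (y b₀ - 1))) (τ.a 2)
        (fun _ r => r < k) (fun _ r => k ≤ r) ∧
      τ.time ≤ σ.time + k * (180 * q + 110) + 20 := ⟨_, fun _ _ => Iff.rfl⟩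
  refine wp_forLoop (n := p) I (by decide) (by simp [hin.agents]) (by omega) ?_ ?_ ?_
  · refine (hI _ _).2 ⟨fun x hx => ?_, by simp, by simp [hyy], fun x hx r hr =>
      ⟨fun h => by omega, fun _ => ?_⟩, by simp⟩
    · have h1 : x ≠ 21 := by omega
      simp [h1]
    · simpa using hT x hx r hr
  · intro a τ ha hτ h21 hp
    obtain ⟨fr, ha0, ha1, hM, ht⟩ := (hI _ _).1 hτ
    have hin1 : HasInput G κ (τ.tick 3) := hin.congr (fun x hx => fr x (by omega)) ha0
    have g25 : τ.v 25 = b₀ := (fr 25 (by decide)).trans h25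
    refine wp_deleteEdges (a := a) hF hin1 hy h0 hb₀ g25 h21 ha ha1 hM ?_
    intro υ fr₁ ha0₁ ha1₁ hM₁ ht₁
    simp only [St.tick_v, St.tick_a, St.tick_time] at fr₁ ha0₁ ha1₁ ht₁
    have g25₁ : υ.v 25 = b₀ := (fr₁ 25 (by decide)).trans g25
    have ha1₁' := ha1₁.trans ha1
    refine ⟨trivial, ?_⟩
    simp only [eval_var, cost_var, g25₁]
    refine wp_computeEdge (G := G) (κ := κ) (a := a) (b := b₀) hF (hin1.congr (fun x hx => ?_)
      (by simp [ha0₁])) (by simpa [ha1₁'] using IsPrice.lower hy) (by simp [fr₁ 21, h21]) ha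
      (by simp) hb₀ ?_
    · have h1 : x ≠ 22 := by omega
      simp [h1, fr₁ x h1]
    intro ω e fr₂ haω he ht₂
    simp only [St.asg_v, St.asg_a, St.asg_time] at fr₂ haω he ht₂
    refine ⟨by simp [fr₂ 21, fr₁ 21, h21], by simp [fr₂ 0, fr₁ 0, hp], (hI _ _).2 ⟨fun x hx => ?_,
      by simp [haω, ha0₁, ha0], by simp [haω, ha1₁'], ?_, ?_⟩⟩
    · have h1 : x ≠ 21 := by omega
      have h2 : x ≠ 22 := by omega
      simp [h1, fr₂ x (by omega) (by omega), h2, fr₁ x h2, fr x hx]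
    · simp only [St.asg_a, haω, Function.update_self]
      rw [ha1₁'] at he
      exact hM₁.write (by omega) (fun _ => he) (fun x hx r hr hs => by omega)
        (fun x hx r hr hs => by omega)
    · have : (a + 1) * (180 * q + 110) = a * (180 * q + 110) + (180 * q + 110) := Nat.succ_mul _ _
      simp [this]
      omega
  intro σ₁ hσ₁
  obtain ⟨fr₁, ha0₁, ha1₁, hM₁, ht₁⟩ := (hI _ _).1 hσ₁
  have hpq : p * (180 * q + 110) = 180 * (p * q) + 110 * p := by ring
  have g25₁ : σ₁.v 25 = b₀ := (fr₁ 25 (by decide)).trans h25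
  have g0 : σ₁.v 0 = p := (fr₁ 0 (by decide)).trans hin.agents
  have g1 : σ₁.v 1 = q := (fr₁ 1 (by decide)).trans hin.objects
  have g3 : σ₁.v 3 = p + q := (fr₁ 3 (by decide)).trans hin.size
  have hval : σ₁.a 1 b₀ = y b₀ - 1 := by rw [ha1₁, Function.update_self]
  refine ⟨by simp [g25₁]; omega, trivial, fun hlt => ?_, fun hge => ?_⟩
  · simp only [eval_get, eval_var, St.tick_v, St.tick_a, g25₁, hval, eval_ofNat] at hlt
    obtain ⟨J, hJ⟩ : ∃ J : ℕ → St → Prop, ∀ k τ, J k τ ↔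
        (∀ x, x < 21 ∨ 24 < x → τ.v x = σ.v x) ∧ τ.a 0 = σ.a 0 ∧
        τ.a 1 = Function.update y b₀ (y b₀ - 1) ∧
        TableMix (p + q) (G.Allowed κ y) (G.Allowed κ (Function.update y b₀ (y b₀ - 1))) (τ.a 2)
          (fun x r => r < p + k ∨ x ≠ b₀) (fun _ _ => False) ∧
        τ.time ≤ σ.time + p * (180 * q + 110) + 30 * k + 40 := ⟨_, fun _ _ => Iff.rfl⟩
    refine wp_forLoop (n := q) J (by decide) (by simp [g1]) (by omega) ?_ ?_ ?_
    · refine (hJ _ _).2 ⟨fun x hx => ?_, by simp [ha0₁], by simp [ha1₁], ?_, by simp; omega⟩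
      · have h1 : x ≠ 22 := by omega
        simp [h1, fr₁ x hx]
      · refine hM₁.keep (fun x hx r hr hs => ?_) (fun x hx r hr hs => hs.elim)
        by_cases hrp : r < p
        · exact Or.inl hrp
        · exact Or.inr ⟨by omega, allowed_lower_absorb (by omega) (by omega)⟩
    · intro b τ hb hτ h22 h1'
      obtain ⟨fr, ha0, ha1, hM, ht⟩ := (hJ _ _).1 hτ
      have g25' : τ.v 25 = b₀ := (fr 25 (by decide)).trans h25
      have g0' : τ.v 0 = p := (fr 0 (by decide)).trans hin.agents
      have g3' : τ.v 3 = p + q := (fr 3 (by decide)).trans hin.size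
      have hidx := idx_lt (N := p + q) (a := b₀) (b := p + b) (by omega) (by omega)
      simp only [wp, ok_add, ok_mul, ok_var, eval_add, eval_mul, eval_var, true_and, St.tick_v,
        g25', h1', g3', g0', h22, cost_add, cost_mul, cost_var, eval_ofNat, cost_ofNat, ok_ofNat,
        St.put_v]
      refine ⟨⟨by omega, by omega, by omega⟩, by omega, (hJ _ _).2 ⟨fun x hx => ?_,
        by simp [ha0], by simp [ha1], ?_, by simp; omega⟩⟩
      · have h1 : x ≠ 22 := by omega
        simp [h1, fr x hx]
      · simp only [St.asg_a, St.put_a, St.tick_a, Function.update_self]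
        refine hM.write (by omega) (fun _ => iff_of_true (by simp) ?_)
          (fun x hx r hr hs => by omega) (fun x hx r hr hs => hs.elim)
        rw [allowed_absorb_iff (by omega), Function.update_self]
        omega
    · intro τ hτ
      obtain ⟨fr, ha0, ha1, hM, ht⟩ := (hJ _ _).1 hτ
      refine hQ _ fr ha0 (by simp [ha1, hyy]) ?_ (by simp; omega)
      intro x hx r hr
      simp only [St.tick_a, ha1, and_true]
      exact (hM x hx r hr).1 (by omega)
  · simp only [eval_get, eval_var, St.tick_v, St.tick_a, g25₁, hval, eval_ofNat] at hge
    refine hQ _ fr₁ ha0₁ (by simp [ha1₁, hyy]) ?_ (by simp; omega)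
    intro x hx r hr
    simp only [St.tick_a, ha1₁, and_true]
    by_cases hrp : r < p
    · exact (hM₁ x hx r hr).1 hrp
    · refine ((hM₁ x hx r hr).2 (by omega)).trans ?_
      by_cases hxb : x = b₀
      · rw [allowed_absorb_iff (by omega), allowed_absorb_iff (by omega), hxb, Function.update_self]
        omega
      · exact allowed_lower_absorb (by omega) hxb

/-! ### Adjusting the prices, and the complete algorithm. -/

/-- Sets the variable `5` to the square root of `N`, rounded up. -/
def computeRoot : Cmd := asg 5 0 ;; loop (var 5 * var 5) (var 3) (asg 5 (var 5 + 1))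

theorem wp_computeRoot {N W K : ℕ} (hF : Fits N W K) {σ : St} {Q : St → Prop} (h3 : σ.v 3 = N)
    (hQ : ∀ τ : St, (∀ x, x ≠ 5 → τ.v x = σ.v x) → τ.a = σ.a → N ≤ τ.v 5 * τ.v 5 → τ.v 5 ≤ N →
      τ.v 5 ≤ Nat.sqrt N + 1 → τ.time ≤ σ.time + 9 * N + 7 → Q τ) :
    computeRoot.wp W K Q σ := by
  have hN2 := hF.two_le
  have hsq := hF.sq
  have hword := hF.word
  refine ⟨trivial, fun τ => (∀ x, x ≠ 5 → τ.v x = σ.v x) ∧ τ.a = σ.a ∧ τ.v 5 ≤ N ∧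
    τ.v 5 ≤ Nat.sqrt N + 1 ∧ τ.time = σ.time + 9 * τ.v 5 + 2, fun τ => N - τ.v 5,
    ⟨fun x hx => by simp [hx], rfl, by simp, by simp, by simp⟩, ?_⟩
  rintro τ ⟨fr, ha, hN, hs, ht⟩
  have g3 : τ.v 3 = N := (fr 3 (by decide)).trans h3
  have hmul : τ.v 5 * τ.v 5 ≤ N * N := Nat.mul_le_mul hN hN
  simp only [wp, ok_mul, ok_add, ok_var, ok_ofNat, eval_mul, eval_add, eval_var, eval_ofNat,
    true_and, g3, cost_mul, cost_var, cost_add, cost_ofNat, St.tick_v]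
  refine ⟨by omega, fun hlt => ⟨by omega, ⟨fun x hx => by simp [hx, fr x hx], by simp [ha], ?_,
    ?_, ?_⟩, ?_⟩, fun hge => ?_⟩
  · have : τ.v 5 ≤ τ.v 5 * τ.v 5 := Nat.le_mul_self _
    simp
    omega
  · have : τ.v 5 ≤ Nat.sqrt N := Nat.le_sqrt.2 hlt.le
    simpa using this
  · simp [ht]
    omega
  · have : τ.v 5 ≤ τ.v 5 * τ.v 5 := Nat.le_mul_self _
    simp
    omega
  · exact hQ _ fr ha (by simpa using hge) hN hs (by simp [ht]; omega)

/-- Sets the variable `25` to an unmatched left node, or to `N` if there is none. -/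
def findFree : Cmd :=
  asg 25 (var 3) ;; forLoop 26 3 (ite (get 5 (var 26)) 1 (asg 25 (var 26)) skip)

theorem wp_findFree {N W K : ℕ} (hF : Fits N W K) {σ : St} {Q : St → Prop} (h3 : σ.v 3 = N)
    (hQ : ∀ τ : St, (∀ x, x ≠ 25 → x ≠ 26 → τ.v x = σ.v x) → τ.a = σ.a →
      (τ.v 25 = N ∧ (∀ x < N, σ.a 5 x ≠ 0) ∨ τ.v 25 < N ∧ σ.a 5 (τ.v 25) = 0) →
      τ.time ≤ σ.time + 20 * N + 10 → Q τ) :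
    findFree.wp W K Q σ := by
  have hN2 := hF.two_le
  have hsq := hF.sq
  have hword := hF.word
  refine ⟨trivial, ?_⟩
  simp only [eval_var, cost_var, h3]
  obtain ⟨I, hI⟩ : ∃ I : ℕ → St → Prop, ∀ k τ, I k τ ↔
      (∀ x, x ≠ 25 → x ≠ 26 → τ.v x = σ.v x) ∧ τ.a = σ.a ∧
      (τ.v 25 = N ∧ (∀ x < k, σ.a 5 x ≠ 0) ∨ τ.v 25 < N ∧ σ.a 5 (τ.v 25) = 0) ∧
      τ.time ≤ σ.time + 20 * k + 4 := ⟨_, fun _ _ => Iff.rfl⟩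
  refine wp_forLoop (n := N) I (by decide) (by simp [h3]) (by omega) ?_ ?_ ?_
  · exact (hI _ _).2 ⟨fun x h1 h2 => by simp [h1, h2], rfl, Or.inl (by simp), by simp⟩
  · intro k τ hk hτ h26 h3'
    obtain ⟨fr, ha, h25, ht⟩ := (hI _ _).1 hτ
    refine ⟨⟨trivial, by simp [h26]; omega⟩, trivial, fun hlt => ⟨trivial, by simpa using h26,
      by simpa using h3', (hI _ _).2 ⟨fun x h1 h2 => by simp [h1, h2, fr x h1 h2], by simp [ha],
        Or.inr ?_, by simp; omega⟩⟩, fun hge => ⟨h26, h3', (hI _ _).2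
        ⟨fun x h1 h2 => by simp [h2, fr x h1 h2], by simp [ha], ?_, by simp; omega⟩⟩⟩
    · simp [h26, ha] at hlt
      simp [h26, hk, hlt]
    · simp [h26, ha] at hge
      simp only [St.asg_v, ne_eq, Nat.reduceEqDiff, not_false_eq_true, Function.update_of_ne,
        St.tick_v]
      refine h25.imp (fun h => ⟨h.1, fun x hx => ?_⟩) id
      rcases Nat.lt_succ_iff_lt_or_eq.1 hx with hx | rfl
      · exact h.2 x hx
      · omega
  · intro τ hτ
    obtain ⟨fr, ha, h25, ht⟩ := (hI _ _).1 hτ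
    exact hQ _ fr ha h25 (by simp; omega)

/-- The final state describes a matching that is popular with penalty `κ`. -/
def MatesPopular (G : PopInstance p q) (κ : ℕ) (mr : ℕ → ℕ) : Prop :=
  ∃ M : G.Matching, G.PopularWithPenalty κ M ∧ ∀ a : Fin p, mr a ≠ 0 ∧
    M.partner a = if h : mr a - 1 < q then some ⟨mr a - 1, h⟩ else none

/-- If every left node has a mate, these mates are distinct and exhaust the right side by counting.
So each agent has a mate too, an object or its dummy. -/
theorem matesPopular_of_perfect {G : PopInstance p q} {κ : ℕ} {y tab mr ml : ℕ → ℕ}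
    (hy : IsPrice q κ y) (hT : TableOn G κ y tab (fun _ _ => True))
    (hM : IsMatch (p + q) (tableEdge (p + q) tab) mr) (hml : IsMateTable (p + q) mr ml)
    (hall : ∀ x < p + q, ml x ≠ 0) : MatesPopular G κ mr := by
  have hsurj : ∀ r < p + q, mr r ≠ 0 := by
    have himg : (Finset.range (p + q)).image (fun x => ml x - 1) = Finset.range (p + q) := by
      refine Finset.eq_of_subset_of_card_le (fun r hr => ?_) (le_of_eq ?_)
      · obtain ⟨x, hx, rfl⟩ := Finset.mem_image.1 hr
        have h1 := Finset.mem_range.1 hx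
        have h2 := hml.le x h1
        have h3 := hall x h1
        exact Finset.mem_range.2 (by omega)
      · refine (Finset.card_image_of_injOn fun x hx x' hx' h => ?_).symm
        have h1 := Finset.mem_range.1 hx
        have h1' := Finset.mem_range.1 hx'
        have h2 := hml.le x h1
        have h3 := hall x h1
        have h3' := hall x' h1'
        have e1 := (hml.iff x h1 (ml x - 1) (by omega)).1 (by omega)
        have e2 := (hml.iff x' h1' (ml x - 1) (by omega)).1 (by omega)
        omega
    intro r hr
    have hr' := Finset.mem_range.2 hr
    rw [← himg] at hr'
    obtain ⟨x, hx, hxr⟩ := Finset.mem_image.1 hr'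
    have h1 := Finset.mem_range.1 hx
    have h3 := hall x h1
    have := (hml.iff x h1 r hr).1 (by omega)
    omega
  have hg : ∀ r < p + q, mr r - 1 < p + q ∧ G.Allowed κ y (mr r - 1) r := fun r hr => by
    have h1 := hsurj r hr
    have h2 := hM.le r hr
    have h3 : mr r - 1 < p + q := by omega
    exact ⟨h3, ((hT _ h3 r hr).1 (hM.edge r hr h1)).1⟩
  obtain ⟨M, hpop, hpart⟩ := exists_popular_of_mates G hy hg fun r hr r' hr' h => by
    have h1 := hsurj r hr
    have h1' := hsurj r' hr'
    exact hM.inj r hr r' hr' h1 (by omega)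
  exact ⟨M, hpop, fun a => ⟨hsurj a (by omega), hpart a⟩⟩

/-- Matches the two sides along the edges of the table and looks for an unmatched left node. -/
def matchRound : Cmd := auction ;; maximize ;; findFree

theorem wp_matchRound {G : PopInstance p q} {κ W K L : ℕ} (hF : FitsInput p q κ W K) {σ : St}
    {Q : St → Prop} (h3 : σ.v 3 = p + q) (h5 : σ.v 5 = L) (hL : p + q ≤ L * L) (hLN : L ≤ p + q)
    (hy : IsPrice q κ (σ.a 1)) (hT : TableOn G κ (σ.a 1) (σ.a 2) (fun _ _ => True))
    (hQ : ∀ τ : St, (∀ x, x < 6 ∨ 26 < x → τ.v x = σ.v x) → (∀ j, j < 3 → τ.a j = σ.a j) →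
      τ.time ≤ σ.time + 350 * ((p + q) * ((p + q) * (L + 1))) →
      (τ.v 25 = p + q ∧ MatesPopular G κ (τ.a 3) ∨ τ.v 25 < p + q ∧
        ∀ z f : ℕ → ℕ, (∀ x, z x ≤ σ.a 1 x) → G.IsPerfect κ z f → z (τ.v 25) < σ.a 1 (τ.v 25)) →
      Q τ) :
    matchRound.wp W K Q σ := by
  have hN2 := hF.fits.two_le
  generalize hN : p + q = N at *
  have hfits : Fits N W K := hN ▸ hF.fits
  refine wp_auction (L := L) hfits hLN h3 h5 fun σ₁ fr₁ fa₁ ht₁ hA => ?_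
  have e2 : σ₁.a 2 = σ.a 2 := fa₁ 2 (by decide) (by decide)
  have g3 : σ₁.v 3 = N := (fr₁ 3 (by decide)).trans h3
  refine wp_maximize (D := L) hfits g3 (by rw [e2]; exact hA.isMatch) (fun mr hmr => ?_)
    fun σ₂ fr₂ fa₂ ht₂ hM hml hU hUfree => ?_
  · rw [e2] at hmr
    -- The labels bound the deficit by `N / L`, which is at most `L` because `N ≤ L * L`.
    have h1 := matchSize_le_of_labels hmr hA.free hA.slack
      fun x hx hfree => hA.out x hx (by omega) hfree
    have hL0 : 0 < L := by
      rcases Nat.eq_zero_or_pos L with h0 | h0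
      · subst h0; omega
      · exact h0
    refine Nat.le_of_mul_le_mul_left (h1.trans ?_) hL0
    rw [Nat.mul_add]
    omega
  have e2' : σ₂.a 2 = σ.a 2 := (fa₂ 2 (by decide)).trans e2
  have e1' : σ₂.a 1 = σ.a 1 := (fa₂ 1 (by decide)).trans (fa₁ 1 (by decide) (by decide))
  have g3' : σ₂.v 3 = N := (fr₂ 3 (by decide)).trans g3
  rw [e2] at hM hU
  refine wp_findFree hfits g3' fun σ₃ fr₃ ha₃ hres ht₃ => hQ _ (fun x hx => ?_)
    (fun j hj => ?_) ?_ ?_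
  · rw [fr₃ x (by omega) (by omega), fr₂ x (by omega), fr₁ x (by omega)]
  · rw [ha₃, fa₂ j hj, fa₁ j (by omega) (by omega)]
  · have h1 : N * (N * (L + 1)) = N * (N * L) + N * N := by ring
    have h2 : (L + 1) * (200 * (N * N)) = 200 * (N * (N * L)) + 200 * (N * N) := by ring
    have h3 : 2 * N ≤ N * N := Nat.mul_le_mul_right N hN2
    omega
  · subst hN
    rw [ha₃]
    refine hres.imp (fun h => ⟨h.1, matesPopular_of_perfect hy hT hM hml h.2⟩)
      fun h => ⟨h.1, fun z f hzy hf => ?_⟩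
    have hfree := hml.free h.1 h.2
    refine not_tight_of_closed (mr := σ₂.a 3) (U := fun x => σ₂.a 6 x = 0) hy hzy hf
      (fun r hr h0 => ?_) hM.inj (fun x hx hx0 r hr hA => ?_) h.1 (hUfree _ h.1 hfree) hfree
    · have h1 := hM.le r hr
      exact ⟨h1, ((hT _ (by omega) r hr).1 (hM.edge r hr h0)).1⟩
    · exact hU x hx hx0 r hr ((hT x hx r hr).2 ⟨hA, trivial⟩)

/-- Lowers prices until there is a perfect matching or there can be none; the variable `28`
records the outcome. -/
def adjustPrices : Cmd :=
  asg 27 1 ;;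
  loop 0 (var 27) (matchRound ;;
    ite (var 25) (var 3)
      (ite 0 (get 1 (var 25)) lowerPrice (asg 27 0 ;; asg 28 0))
      (asg 27 0 ;; asg 28 1))

theorem wp_adjustPrices {G : PopInstance p q} {κ W K L : ℕ} (hF : FitsInput p q κ W K) {σ : St}
    {Q : St → Prop} (hin : HasInput G κ σ) (h5 : σ.v 5 = L) (hL : p + q ≤ L * L) (hLN : L ≤ p + q)
    (hy : IsPrice q κ (σ.a 1)) (hy' : ∀ x < q, σ.a 1 x = κ)
    (hT : TableOn G κ (σ.a 1) (σ.a 2) (fun _ _ => True))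
    (hQ : ∀ τ : St, (∀ x, x < 4 → τ.v x = σ.v x) →
      τ.time ≤ σ.time + (q * κ + 1) * (700 * ((p + q) * ((p + q) * (L + 1)))) + 10 →
      (τ.v 28 = 1 ∧ MatesPopular G κ (τ.a 3) ∨
        τ.v 28 = 0 ∧ ¬ ∃ M : G.Matching, G.PopularWithPenalty κ M) → Q τ) :
    adjustPrices.wp W K Q σ := by
  have hK := hF.lt
  have hsq := hF.fits.sq
  have hword := hF.fits.word
  have hN2 := hF.fits.two_le
  obtain ⟨B, hB⟩ : ∃ B, B = (p + q) * ((p + q) * (L + 1)) := ⟨_, rfl⟩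
  rw [← hB] at hQ
  -- A matching round followed by a price change, including the control, costs at most `700 * B`.
  have hBlow : 200 * (p * q) + 200 * (p + q) + 60 + 350 * B + 20 ≤ 700 * B := by
    have h1 : B = (p + q) * ((p + q) * L) + (p + q) * (p + q) := by rw [hB]; ring
    have h2 : (p + q) * (p + q) = p * p + p * q + (q * p + q * q) := by ring
    have h3 : 2 * (p + q) ≤ (p + q) * (p + q) := Nat.mul_le_mul_right _ hN2
    have h4 : q * p = p * q := Nat.mul_comm _ _
    omega
  refine ⟨trivial, fun τ => (∀ x, x < 6 → τ.v x = σ.v x) ∧ (τ.v 27 = 0 →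
      τ.time ≤ σ.time + (q * κ + 1) * (700 * B) + 7 ∧ (τ.v 28 = 1 ∧ MatesPopular G κ (τ.a 3) ∨
        τ.v 28 = 0 ∧ ¬ ∃ M : G.Matching, G.PopularWithPenalty κ M)) ∧
      (τ.v 27 ≠ 0 → τ.a 0 = σ.a 0 ∧ IsPrice q κ (τ.a 1) ∧
        TableOn G κ (τ.a 1) (τ.a 2) (fun _ _ => True) ∧
        (∀ z f : ℕ → ℕ, IsPrice q κ z → G.IsPerfect κ z f → ∀ x, z x ≤ τ.a 1 x) ∧
        τ.time + (∑ x ∈ Finset.range q, τ.a 1 x) * (700 * B) ≤ σ.time + q * κ * (700 * B) + 7),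
    fun τ => if τ.v 27 = 0 then 0 else 1 + ∑ x ∈ Finset.range q, τ.a 1 x, ?_, ?_⟩
  · refine ⟨fun x hx => ?_, fun h => ?_, fun _ => ⟨rfl, hy, hT, fun z f hz _ x => ?_, ?_⟩⟩
    · have h1 : x ≠ 27 := by omega
      simp [h1]
    · simp at h
    · rcases Nat.lt_or_ge x q with hx | hx
      · simp only [St.asg_a, hy' x hx]
        exact hz.le x
      · rw [hz.dummy x hx]
        exact Nat.zero_le _
    · have h1 : ∑ x ∈ Finset.range q, σ.a 1 x = q * κ := by
        rw [Finset.sum_congr rfl fun x hx => hy' x (Finset.mem_range.1 hx)]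
        simp
      simp [h1]
      omega
  rintro τ ⟨fr, hdone, hgo⟩
  refine ⟨trivial, trivial, fun hlt => ?_, fun hge => ?_⟩
  swap
  · obtain ⟨h1, h2⟩ := hdone (by simpa using hge)
    exact hQ _ (fun x hx => fr x (by omega)) (by simp; omega) h2
  have h27 : τ.v 27 ≠ 0 := by
    simp only [eval_ofNat, eval_var] at hlt
    omega
  obtain ⟨ha0, hyτ, hTτ, hw, ht⟩ := hgo h27
  simp only [if_neg h27]
  have g3 : τ.v 3 = p + q := (fr 3 (by decide)).trans hin.size
  refine wp_matchRound (G := G) (L := L) hF (by exact g3)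
    (by exact (fr 5 (by decide)).trans h5) hL hLN hyτ hTτ ?_
  intro τ₁ fr₁ fa₁ ht₁ hres
  simp only [St.tick_v, St.tick_a, St.tick_time, ← hB, cost_ofNat, cost_var] at fr₁ fa₁ ht₁ hres
  have g3₁ : τ₁.v 3 = p + q := (fr₁ 3 (by decide)).trans g3
  have g27₁ : τ₁.v 27 = τ.v 27 := fr₁ 27 (by decide)
  have e0 : τ₁.a 0 = τ.a 0 := fa₁ 0 (by decide)
  have e1 : τ₁.a 1 = τ.a 1 := fa₁ 1 (by decide)
  have e2 : τ₁.a 2 = τ.a 2 := fa₁ 2 (by decide)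
  have hfinal : τ.time + 700 * B ≤ σ.time + (q * κ + 1) * (700 * B) + 7 := by
    have h1 : (q * κ + 1) * (700 * B) = q * κ * (700 * B) + 700 * B := Nat.succ_mul _ _
    have h2 := Nat.zero_le ((∑ x ∈ Finset.range q, τ.a 1 x) * (700 * B))
    omega
  refine ⟨trivial, trivial, fun h25 => ?_, fun h25 => ?_⟩
  · simp only [eval_var, g3₁] at h25
    obtain ⟨-, hz⟩ := hres.resolve_left fun h => by omega
    refine ⟨trivial, ⟨trivial, by simp; omega⟩, fun hpos => ?_, fun hzero => ?_⟩
    · simp only [eval_ofNat, eval_get, eval_var, St.tick_v, St.tick_a, e1] at hpos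
      have hb₀ : τ₁.v 25 < q := by
        by_contra hb
        have := hyτ.dummy (τ₁.v 25) (by omega)
        omega
      refine wp_lowerPrice (G := G) (κ := κ) (b₀ := τ₁.v 25) hF (hin.congr (fun x hx => ?_) ?_)
        ?_ ?_ hb₀ rfl ?_ fun τ₂ fr₂ f0 f1 hT₂ ht₂ => ?_
      · simp [fr₁ x (by omega), fr x (by omega)]
      · simp [e0, ha0]
      · simpa [e1] using hyτ
      · simp [e1]; omega
      · simpa [e1, e2] using hTτ
      simp only [St.tick_v, St.tick_a, St.tick_time, e1, cost_ofNat, cost_var, cost_get]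
        at fr₂ f0 f1 ht₂
      have g27₂ : τ₂.v 27 = τ.v 27 := (fr₂ 27 (by decide)).trans g27₁
      have hsum : ∑ x ∈ Finset.range q, τ₂.a 1 x + 1 = ∑ x ∈ Finset.range q, τ.a 1 x := by
        have hmem := Finset.mem_range.2 hb₀
        rw [← Finset.add_sum_erase _ _ hmem, ← Finset.add_sum_erase _ (τ.a 1) hmem, f1,
          Function.update_self, Finset.sum_congr rfl fun x hx =>
          Function.update_of_ne (Finset.ne_of_mem_erase hx) _ _]
        omega
      refine ⟨⟨fun x hx => ?_, fun h => absurd (g27₂ ▸ h) h27, fun _ => ⟨?_, ?_, hT₂, ?_, ?_⟩⟩, ?_⟩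
      · rw [fr₂ x (by omega), fr₁ x (by omega), fr x hx]
      · rw [f0, e0, ha0]
      · rw [f1]
        exact IsPrice.lower hyτ
      -- At the free node the supporting price is strictly smaller, so by integrality it still lies
      -- below the price lowered by one.
      · intro z f hzp hf x
        have h1 := hz z f (hw z f hzp hf) hf
        have h2 := hw z f hzp hf x
        rw [f1, Function.update_apply]
        split
        · rename_i hx
          subst hx
          omega
        · exact h2
      · rw [← hsum, Nat.succ_mul] at ht
        omega
      · simp only [g27₂, if_neg h27]
        omega
    · simp only [eval_ofNat, eval_get, eval_var, St.tick_v, St.tick_a, e1] at hzero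
      refine ⟨trivial, trivial, ⟨fun x hx => ?_, fun _ => ⟨by simp; omega, Or.inr ⟨by simp, ?_⟩⟩,
        fun h => absurd (by simp) h⟩, by simp⟩
      · have h1 : x ≠ 27 := by omega
        have h2 : x ≠ 28 := by omega
        simp [h1, h2, fr₁ x (by omega), fr x hx]
      -- Prices supporting `M` would have to be below zero at the free node.
      · rintro ⟨M, hM⟩
        obtain ⟨z, f, hzp, hf⟩ := exists_prices hM
        have := hz z f (hw z f hzp hf) hf
        omega
  · simp only [eval_var, g3₁] at h25
    obtain ⟨-, hz⟩ := hres.resolve_right fun h => by omega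
    refine ⟨trivial, trivial, ⟨fun x hx => ?_, fun _ => ⟨by simp; omega, Or.inl ⟨by simp, ?_⟩⟩,
      fun h => absurd (by simp) h⟩, by simp⟩
    · have h1 : x ≠ 27 := by omega
      have h2 : x ≠ 28 := by omega
      simp [h1, h2, fr₁ x (by omega), fr x hx]
    · simpa using hz

/-- Copies the mates of the agents to the output. -/
def writeOutput : Cmd :=
  forLoop 21 0 (ite (get 3 (var 21)) (var 1 + 1) (put 0 (var 21) (get 3 (var 21)))
    (put 0 (var 21) 0)) ;;
  asg 0 (var 28)

/-- A mate entry below `q + 1` is the successor of an object, hence already in output format; a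
larger one encodes the dummy and becomes `0`. -/
theorem wp_writeOutput {W K : ℕ} {σ : St} {Q : St → Prop} (h0 : σ.v 0 = p) (h1 : σ.v 1 = q)
    (hpK : p ≤ K) (hpW : p < W) (hqW : q + 1 < W)
    (hQ : ∀ τ : St, τ.v 0 = σ.v 28 →
      (∀ a < p, τ.a 0 a = if σ.a 3 a < q + 1 then σ.a 3 a else 0) →
      τ.time ≤ σ.time + 30 * p + 10 → Q τ) :
    writeOutput.wp W K Q σ := by
  obtain ⟨I, hI⟩ : ∃ I : ℕ → St → Prop, ∀ k τ, I k τ ↔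
      (∀ x, x ≠ 21 → τ.v x = σ.v x) ∧ τ.a 3 = σ.a 3 ∧
      (∀ a < k, τ.a 0 a = if σ.a 3 a < q + 1 then σ.a 3 a else 0) ∧
      τ.time ≤ σ.time + 30 * k + 2 := ⟨_, fun _ _ => Iff.rfl⟩
  refine wp_forLoop (n := p) I (by decide) h0 hpW ?_ ?_ ?_
  · exact (hI _ _).2 ⟨fun x hx => by simp [hx], rfl, by simp, by simp⟩
  · intro k τ hk hτ h21 h0'
    obtain ⟨fr, ha, hout, ht⟩ := (hI _ _).1 hτ
    have g1 : τ.v 1 = q := (fr 1 (by decide)).trans h1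
    simp only [wp, ok_get, ok_var, ok_add, ok_ofNat, eval_get, eval_var, eval_add, eval_ofNat,
      true_and, St.tick_v, St.tick_a, h21, g1, ha, St.put_v, h0', cost_get, cost_var, cost_add,
      cost_ofNat]
    have hk' : k < K := by omega
    refine ⟨hk', hqW, fun hlt => ⟨hk', hk', (hI _ _).2 ⟨fun x hx => by simp [hx, fr x hx],
      by simp [ha], fun a hak => ?_, by simp; omega⟩⟩, fun hge => ⟨hk', (hI _ _).2
      ⟨fun x hx => by simp [hx, fr x hx], by simp [ha], fun a hak => ?_, by simp; omega⟩⟩⟩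
    · by_cases h : a = k
      · subst h
        simp [hlt]
      · simp [h, hout a (by omega)]
    · by_cases h : a = k
      · subst h
        simp [hge]
      · simp [h, hout a (by omega)]
  · intro τ hτ
    obtain ⟨fr, ha, hout, ht⟩ := (hI _ _).1 hτ
    exact ⟨trivial, hQ _ (by simp [fr]) hout (by simp; omega)⟩

/-- The whole algorithm. -/
def popularCmd : Cmd := computeRoot ;; initTable ;; adjustPrices ;; writeOutput

theorem popularCmd_wf : popularCmd.wf = true := by decide

theorem wp_popularCmd {G : PopInstance p q} {κ W K : ℕ} (hF : FitsInput p q κ W K) {σ : St}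
    (hin : HasInput G κ σ) (h1z : ∀ i, σ.a 1 i = 0) (h2z : ∀ i, σ.a 2 i = 0) :
    popularCmd.wp W K (fun τ =>
      τ.time ≤ σ.time + (q * κ + 1) * (700 * ((p + q) * ((p + q) * (Nat.sqrt (p + q) + 2)))) +
        200 * (p * (q * q)) + 200 * (p * q) + 300 * (p + q) + 100 ∧
      (τ.v 0 = 1 ∧ (∃ M : G.Matching, G.PopularWithPenalty κ M ∧ ∀ a : Fin p, τ.a 0 a =
        match M.partner a with
        | none => 0
        | some b => (b : ℕ) + 1) ∨
      τ.v 0 = 0 ∧ ¬ ∃ M : G.Matching, G.PopularWithPenalty κ M)) σ := by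
  have hK := hF.lt
  have hsq := hF.fits.sq
  have hword := hF.fits.word
  refine wp_computeRoot hF.fits hin.size fun σ₁ fr₁ ha₁ hL hLN hLs ht₁ => ?_
  refine wp_initTable (G := G) (κ := κ) hF (hin.congr (fun x hx => fr₁ x (by omega)) (by rw [ha₁]))
    (by rw [ha₁]; exact h1z) (by rw [ha₁]; exact h2z) fun σ₂ fr₂ f0 hy' hy hT ht₂ => ?_
  have hin₂ : HasInput G κ σ₂ := hin.congr
    (fun x hx => (fr₂ x (by omega)).trans (fr₁ x (by omega))) (by rw [f0, ha₁])
  refine wp_adjustPrices (G := G) (L := σ₁.v 5) hF hin₂ (fr₂ 5 (by decide)) hL hLN hy hy' hT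
    fun σ₃ fr₃ ht₃ hres => ?_
  refine wp_writeOutput ((fr₃ 0 (by decide)).trans hin₂.agents)
    ((fr₃ 1 (by decide)).trans hin₂.objects) (by omega) (by omega) (by omega)
    fun τ hτ0 hout ht => ⟨?_, ?_⟩
  · have : (q * κ + 1) * (700 * ((p + q) * ((p + q) * (σ₁.v 5 + 1)))) ≤
        (q * κ + 1) * (700 * ((p + q) * ((p + q) * (Nat.sqrt (p + q) + 2)))) := by
      have h1 : σ₁.v 5 + 1 ≤ Nat.sqrt (p + q) + 2 := by omega
      gcongr
    show τ.time ≤ _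
    omega
  · rw [hτ0]
    refine hres.imp (fun h => ⟨h.1, ?_⟩) id
    obtain ⟨-, M, hpop, hM⟩ := h
    refine ⟨M, hpop, fun a => ?_⟩
    obtain ⟨h0, ha⟩ := hM a
    rw [hout a a.2, ha]
    by_cases h : σ₃.a 3 a - 1 < q
    · rw [dif_pos h, if_pos (by omega)]
      simp only
      omega
    · rw [dif_neg h, if_neg (by omega)]

end WordRAM

/-! ### The initial machine state and the running time. -/

namespace PopInstance

open WordRAM

variable {p q : ℕ}

open Classical in
theorem inputMem_adj (G : PopInstance p q) {a b : ℕ} (ha : a < p) (hb : b < q) :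
    G.inputMem (a * q + b) = G.adjVal a b := by
  unfold inputMem adjVal
  refine if_congr ⟨?_, fun ⟨h1, h2, h⟩ => Or.inl ⟨⟨a, h1⟩, ⟨b, h2⟩, rfl, h⟩⟩ rfl rfl
  have h1 := prod_idx_lt ha hb
  rintro (⟨a', b', h, hadj⟩ | ⟨a', b', b'', h, -⟩)
  · obtain ⟨rfl, rfl⟩ := cell_inj hb b'.2 h
    exact ⟨a'.2, b'.2, hadj⟩
  · omega

open Classical in
theorem inputMem_pref (G : PopInstance p q) {a b b' : ℕ} (ha : a < p) (hb : b < q) (hb' : b' < q) :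
    G.inputMem (p * q + ((a * q + b) * q + b')) = G.prefVal a b b' := by
  unfold inputMem prefVal
  refine if_congr ⟨?_, fun ⟨h1, h2, h3, h⟩ => Or.inr ⟨⟨a, h1⟩, ⟨b, h2⟩, ⟨b', h3⟩, rfl, h⟩⟩ rfl rfl
  rintro (⟨c, d, h, -⟩ | ⟨c, d, d', h, hpref⟩)
  · have := prod_idx_lt c.2 d.2
    omega
  · obtain ⟨h1, rfl⟩ := cell_inj hb' d'.2 (Nat.add_left_cancel h)
    obtain ⟨rfl, rfl⟩ := cell_inj hb d.2 h1
    exact ⟨c.2, d.2, d'.2, hpref⟩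

theorem inputMem_of_le (G : PopInstance p q) {i : ℕ} (hi : p * q + p * q * q ≤ i) :
    G.inputMem i = 0 := by
  unfold inputMem
  refine if_neg ?_
  rintro (⟨a, b, rfl, -⟩ | ⟨a, b, b', rfl, -⟩)
  · have := prod_idx_lt a.2 b.2
    omega
  · have := prod_idx_lt (prod_idx_lt a.2 b.2) b'.2
    omega

theorem inputMem_le_one (G : PopInstance p q) (i : ℕ) : G.inputMem i ≤ 1 := by
  unfold inputMem
  split <;> omega

end PopInstance

namespace WordRAM

open PopInstance

variable {p q : ℕ}

/-- The sizes `N ^ 4` of the arrays and `N ^ 10` of the words suffice. -/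
theorem fitsInput {κ : ℕ} (h1 : 1 ≤ κ) (hlt : κ < p + q) :
    FitsInput p q κ ((p + q) ^ 10) ((p + q) ^ 4) := by
  have key : ∀ N : ℕ, 2 ≤ N → Fits N (N ^ 10) (N ^ 4) ∧ N * N + N * N * N ≤ N ^ 4 := by
    intro N hN
    have e2 : 2 * N ≤ N * N := Nat.mul_le_mul_right N hN
    have e3 : 2 * (N * N) ≤ N * N * N := by
      rw [Nat.mul_comm]
      exact Nat.mul_le_mul_left _ hN
    have e4 : 2 * (N * N * N) ≤ N ^ 4 := by
      rw [show N ^ 4 = N * (N * N * N) by ring]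
      exact Nat.mul_le_mul_right _ hN
    have h6 : 2 ^ 6 ≤ N ^ 6 := Nat.pow_le_pow_left hN 6
    -- The factor `N ^ 6 ≥ 64` makes room for the sixteen arrays of length `N ^ 4`.
    refine ⟨⟨hN, by omega, ?_⟩, by omega⟩
    calc 16 * N ^ 4 ≤ N ^ 6 * N ^ 4 := Nat.mul_le_mul_right _ (by omega)
      _ = N ^ 10 := by ring
  obtain ⟨hfits, hin⟩ := key (p + q) (by omega)
  refine ⟨hfits, le_trans ?_ hin, h1, hlt⟩
  gcongr <;> omega

/-- The program: computes `N` and the array size, and runs the algorithm. -/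
def popularProg : Prog :=
  .seq (.add 3 0 1) (.seq (.mul 40 3 3) (.seq (.mul 40 40 40) popularCmd.code))

theorem exec_popularProg {κ : ℕ} (G : PopInstance p q) (h1 : 1 ≤ κ) (hlt : κ < p + q) :
    ∃ t s, Exec ((p + q) ^ 10) popularProg (G.inputState κ) t s ∧
      t ≤ (q * κ + 1) * (700 * ((p + q) * ((p + q) * (Nat.sqrt (p + q) + 2)))) +
        200 * (p * (q * q)) + 200 * (p * q) + 300 * (p + q) + 103 ∧
      (s.reg 0 = 1 ∧ (∃ M : G.Matching, G.PopularWithPenalty κ M ∧ Outputs s M) ∨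
        s.reg 0 = 0 ∧ ¬ ∃ M : G.Matching, G.PopularWithPenalty κ M) := by
  have hF := fitsInput h1 hlt
  obtain ⟨N, hN⟩ : ∃ N, N = p + q := ⟨_, rfl⟩
  obtain ⟨K, hK⟩ : ∃ K, K = (p + q) ^ 4 := ⟨_, rfl⟩
  obtain ⟨W, hW⟩ : ∃ W, W = (p + q) ^ 10 := ⟨_, rfl⟩
  rw [← hK, ← hW] at hF
  have hin := hF.input
  have hword := hF.fits.word
  have hsq := hF.fits.sq
  have hN2 := hF.fits.two_le
  have hW256 : 256 ≤ W := by
    have : 2 ^ 10 ≤ (p + q) ^ 10 := Nat.pow_le_pow_left hN2 10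
    omega
  have hNK : (p + q) * (p + q) * ((p + q) * (p + q)) = K := by rw [hK]; ring
  obtain ⟨r, hr⟩ : ∃ r, r = Function.update (Function.update (inputReg p q κ) 3 (p + q)) 40 K :=
    ⟨_, rfl⟩
  have hr3 : ∀ x, x ≠ 3 → x ≠ 40 → r x = inputReg p q κ x := fun x hx hx' => by
    rw [hr, Function.update_of_ne hx', Function.update_of_ne hx]
  have hpre : ∀ {t s}, Exec W popularCmd.code ⟨r, G.inputMem⟩ t s →
      Exec W popularProg (G.inputState κ) (1 + (1 + (1 + t))) s := fun h => by
    refine .seq (.add _ 3 0 1 ?_) (.seq (.mul _ 40 3 3 ?_) (.seq (.mul _ 40 40 40 ?_) ?_))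
    · simp only [inputState, inputReg]
      omega
    · simp [inputState, State.setReg, inputReg]
      omega
    · simp [inputState, State.setReg, inputReg, hNK]
      omega
    · convert h using 2
      · simp [inputState, State.setReg, inputReg, hNK, hr]
      · rfl
  -- The memory is cut into blocks of length `K`. The whole input lies in block `0`, which also
  -- receives the output, so the blocks for the prices and the table start out as zero.
  let σ : St := ⟨r, fun j i => G.inputMem (j * K + i), 0⟩
  have hinput : HasInput G κ σ := by
    refine ⟨hr3 0 (by decide) (by decide), hr3 1 (by decide) (by decide),
      hr3 2 (by decide) (by decide), by simp [σ, hr], fun a ha b hb => ?_,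
      fun a ha b hb b' hb' => ?_⟩
    · simpa [σ] using G.inputMem_adj ha hb
    · simpa [σ] using G.inputMem_pref ha hb hb'
  have hrel : Rel W K ⟨r, G.inputMem⟩ σ := by
    refine ⟨fun _ _ => rfl, by simp [hr], fun _ _ _ _ => rfl, fun x hx => ?_, fun j _ i _ => ?_⟩
    · show r x < W
      by_cases h : x = 3
      · subst h
        simp [hr]
        omega
      · rw [hr3 x h (by omega)]
        unfold inputReg
        have := hF.lt
        split <;> omega
    · have := G.inputMem_le_one (j * K + i)
      show G.inputMem (j * K + i) < W
      omega
  obtain ⟨t, s, σ', hx, hs, ⟨ht, hres⟩, ht'⟩ := Cmd.wp_sound hword hW256 popularCmd popularCmd_wf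
    _ σ _ (wp_popularCmd hF hinput (fun i => G.inputMem_of_le (by omega))
      (fun i => G.inputMem_of_le (by omega))) hrel
  have hσ : σ.time = 0 := rfl
  refine ⟨_, s, hW ▸ hpre hx, by omega, ?_⟩
  rw [hs.reg 0 (by decide)]
  refine hres.imp (fun h => ⟨h.1, ?_⟩) id
  obtain ⟨-, M, hpop, hM⟩ := h
  refine ⟨M, hpop, fun a => ?_⟩
  have := hs.mem 0 (by decide) a (by omega)
  rw [Nat.zero_mul, Nat.zero_add] at this
  exact this.trans (hM a)

/-- With `q * κ + 1 ≤ 2 * N * κ` and `√N + 2 ≤ 3 * √N` (rounded down), the rounds cost at most `4200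
* N ^ 3 * √N * κ`, and the other terms are of order `N ^ 3`. This is linear in `κ`; the exponent `5
/ 2` enters only through `κ ≤ κ ^ (5 / 2)`. -/
theorem step_bound {κ t : ℕ} (h1 : 1 ≤ κ) (hlt : κ < p + q)
    (ht : t ≤ (q * κ + 1) * (700 * ((p + q) * ((p + q) * (Nat.sqrt (p + q) + 2)))) +
      200 * (p * (q * q)) + 200 * (p * q) + 300 * (p + q) + 103) :
    (t : ℝ) ≤ 6000 * ((p + q : ℕ) : ℝ) ^ (7 / 2 : ℝ) * (κ : ℝ) ^ (5 / 2 : ℝ) := by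
  have hN : 2 ≤ p + q := by omega
  have hp : p ≤ p + q := by omega
  have hq : q ≤ p + q := by omega
  generalize p + q = N at *
  have hs1 : 1 ≤ Nat.sqrt N := Nat.le_sqrt.2 (by omega)
  have hnat : t ≤ 6000 * (N ^ 3 * Nat.sqrt N) * κ := by
    generalize Nat.sqrt N = s at *
    have hNκ : q * κ + 1 ≤ 2 * (N * κ) := by
      have e1 : q * κ ≤ N * κ := Nat.mul_le_mul_right κ hq
      have e2 : 1 * 1 ≤ N * κ := Nat.mul_le_mul (by omega) h1
      omega
    have hs3 : s + 2 ≤ 3 * s := by omega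
    have hmain : (q * κ + 1) * (700 * (N * (N * (s + 2)))) ≤ 4200 * (N ^ 3 * s * κ) :=
      calc (q * κ + 1) * (700 * (N * (N * (s + 2)))) ≤
            2 * (N * κ) * (700 * (N * (N * (3 * s)))) := by gcongr
        _ = 4200 * (N ^ 3 * s * κ) := by ring
    have hsκ : N ^ 3 ≤ N ^ 3 * s * κ := by
      rw [Nat.mul_assoc]
      exact Nat.le_mul_of_pos_right _ (Nat.mul_pos hs1 h1)
    have h3 : p * (q * q) ≤ N ^ 3 := by
      calc p * (q * q) ≤ N * (N * N) := by gcongr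
        _ = N ^ 3 := by ring
    have h2 : p * q ≤ N * N := Nat.mul_le_mul hp hq
    have e2 : 2 * N ≤ N * N := Nat.mul_le_mul_right N hN
    have e3 : 2 * (N * N) ≤ N ^ 3 := by
      rw [show N ^ 3 = N * (N * N) by ring]
      exact Nat.mul_le_mul_right _ hN
    have e4 : 6000 * (N ^ 3 * s) * κ = 6000 * (N ^ 3 * s * κ) := by ring
    omega
  have hN0 : (0 : ℝ) < N := by exact_mod_cast (by omega : 0 < N)
  have hpow : (N : ℝ) ^ (7 / 2 : ℝ) = (N : ℝ) ^ 3 * Real.sqrt N := by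
    rw [Real.sqrt_eq_rpow, ← Real.rpow_natCast, ← Real.rpow_add hN0]
    norm_num
  have hκ : (κ : ℝ) ≤ (κ : ℝ) ^ (5 / 2 : ℝ) :=
    Real.self_le_rpow_of_one_le (by exact_mod_cast h1) (by norm_num)
  calc (t : ℝ) ≤ 6000 * ((N : ℝ) ^ 3 * (Nat.sqrt N : ℝ)) * κ := by exact_mod_cast hnat
    _ ≤ 6000 * ((N : ℝ) ^ 3 * Real.sqrt N) * (κ : ℝ) ^ (5 / 2 : ℝ) := by
      gcongr
      exact Real.nat_sqrt_le_real_sqrt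
    _ = 6000 * (N : ℝ) ^ (7 / 2 : ℝ) * (κ : ℝ) ^ (5 / 2 : ℝ) := by rw [hpow]

end WordRAM

theorem mainTheorem10 :
    ∃ (P : WordRAM.Prog) (c : ℕ) (C : ℝ),
      ∀ (p q κ : ℕ) (G : PopInstance p q), 1 ≤ κ → κ < p + q →
        ∃ (t : ℕ) (s : WordRAM.State),
          WordRAM.Exec ((p + q) ^ c) P (G.inputState κ) t s ∧
          (t : ℝ) ≤ C * ((p + q : ℕ) : ℝ) ^ (7 / 2 : ℝ) * (κ : ℝ) ^ (5 / 2 : ℝ) ∧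
          ((∃ M : G.Matching, G.PopularWithPenalty κ M) →
            s.reg 0 = 1 ∧ ∃ M : G.Matching, G.PopularWithPenalty κ M ∧ PopInstance.Outputs s M) ∧
          ((¬ ∃ M : G.Matching, G.PopularWithPenalty κ M) → s.reg 0 = 0) := by
  refine ⟨WordRAM.popularProg, 10, 6000, fun p q κ G h1 hlt => ?_⟩
  obtain ⟨t, s, hx, ht, hres⟩ := WordRAM.exec_popularProg G h1 hlt
  refine ⟨t, s, hx, WordRAM.step_bound h1 hlt ht, fun hM => ?_, fun hM => ?_⟩
  · rcases hres with h | h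
    · exact h
    · exact absurd hM h.2
  · rcases hres with ⟨-, M, hpop, -⟩ | h
    · exact absurd ⟨M, hpop⟩ hM
    · exact h.1
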